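/- Let $K$ be an algebraically closed field, $n\ge 0$, and $K[[X]]=K[[x_1,\dots,x_n]]$. A monic polynomial $f\in K[[X]][y]$ is a *Puiseux polynomial* if $f=\prod_{i=1}^d (y-\xi_i)$ with $\xi_1,\dots,\xi_d\in\bigcup_{m\ge 1}K[[x_1^{1/m},\dots,x_n^{1/m}]]$. The *normalization* $\mathcal N(D)$ of a domain $D$ is its integral closure in its field of fractions. Two points given by maximal ideals $\mathfrak m\subset A$, $\mathfrak m'\subset A'$ of $K$-algebras are *analytically isomorphic* if the completions $\varprojlim_k A/\mathfrak m^k$ and $\varprojlim_k A'/\mathfrak m'^k$ are isomorphic as $K$-algebras; for a local ring the maximal ideal is understood. A *simplicial pair* $(M,\sigma)$ consists of a finitely generated subgroup $M$ of $\mathbb Q^n$ with $\mathbb Z^n\subseteq M$, and a cone $\sigma\subset\mathbb R^n$ generated by $n$ linearly independent vectors of $\mathbb Z^n$. The *special point* of the affine toric variety $\operatorname{Spec}K[M\cap\sigma]$ is the maximal ideal generated by the monomials $x^\alpha$, $0\ne\alpha\in M\cap\sigma$. An *$n$-dimensional Hirzebruch–Jung singularity* is a Noetherian local $K$-algebra that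 is a normal domain, is not regular, and is analytically isomorphic to the special point of $\operatorname{Spec}K[M\cap\sigma]$ for some simplicial pair $(M,\sigma)$ in dimension $n$. 1. Let $f\in K[[X]][y]$ be an irreducible (monic) Puiseux polynomial such that $\operatorname{char}K\nmid\deg f$. Then $\mathcal N(K[[X]][y]/(f))$ is a local ring, and it is either regular or an $n$-dimensional Hirzebruch–Jung singularity. 2. Conversely, every $n$-dimensional Hirzebruch–Jung singularity $R$ is analytically isomorphic to $\mathcal N(K[[X]][y]/(f))$, which is a local ring, for some irreducible (monic) Puiseux polynomial $f\in K[[X]][y]$. If moreover $R$ is analytically isomorphic to the special point of $\operatorname{Spec}K[M\cap\sigma]$ and $\operatorname{char}K$ does not divide the index in $M$ of the subgroup generated by the points of $M$ on the lines spanned by the rays of $\sigma$ (which always holds in characteristic $0$), then $f$ can be chosen with $\operatorname{char}K\nmid\deg f$. -/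

import Mathlib

open Polynomial

namespace PuiseuxHypersurface

universe u v w

/-- A monic `f ∈ K[[x₁,…,xₙ]][y]` is a Puiseux polynomial if it is a product of linear factors
`y - ξᵢ` with `ξᵢ ∈ ⋃ₘ K[[x₁^{1/m},…,xₙ^{1/m}]]`. The (finitely many) `ξᵢ` have a common
denominator `m`, and `K[[x₁^{1/m},…,xₙ^{1/m}]]` is the power series ring `K[[t₁,…,tₙ]]` regarded as
an extension of `K[[x₁,…,xₙ]]` through the embedding `xᵢ ↦ tᵢ ^ m`, which is
`MvPowerSeries.expand m`. -/
def IsPuiseux {K : Type u} [Field K] {n : ℕ} (f : (MvPowerSeries (Fin n) K)[X]) : Prop :=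
  f.Monic ∧ ∃ (m : ℕ) (hm : m ≠ 0) (d : ℕ) (ξ : Fin d → MvPowerSeries (Fin n) K),
    f.map (MvPowerSeries.expand (R := K) (σ := Fin n) m hm).toRingHom = ∏ i, (X - C (ξ i))

/-- The normalization of a domain: its integral closure in its field of fractions. -/
abbrev Normalization (D : Type u) [CommRing D] : Type u :=
  integralClosure D (FractionRing D)

/-- The points given by the maximal ideals `I ⊆ A` and `J ⊆ B` are analytically isomorphic over
`K` if the completions of `A` at `I` and of `B` at `J` are isomorphic `K`-algebras. -/
def AnalyticallyIsomorphic (K : Type u) [Field K] {A : Type v} [CommRing A] [Algebra K A]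
    (I : Ideal A) {B : Type w} [CommRing B] [Algebra K B] (J : Ideal B) : Prop :=
  Nonempty (AdicCompletion I A ≃ₐ[K] AdicCompletion J B)

/-- The convex cone in `ℝⁿ` generated by the integer vectors `v₁, …, vₙ`. -/
noncomputable def cone {n : ℕ} (v : Fin n → Fin n → ℤ) : PointedCone ℝ (Fin n → ℝ) :=
  PointedCone.hull ℝ (Set.range fun i j => (v i j : ℝ))

/-- The semigroup `M ∩ σ`, for a subgroup `M` of `ℚⁿ` and a cone `σ` in `ℝⁿ`. -/
def semigroup {n : ℕ} (M : AddSubgroup (Fin n → ℚ)) (σ : PointedCone ℝ (Fin n → ℝ)) :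
    AddSubmonoid (Fin n → ℚ) where
  carrier := {α | α ∈ M ∧ (fun i => (α i : ℝ)) ∈ σ}
  zero_mem' := ⟨M.zero_mem, by
    have h : (fun i => (((0 : Fin n → ℚ) i : ℚ) : ℝ)) = 0 := by ext; simp
    rw [h]; exact σ.zero_mem⟩
  add_mem' := by
    rintro a b ⟨ha, ha'⟩ ⟨hb, hb'⟩
    refine ⟨M.add_mem ha hb, ?_⟩
    have h : (fun i => (((a + b) i : ℚ) : ℝ)) = (fun i => (a i : ℝ)) + fun i => (b i : ℝ) := by
      ext; simp
    rw [h]; exact σ.add_mem ha' hb'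

/-- The special ideal of the semigroup algebra `K[S]`, generated by the monomials `x ^ α` with
`0 ≠ α ∈ S`. -/
noncomputable def specialIdeal (K : Type u) [Field K] {n : ℕ} (S : AddSubmonoid (Fin n → ℚ)) :
    Ideal (AddMonoidAlgebra K S) :=
  Ideal.span {p | ∃ α : S, α ≠ 0 ∧ p = AddMonoidAlgebra.single α 1}

/-- `M` is a lattice in `ℚⁿ` containing `ℤⁿ`, and `v₁, …, vₙ` are linearly independent integer
vectors, so that they generate a rational simplicial cone of maximal dimension in `ℝⁿ`. -/
structure IsSimplicialPair {n : ℕ} (M : AddSubgroup (Fin n → ℚ)) (v : Fin n → Fin n → ℤ) :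
    Prop where
  fg : M.FG
  int_mem : ∀ a : Fin n → ℤ, (fun i => (a i : ℚ)) ∈ M
  linearIndependent : LinearIndependent ℝ fun i j => (v i j : ℝ)

/-- The sublattice of `M` generated by the points of `M` on the lines through `v₁, …, vₙ`,
equivalently by the primitive generators in `M` of the rays of the cone over `v₁, …, vₙ`. -/
def rayLattice {n : ℕ} (M : AddSubgroup (Fin n → ℚ)) (v : Fin n → Fin n → ℤ) :
    AddSubgroup (Fin n → ℚ) :=
  AddSubgroup.closure {α | α ∈ M ∧ ∃ (i : Fin n) (t : ℚ), α = fun j => t * (v i j : ℚ)}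

/-- The local `K`-algebra `R` is a Hirzebruch–Jung singularity with toric model `(M, σ)`, where
`σ` is the cone over `v₁, …, vₙ`: it is Noetherian, a normal domain, singular, and analytically
isomorphic to the special point of the affine toric variety `Spec K[M ∩ σ]`. -/
structure IsHirzebruchJungOf (K : Type u) [Field K] {n : ℕ} (M : AddSubgroup (Fin n → ℚ))
    (v : Fin n → Fin n → ℤ) (R : Type w) [CommRing R] [Algebra K R] [IsLocalRing R] :
    Prop where
  pair : IsSimplicialPair M v
  noetherian : IsNoetherianRing R
  domain : IsDomain R
  normal : IsIntegrallyClosed R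
  singular : ¬ IsRegularLocalRing R
  analyticallyIsomorphic : AnalyticallyIsomorphic K (IsLocalRing.maximalIdeal R)
    (specialIdeal K (semigroup M (cone v)))

/-- The local `K`-algebra `R` is an `n`-dimensional Hirzebruch–Jung singularity. -/
def IsHirzebruchJung (K : Type u) [Field K] (n : ℕ) (R : Type w) [CommRing R] [Algebra K R]
    [IsLocalRing R] : Prop :=
  ∃ (M : AddSubgroup (Fin n → ℚ)) (v : Fin n → Fin n → ℤ), IsHirzebruchJungOf K M v R

end PuiseuxHypersurface

/-! Let A = K[[x]] be embedded in a second power series ring C = K[[t]] by xᵢ ↦ tᵢ ^ N uᵢ with units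
uᵢ, and let f be irreducible with a root ξ in C. Since C is normal and integral over A, the
normalization of A[y]/(f) is the set of elements of C lying in Frac(A)(ξ)
(`nonempty_normalization_equiv`). Let T be the set of nonnegative points of a lattice P with N ℤⁿ ⊆
P ⊆ ℤⁿ. If the units and ξ lie in K[[T]] and Frac(A)(ξ) contains all monomials with exponents in T,
this normalization is K[[T]] (`nonempty_normalization_equiv_supported`). The ring K[[T]] is local
and Noetherian, and it has the same completion as the semigroup algebra at its special point
(`analyticallyIsomorphic_supported`). Both directions thus become questions about fields generated
by monomials.

Direct part: a degree prime to the characteristic makes f separable, and a separable root cannot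
need p-th roots of the variables (`exists_root_of_separable`). So there is a root in K[[x^{1/N}]]
with N prime to p. The monomials with exponents in {0, …, N - 1}ⁿ form a Kummer basis, on which
automorphisms act by roots of unity in K. Hence Frac(A)(ξ) contains each basis monomial that occurs
in ξ with nonzero coefficient (`radical_mem_of_sum_mem`), and P is the lattice of Laurent exponents
in that field.

Converse, tame case: with N the index of the ray lattice, the monomial field is an intermediate
field of a Kummer extension. It has a primitive element in C, whose minimal polynomial splits and
has degree dividing N ^ n (`exists_isPuiseux_of_natCast_ne_zero`).

Converse, general case: the monomial field may be inseparable over Frac(A) and need not be simple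
when uᵢ = 1. The freedom in the units repairs this: with N = p ^ k m, the choice uᵢ = wᵢ ^ m, where
wᵢ is a polynomial in the earlier variables, makes a single monomial a generator
(`exists_triangular_units`). Its minimal polynomial is still Puiseux: some p ^ e-th power of the
root comes from an extension of degree prime to p, where everything splits, and K is perfect
(`isPuiseux_of_pow_mem_range`). -/

namespace PuiseuxHypersurface

/-! ### Power series rings over a field are integrally closed. -/

section Normal

open MvPowerSeries

variable {n : ℕ} {K : Type*} [Field K]

/-- Division of power series: the remainder has no monomial divisible by the initial one of `b`. -/
theorem exists_division (b a : MvPowerSeries (Fin n) K) {d : Fin n →₀ ℕ}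
    (hd : lexOrder b = toLex d) :
    ∃ c : MvPowerSeries (Fin n) K, ∀ γ, coeff (d + γ) (a - b * c) = 0 := by
  classical
  have hb : coeff d b ≠ 0 := coeff_ne_zero_of_lexOrder hd.symm
  let wf : WellFounded fun x y : Fin n →₀ ℕ => toLex x < toLex y :=
    InvImage.wf toLex (wellFounded_lt (α := Lex (Fin n →₀ ℕ)))
  -- Recursion along the lexicographic order: the coefficient of b * c at d + γ involves c at γ with
  -- the invertible factor `coeff d b`, and otherwise only c at smaller exponents. A term with a
  -- larger exponent of c would need an exponent of b below d.
  let F : (γ : Fin n →₀ ℕ) → ((ε : Fin n →₀ ℕ) → toLex ε < toLex γ → K) → K := fun γ rec =>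
    (coeff d b)⁻¹ * (coeff (d + γ) a - ∑ x ∈ Finset.HasAntidiagonal.antidiagonal (d + γ),
      if h : toLex x.2 < toLex γ then coeff x.1 b * rec x.2 h else 0)
  let c : MvPowerSeries (Fin n) K := fun γ => wf.fix F γ
  have hc : ∀ γ, coeff γ c = (coeff d b)⁻¹ * (coeff (d + γ) a -
      ∑ x ∈ Finset.HasAntidiagonal.antidiagonal (d + γ),
        if toLex x.2 < toLex γ then coeff x.1 b * coeff x.2 c else 0) := by
    intro γ
    change wf.fix F γ = _
    rw [wf.fix_eq]
    simp only [F, dite_eq_ite]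
    rfl
  refine ⟨c, fun γ => ?_⟩
  rw [map_sub, MvPowerSeries.coeff_mul, sub_eq_zero]
  have hmem : (d, γ) ∈ Finset.HasAntidiagonal.antidiagonal (d + γ) := by simp
  have key : ∀ x ∈ Finset.HasAntidiagonal.antidiagonal (d + γ), x ≠ (d, γ) →
      coeff x.1 b * coeff x.2 c =
        if toLex x.2 < toLex γ then coeff x.1 b * coeff x.2 c else 0 := by
    rintro ⟨u, v⟩ hx hne
    split_ifs with h
    · rfl
    · rw [Finset.HasAntidiagonal.mem_antidiagonal] at hx
      simp only at hx h
      have hu : toLex u < toLex d := by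
        by_contra hu
        have h1 : toLex d ≤ toLex u := not_lt.mp hu
        have h2 : toLex γ ≤ toLex v := not_lt.mp h
        have h3 : toLex u + toLex v = toLex d + toLex γ := congrArg toLex hx
        have h4 : toLex d = toLex u := by
          by_contra hne'
          have := add_lt_add_of_lt_of_le (lt_of_le_of_ne h1 hne') h2
          exact absurd h3 (ne_of_gt this)
        have h5 : d = u := toLex.injective h4
        subst h5
        exact hne (by rw [add_left_cancel hx])
      rw [coeff_eq_zero_of_lt_lexOrder (d := u), zero_mul]
      rw [hd]; exact_mod_cast hu
  rw [← Finset.add_sum_erase _ _ hmem,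
    Finset.sum_congr rfl fun x hx => key x (Finset.mem_of_mem_erase hx) (Finset.ne_of_mem_erase hx)]
  have h0 := hc γ
  rw [← Finset.add_sum_erase _ _ hmem] at h0
  simp only [lt_irrefl, if_false, zero_add] at h0
  rw [h0, mul_inv_cancel_left₀ hb]
  ring

theorem lexOrder_pow {φ : MvPowerSeries (Fin n) K} {x : Fin n →₀ ℕ} (hx : lexOrder φ = toLex x)
    (k : ℕ) : lexOrder (φ ^ k) = toLex (k • x) := by
  induction k with
  | zero =>
    refine le_antisymm ?_ ?_
    · simpa using lexOrder_le_of_coeff_ne_zero (φ := (1 : MvPowerSeries (Fin n) K)) (d := 0)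
    · rw [le_lexOrder_iff]
      intro y hy
      simp at hy
  | succ k ih => rw [pow_succ, lexOrder_mul, ih, hx, succ_nsmul]; rfl

/-- Comparing initial exponents gives k d ≤ e + k x for every k, where e is the initial exponent of
δ; for large k the bounded term e cannot compensate a coordinate with x < d. -/
theorem le_of_forall_pow_dvd {r b δ : MvPowerSeries (Fin n) K} {d x : Fin n →₀ ℕ}
    (hd : lexOrder b = toLex d) (hx : lexOrder r = toLex x) (hδ : δ ≠ 0)
    (h : ∀ k, b ^ k ∣ δ * r ^ k) : d ≤ x := by
  obtain ⟨e, he⟩ := exists_finsupp_eq_lexOrder_of_ne_zero hδ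
  have hr : r ≠ 0 := by rintro rfl; simp at hx
  intro i
  by_contra hlt
  push Not at hlt
  -- This is the first k for which k (dᵢ - xᵢ) ≥ k already exceeds eᵢ.
  obtain ⟨c, hc⟩ := h (e i + 1)
  have hc0 : c ≠ 0 := by
    rintro rfl
    rw [mul_zero] at hc
    exact mul_ne_zero hδ (pow_ne_zero _ hr) hc
  obtain ⟨y, hy⟩ := exists_finsupp_eq_lexOrder_of_ne_zero hc0
  have h1 := congrArg lexOrder hc
  rw [lexOrder_mul, lexOrder_mul, lexOrder_pow hx, lexOrder_pow hd, he, hy] at h1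
  have h2 : e + (e i + 1) • x = (e i + 1) • d + y := by
    have : toLex (e + (e i + 1) • x) = toLex ((e i + 1) • d + y) := by exact_mod_cast h1
    exact toLex.injective this
  have h3 := DFunLike.congr_fun h2 i
  simp only [Finsupp.add_apply, Finsupp.smul_apply, smul_eq_mul] at h3
  nlinarith

/-- An integral fraction a / b is almost integral, and so is r / b for the remainder r of a modulo
b. If r were nonzero, its initial exponent would be divisible by that of b, which the division
excludes. -/
instance isIntegrallyClosed_mvPowerSeries : IsIntegrallyClosed (MvPowerSeries (Fin n) K) := by
  rw [isIntegrallyClosed_iff (FractionRing (MvPowerSeries (Fin n) K))]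
  intro x hx
  obtain ⟨a, b, hb, rfl⟩ := IsFractionRing.div_surjective (A := MvPowerSeries (Fin n) K) x
  have hb0 : b ≠ 0 := nonZeroDivisors.ne_zero hb
  have hb1 : algebraMap _ (FractionRing (MvPowerSeries (Fin n) K)) b ≠ 0 := by simpa using hb0
  obtain ⟨d, hd⟩ := exists_finsupp_eq_lexOrder_of_ne_zero hb0
  obtain ⟨c, hc⟩ := exists_division b a hd
  by_cases hr : a - b * c = 0
  · exact ⟨c, by rw [sub_eq_zero.mp hr, map_mul, mul_div_cancel_left₀ _ hb1]⟩
  exfalso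
  obtain ⟨x, hx'⟩ := exists_finsupp_eq_lexOrder_of_ne_zero hr
  have hinteg : IsIntegral (MvPowerSeries (Fin n) K)
      (algebraMap _ (FractionRing (MvPowerSeries (Fin n) K)) (a - b * c) / algebraMap _ _ b) := by
    have := hx.sub (isIntegral_algebraMap (x := c))
    rwa [map_sub, map_mul, sub_div, mul_div_cancel_left₀ _ hb1]
  obtain ⟨δ, hδ, hδ'⟩ := hinteg.isAlmostIntegral
  have hle : d ≤ x := by
    refine le_of_forall_pow_dvd hd hx' (nonZeroDivisors.ne_zero hδ) fun k => ?_
    obtain ⟨y, hy⟩ := hδ' k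
    refine ⟨y, IsFractionRing.injective _ (FractionRing (MvPowerSeries (Fin n) K)) ?_⟩
    rw [Algebra.smul_def, div_pow, ← mul_div_assoc, eq_div_iff (pow_ne_zero _ hb1)] at hy
    simp only [map_mul, map_pow]
    rw [← hy, mul_comm]
  obtain ⟨γ, rfl⟩ := le_iff_exists_add.mp hle
  exact coeff_ne_zero_of_lexOrder hx'.symm (hc γ)

end Normal

/-! ### Power series with exponents in a monoid. -/

section Supported

open MvPowerSeries

variable {n : ℕ} (K : Type*) [Field K]

/-- The ring `K[[T]]` of power series all of whose exponents lie in the monoid `T`. -/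
def supported (T : AddSubmonoid (Fin n →₀ ℕ)) : Subalgebra K (MvPowerSeries (Fin n) K) where
  carrier := {g | ∀ α, α ∉ T → coeff α g = 0}
  mul_mem' := by
    classical
    intro a b ha hb α hα
    rw [MvPowerSeries.coeff_mul]
    refine Finset.sum_eq_zero fun x hx => ?_
    rw [Finset.HasAntidiagonal.mem_antidiagonal] at hx
    by_cases h1 : x.1 ∈ T
    · by_cases h2 : x.2 ∈ T
      · exact absurd (hx ▸ T.add_mem h1 h2) hα
      · rw [hb _ h2, mul_zero]
    · rw [ha _ h1, zero_mul]
  add_mem' := by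
    intro a b ha hb α hα
    rw [map_add, ha α hα, hb α hα, add_zero]
  algebraMap_mem' := by
    classical
    intro r α hα
    rw [MvPowerSeries.algebraMap_apply, MvPowerSeries.coeff_C, if_neg]
    rintro rfl
    exact hα T.zero_mem

variable {K} {T : AddSubmonoid (Fin n →₀ ℕ)}

theorem mem_supported {g : MvPowerSeries (Fin n) K} :
    g ∈ supported K T ↔ ∀ α, α ∉ T → coeff α g = 0 := Iff.rfl

theorem monomial_mem_supported {α : Fin n →₀ ℕ} (hα : α ∈ T) (r : K) :
    monomial α r ∈ supported K T := by
  classical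
  intro β hβ
  rw [MvPowerSeries.coeff_monomial, if_neg]
  rintro rfl
  exact hβ hα

/-- The monoid `T` is the set of nonnegative points of a group. -/
def IsFull (T : AddSubmonoid (Fin n →₀ ℕ)) : Prop := ∀ α ∈ T, ∀ β, α + β ∈ T → β ∈ T

/-- Let θ' be the part of θ with exponents in T. Fullness kills the coefficients of a * (θ - θ') at
exponents in T, and the others vanish because a * θ and a * θ' are supported in T. So θ = θ'. -/
theorem mem_supported_of_mul_mem (hT : IsFull T) {a θ : MvPowerSeries (Fin n) K}
    (ha : a ∈ supported K T) (ha0 : a ≠ 0) (h : a * θ ∈ supported K T) : θ ∈ supported K T := by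
  classical
  let θ' : MvPowerSeries (Fin n) K := fun α => if α ∈ T then coeff α θ else 0
  have hθ' : ∀ α, coeff α θ' = if α ∈ T then coeff α θ else 0 := fun α => rfl
  have hmem : θ' ∈ supported K T := fun α hα => by rw [hθ', if_neg hα]
  suffices a * (θ - θ') = 0 by
    rw [mul_eq_zero, or_iff_right ha0, sub_eq_zero] at this
    rwa [this]
  ext α
  rw [map_zero]
  by_cases hα : α ∈ T
  · rw [MvPowerSeries.coeff_mul]
    refine Finset.sum_eq_zero fun x hx => ?_
    rw [Finset.HasAntidiagonal.mem_antidiagonal] at hx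
    by_cases h1 : x.1 ∈ T
    · have h2 : x.2 ∈ T := hT _ h1 _ (hx ▸ hα)
      rw [map_sub, hθ', if_pos h2, sub_self, mul_zero]
    · rw [ha _ h1, zero_mul]
  · rw [mul_sub]
    exact (supported K T).sub_mem h ((supported K T).mul_mem ha hmem) α hα

end Supported

/-! ### The substitutions xᵢ ↦ xᵢ ^ N uᵢ and Euclidean division of exponents. -/

section Substitution

open MvPowerSeries

variable {n : ℕ} {K : Type*} [Field K] {N : ℕ}

theorem hasSubst_X_pow_mul (hN : N ≠ 0) (u : Fin n → MvPowerSeries (Fin n) K) :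
    HasSubst fun i => (X i : MvPowerSeries (Fin n) K) ^ N * u i :=
  hasSubst_of_constantCoeff_zero fun i => by simp [hN]

/-- The substitution `xᵢ ↦ xᵢ ^ N * uᵢ`. -/
noncomputable def twist (hN : N ≠ 0) (u : Fin n → MvPowerSeries (Fin n) K) :
    MvPowerSeries (Fin n) K →ₐ[K] MvPowerSeries (Fin n) K :=
  substAlgHom (hasSubst_X_pow_mul hN u)

@[simp] theorem twist_X (hN : N ≠ 0) (u : Fin n → MvPowerSeries (Fin n) K) (i : Fin n) :
    twist hN u (X i) = X i ^ N * u i := substAlgHom_X _ i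

theorem twist_one (hN : N ≠ 0) :
    twist (K := K) (n := n) hN (fun _ => 1) = MvPowerSeries.expand N hN := by
  unfold twist MvPowerSeries.expand
  congr 1
  simp

/-- The power product of the units `uᵢ`. -/
noncomputable def unitPow (u : Fin n → MvPowerSeries (Fin n) K) (γ : Fin n →₀ ℕ) :
    MvPowerSeries (Fin n) K := ∏ i, u i ^ γ i

theorem prod_X_pow_mul (u : Fin n → MvPowerSeries (Fin n) K) (γ : Fin n →₀ ℕ) :
    (γ.prod fun i e => ((X i : MvPowerSeries (Fin n) K) ^ N * u i) ^ e) =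
      monomial (N • γ) 1 * unitPow u γ := by
  rw [Finsupp.prod_fintype _ _ (by simp), unitPow, ← one_pow (∑ i, (N • γ) i)]
  simp only [mul_pow, Finset.prod_mul_distrib]
  congr 1
  rw [one_pow, MvPowerSeries.monomial_eq', Finsupp.prod_fintype _ _ (by simp)]
  simp [pow_mul]

/-- Only γ with N • γ ≤ δ contribute, so the infinite sum defining the substitution may be cut off
at γ ≤ δ. -/
theorem coeff_twist (hN : N ≠ 0) (u : Fin n → MvPowerSeries (Fin n) K)
    (g : MvPowerSeries (Fin n) K) (δ : Fin n →₀ ℕ) :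
    coeff δ (twist hN u g) =
      ∑ γ ∈ Finset.Iic δ, coeff γ g * coeff δ (monomial (N • γ) 1 * unitPow u γ) := by
  classical
  rw [twist, substAlgHom_apply, coeff_subst (hasSubst_X_pow_mul hN u)]
  simp only [prod_X_pow_mul, smul_eq_mul]
  refine finsum_eq_sum_of_support_subset _ fun γ hγ => ?_
  rw [Function.mem_support] at hγ
  have h := right_ne_zero_of_mul hγ
  rw [MvPowerSeries.coeff_monomial_mul] at h
  have h1 : N • γ ≤ δ := by
    by_contra h'
    rw [if_neg h'] at h
    exact h rfl
  simp only [Finset.coe_Iic, Set.mem_Iic]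
  intro i
  refine le_trans ?_ (h1 i)
  simp only [Finsupp.smul_apply, smul_eq_mul]
  exact Nat.le_mul_of_pos_left _ (Nat.pos_of_ne_zero hN)

theorem constantCoeff_unitPow {u : Fin n → MvPowerSeries (Fin n) K}
    (hu : ∀ i, constantCoeff (u i) = 1) (γ : Fin n →₀ ℕ) : constantCoeff (unitPow u γ) = 1 := by
  simp [unitPow, hu]

/-- For a minimal exponent β of g, no other term reaches N • β, so the image has there the same
nonzero coefficient as g at β. -/
theorem twist_injective (hN : N ≠ 0) {u : Fin n → MvPowerSeries (Fin n) K}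
    (hu : ∀ i, constantCoeff (u i) = 1) : Function.Injective (twist hN u) := by
  classical
  rw [injective_iff_map_eq_zero]
  intro g hg
  by_contra h0
  obtain ⟨β, hβ, hmin⟩ : ∃ β, coeff β g ≠ 0 ∧ ∀ γ < β, coeff γ g = 0 := by
    have hne : {β | coeff β g ≠ 0}.Nonempty := by
      by_contra hne
      rw [Set.not_nonempty_iff_eq_empty, Set.eq_empty_iff_forall_notMem] at hne
      exact h0 (MvPowerSeries.ext fun β => by simpa using hne β)
    obtain ⟨β, hβ, h⟩ := WellFounded.has_min (wellFounded_lt (α := Fin n →₀ ℕ)) _ hne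
    exact ⟨β, hβ, fun γ hγ => by_contra fun h' => h γ h' hγ⟩
  have h := congrArg (MvPowerSeries.coeff (N • β)) hg
  rw [coeff_twist, map_zero, Finset.sum_eq_single β] at h
  · rw [MvPowerSeries.coeff_monomial_mul, if_pos le_rfl, tsub_self,
      coeff_zero_eq_constantCoeff_apply,
      constantCoeff_unitPow hu] at h
    exact hβ (by simpa using h)
  · intro γ _ hγ
    rw [MvPowerSeries.coeff_monomial_mul]
    split_ifs with hle
    · have : γ ≤ β := fun i => by
        have := hle i
        simp only [Finsupp.smul_apply, smul_eq_mul] at this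
        exact Nat.le_of_mul_le_mul_left this (Nat.pos_of_ne_zero hN)
      rw [hmin γ (lt_of_le_of_ne this hγ), zero_mul]
    · rw [mul_zero]
  · intro h'
    exfalso
    apply h'
    rw [Finset.mem_Iic]
    intro i
    simp only [Finsupp.smul_apply, smul_eq_mul]
    exact Nat.le_mul_of_pos_left _ (Nat.pos_of_ne_zero hN)

variable {T : AddSubmonoid (Fin n →₀ ℕ)}

theorem unitPow_mem {u : Fin n → MvPowerSeries (Fin n) K} (hu : ∀ i, u i ∈ supported K T)
    (γ : Fin n →₀ ℕ) : unitPow u γ ∈ supported K T :=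
  Subalgebra.prod_mem _ fun i _ => Subalgebra.pow_mem _ (hu i) _

theorem twist_mem (hN : N ≠ 0) (hNT : ∀ α, N • α ∈ T) {u : Fin n → MvPowerSeries (Fin n) K}
    (hu : ∀ i, u i ∈ supported K T) (g : MvPowerSeries (Fin n) K) :
    twist hN u g ∈ supported K T := by
  intro δ hδ
  rw [coeff_twist]
  refine Finset.sum_eq_zero fun γ _ => ?_
  rw [Subalgebra.mul_mem _ (monomial_mem_supported (hNT γ) _) (unitPow_mem hu γ) δ hδ, mul_zero]

/-- The exponent vector with entries in `{0, …, N - 1}`. -/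
noncomputable def boxExp (β : Fin n → Fin N) : Fin n →₀ ℕ :=
  Finsupp.equivFunOnFinite.symm fun i => (β i : ℕ)

@[simp] theorem boxExp_apply (β : Fin n → Fin N) (i : Fin n) : boxExp β i = β i := rfl

/-- Euclidean division of exponent vectors by `N`. -/
noncomputable def divModEquiv (hN : N ≠ 0) :
    (Fin n → Fin N) × (Fin n →₀ ℕ) ≃ (Fin n →₀ ℕ) where
  toFun x := boxExp x.1 + N • x.2
  invFun α := (fun i => ⟨α i % N, Nat.mod_lt _ (Nat.pos_of_ne_zero hN)⟩,
    Finsupp.equivFunOnFinite.symm fun i => α i / N)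
  left_inv := by
    rintro ⟨β, γ⟩
    ext i
    · simp [Nat.add_mul_mod_self_left, Nat.mod_eq_of_lt (β i).2]
    · simp [Nat.add_mul_div_left _ _ (Nat.pos_of_ne_zero hN), Nat.div_eq_of_lt (β i).2]
  right_inv := by
    intro α
    ext i
    simp [Nat.mod_add_div]

theorem divModEquiv_apply (hN : N ≠ 0) (β : Fin n → Fin N) (γ : Fin n →₀ ℕ) :
    divModEquiv hN (β, γ) = boxExp β + N • γ := rfl

/-- A power series with exponents in `T` is a combination of the monomials with exponents in
`T ∩ {0, …, N - 1}ⁿ`, with coefficients in the image of a substitution `xᵢ ↦ xᵢ ^ N * uᵢ`. -/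
theorem exists_eq_sum_twist (hN : N ≠ 0) (hT : IsFull T) (hNT : ∀ α, N • α ∈ T)
    {u : Fin n → MvPowerSeries (Fin n) K} (hu : ∀ i, u i ∈ supported K T)
    (hu1 : ∀ i, constantCoeff (u i) = 1) {g : MvPowerSeries (Fin n) K} (hg : g ∈ supported K T) :
    ∃ h : (Fin n → Fin N) → MvPowerSeries (Fin n) K, (∀ β, boxExp β ∉ T → h β = 0) ∧
      g = ∑ β, monomial (boxExp β) 1 * twist hN u (h β) := by
  classical
  -- For α = β + Nγ with β in the box, e α is x ^ β times the image of x ^ γ. The family is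
  -- unitriangular with respect to the monomials, so g has an expansion in it, with coefficients c
  -- found recursively.
  let e : (Fin n →₀ ℕ) → MvPowerSeries (Fin n) K := fun α =>
    monomial α 1 * unitPow u ((divModEquiv hN).symm α).2
  have he1 : ∀ α, coeff α (e α) = 1 := fun α => by
    simp only [e]
    rw [MvPowerSeries.coeff_monomial_mul, if_pos le_rfl, tsub_self,
      coeff_zero_eq_constantCoeff_apply,
      constantCoeff_unitPow hu1, mul_one]
  have he0 : ∀ α δ, ¬ α ≤ δ → coeff δ (e α) = 0 := fun α δ h => by
    simp only [e]
    rw [MvPowerSeries.coeff_monomial_mul, if_neg h]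
  let F : (δ : Fin n →₀ ℕ) → ((α : Fin n →₀ ℕ) → α < δ → K) → K := fun δ rec =>
    coeff δ g - ∑ α ∈ Finset.Iio δ, if h : α < δ then rec α h * coeff δ (e α) else 0
  let wf := wellFounded_lt (α := Fin n →₀ ℕ)
  let c : (Fin n →₀ ℕ) → K := wf.fix F
  have hc : ∀ δ, c δ = coeff δ g - ∑ α ∈ Finset.Iio δ, c α * coeff δ (e α) := by
    intro δ
    change wf.fix F δ = _
    rw [wf.fix_eq]
    simp only [F]
    congr 1
    refine Finset.sum_congr rfl fun α hα => ?_
    rw [dif_pos (Finset.mem_Iio.mp hα)]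
  have hcT : ∀ δ, δ ∉ T → c δ = 0 := by
    intro δ
    induction δ using wf.induction with
    | _ δ ih =>
      intro hδ
      rw [hc, hg δ hδ, zero_sub, neg_eq_zero]
      refine Finset.sum_eq_zero fun α hα => ?_
      by_cases hαT : α ∈ T
      · rw [Subalgebra.mul_mem _ (monomial_mem_supported hαT _) (unitPow_mem hu _) δ hδ, mul_zero]
      · rw [ih α (Finset.mem_Iio.mp hα) hαT, zero_mul]
  have hsum : ∀ δ, coeff δ g = ∑ α ∈ Finset.Iic δ, c α * coeff δ (e α) := by
    intro δ
    rw [← Finset.Iio_insert, Finset.sum_insert (by simp), he1, mul_one, hc δ]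
    ring
  -- The expansion is regrouped by residue classes modulo N.
  let h : (Fin n → Fin N) → MvPowerSeries (Fin n) K := fun β γ => c (boxExp β + N • γ)
  have hh : ∀ β γ, coeff γ (h β) = c (boxExp β + N • γ) := fun _ _ => rfl
  refine ⟨h, fun β hβ => ?_, ?_⟩
  · ext γ
    refine hcT _ fun h => hβ (hT _ (hNT γ) _ ?_)
    rwa [add_comm]
  · ext δ
    rw [map_sum, hsum]
    have hterm : ∀ β : Fin n → Fin N, coeff δ (monomial (boxExp β) 1 *
        twist hN u (h β)) =
        ∑ γ ∈ Finset.Iic δ, c (divModEquiv hN (β, γ)) * coeff δ (e (divModEquiv hN (β, γ))) := by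
      intro β
      have hmon : ∀ γ, e (divModEquiv hN (β, γ)) =
          monomial (boxExp β) 1 * (monomial (N • γ) 1 * unitPow u γ) := fun γ => by
        simp only [e, Equiv.symm_apply_apply]
        rw [divModEquiv_apply, ← mul_assoc, MvPowerSeries.monomial_mul_monomial, one_mul]
      simp only [hmon, MvPowerSeries.coeff_monomial_mul (m := δ) (n := boxExp β), one_mul]
      split_ifs with hle
      · rw [coeff_twist]
        refine Finset.sum_subset_zero_on_sdiff (Finset.Iic_subset_Iic.mpr tsub_le_self) ?_ ?_
        · intro γ hγ
          rw [Finset.mem_sdiff, Finset.mem_Iic, Finset.mem_Iic] at hγ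
          rw [MvPowerSeries.coeff_monomial_mul, if_neg, mul_zero]
          intro hle'
          refine hγ.2 (le_trans (fun i => ?_) hle')
          simp only [Finsupp.smul_apply, smul_eq_mul]
          exact Nat.le_mul_of_pos_left _ (Nat.pos_of_ne_zero hN)
        · intro γ _
          rw [hh, divModEquiv_apply]
      · simp
    -- The index sets do not correspond under division by N; only the supports do. Passing to
    -- finsums discards the vanishing terms, so that the bijection applies.
    rw [Finset.sum_congr rfl fun β _ => hterm β, ← Finset.sum_product',
      ← finsum_eq_sum_of_support_subset, ← finsum_eq_sum_of_support_subset]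
    · exact (finsum_comp_equiv (divModEquiv hN) (f := fun α => c α * coeff δ (e α))).symm
    · rintro ⟨β, γ⟩ h
      have h1 : divModEquiv hN (β, γ) ≤ δ := by
        by_contra hle
        exact h (by simp [he0 _ _ hle])
      simp only [Finset.coe_product, Finset.coe_univ, Finset.coe_Iic, Set.mem_prod, Set.mem_univ,
        Set.mem_Iic, true_and]
      intro i
      have := h1 i
      rw [divModEquiv_apply] at this
      simp only [Finsupp.add_apply, Finsupp.smul_apply, smul_eq_mul] at this
      have := Nat.le_mul_of_pos_left (γ i) (Nat.pos_of_ne_zero hN)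
      lia
    · intro α h
      by_contra hle
      rw [Finset.coe_Iic, Set.mem_Iic] at hle
      exact h (by simp [he0 _ _ hle])

end Substitution

universe u v w

/-! ### Isomorphisms of completions. -/

section Completion

variable {K : Type u} [Field K] {A : Type v} [CommRing A] [Algebra K A] {B : Type w} [CommRing B]
  [Algebra K B]

/-- The two hypotheses say that φ induces injections and surjections A / I ^ k → B / J ^ k; these
are compatible with the transition maps and pass to the limit. -/
theorem AnalyticallyIsomorphic.of_hom {I : Ideal A} {J : Ideal B} (φ : A →ₐ[K] B)
    (h1 : ∀ k a, a ∈ I ^ k ↔ φ a ∈ J ^ k) (h2 : ∀ k b, ∃ a, b - φ a ∈ J ^ k) :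
    AnalyticallyIsomorphic K I J := by
  have hI : ∀ k, (I ^ k • ⊤ : Ideal A) = I ^ k := fun k => by simp
  have hJ : ∀ k, (J ^ k • ⊤ : Ideal B) = J ^ k := fun k => by simp
  let f : ∀ k, (A ⧸ (I ^ k • ⊤ : Ideal A)) →ₐ[K] (B ⧸ (J ^ k • ⊤ : Ideal B)) := fun k =>
    Ideal.quotientMapₐ _ φ fun a ha => by
      rw [Ideal.mem_comap, hJ]
      rw [hI] at ha
      exact (h1 k a).mp ha
  have hf : ∀ k a, f k (Ideal.Quotient.mk _ a) = Ideal.Quotient.mk _ (φ a) := fun k a => rfl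
  have hinj : ∀ k, Function.Injective (f k) := by
    intro k
    rw [injective_iff_map_eq_zero]
    intro x hx
    obtain ⟨a, rfl⟩ := Ideal.Quotient.mk_surjective x
    rw [hf, Ideal.Quotient.eq_zero_iff_mem, hJ] at hx
    rw [Ideal.Quotient.eq_zero_iff_mem, hI]
    exact (h1 k a).mpr hx
  have hsurj : ∀ k, Function.Surjective (f k) := by
    intro k y
    obtain ⟨b, rfl⟩ := Ideal.Quotient.mk_surjective y
    obtain ⟨a, ha⟩ := h2 k b
    refine ⟨Ideal.Quotient.mk _ a, ?_⟩
    rw [hf, eq_comm, Ideal.Quotient.eq, hJ]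
    exact ha
  have hcomm : ∀ {k l : ℕ} (hkl : k ≤ l) (x : A ⧸ (I ^ l • ⊤ : Ideal A)),
      AdicCompletion.transitionMap J B hkl (f l x) =
        f k (AdicCompletion.transitionMap I A hkl x) := by
    intro k l hkl x
    obtain ⟨a, rfl⟩ := Ideal.Quotient.mk_surjective x
    rfl
  let F : AdicCompletion I A →ₐ[K] AdicCompletion J B :=
    { toFun := fun x => ⟨fun k => f k (x.val k), fun {k l} hkl => by
        rw [hcomm hkl, x.property hkl]⟩
      map_one' := by ext k; exact map_one (f k)
      map_mul' := fun x y => by ext k; exact map_mul (f k) _ _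
      map_zero' := by ext k; exact map_zero (f k)
      map_add' := fun x y => by ext k; exact map_add (f k) _ _
      commutes' := fun r => by ext k; exact (f k).commutes r }
  have hF : ∀ x k, (F x).val k = f k (x.val k) := fun x k => rfl
  refine ⟨AlgEquiv.ofBijective F ⟨fun x y hxy => ?_, fun y => ?_⟩⟩
  · ext k
    apply hinj k
    rw [← hF, ← hF, hxy]
  · choose g hg using fun k => hsurj k (y.val k)
    refine ⟨⟨g, fun {k l} hkl => hinj k ?_⟩, ?_⟩
    · rw [← hcomm hkl, hg, hg, y.property hkl]
    · ext k
      exact hg k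

theorem AnalyticallyIsomorphic.symm {I : Ideal A} {J : Ideal B}
    (h : AnalyticallyIsomorphic K I J) : AnalyticallyIsomorphic K J I :=
  h.map AlgEquiv.symm

theorem AnalyticallyIsomorphic.trans {C : Type*} [CommRing C] [Algebra K C] {I : Ideal A}
    {J : Ideal B} {L : Ideal C} (h : AnalyticallyIsomorphic K I J)
    (h' : AnalyticallyIsomorphic K J L) : AnalyticallyIsomorphic K I L := by
  obtain ⟨e⟩ := h
  obtain ⟨e'⟩ := h'
  exact ⟨e.trans e'⟩

end Completion

/-! ### The completion of a semigroup algebra at its special point. -/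

section SemigroupRing

open MvPowerSeries

variable {n : ℕ} {K : Type u} [Field K] {T : AddSubmonoid (Fin n →₀ ℕ)}

/-- The ideal of power series in `K[[T]]` without constant term. -/
noncomputable def constIdeal (K : Type u) [Field K] (T : AddSubmonoid (Fin n →₀ ℕ)) :
    Ideal (supported K T) :=
  RingHom.ker ((constantCoeff (σ := Fin n) (R := K)).comp (supported K T).subtype)

theorem mem_constIdeal {g : supported K T} :
    g ∈ constIdeal K T ↔ constantCoeff (g : MvPowerSeries (Fin n) K) = 0 := Iff.rfl

/-- The elements of `T` that are sums of `k` nonzero elements of `T`. -/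
def sumsOf (T : AddSubmonoid (Fin n →₀ ℕ)) : ℕ → Set (Fin n →₀ ℕ)
  | 0 => T
  | k + 1 => {α | ∃ β ∈ T, β ≠ 0 ∧ ∃ γ ∈ sumsOf T k, α = β + γ}

theorem coeff_eq_zero_of_mem_constIdeal_pow (k : ℕ) {g : supported K T}
    (hg : g ∈ constIdeal K T ^ k) :
    ∀ α, α ∉ sumsOf T k → coeff α (g : MvPowerSeries (Fin n) K) = 0 := by
  classical
  induction k generalizing g with
  | zero => exact g.2
  | succ k ih =>
    rw [pow_succ'] at hg
    refine Submodule.mul_induction_on hg ?_ ?_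
    · intro a ha b hb α hα
      rw [MulMemClass.coe_mul, MvPowerSeries.coeff_mul]
      refine Finset.sum_eq_zero fun x hx => ?_
      rw [Finset.HasAntidiagonal.mem_antidiagonal] at hx
      by_cases h1 : x.1 ∈ T
      · by_cases h0 : x.1 = 0
        · rw [h0, coeff_zero_eq_constantCoeff_apply, mem_constIdeal.mp ha, zero_mul]
        · by_cases h2 : x.2 ∈ sumsOf T k
          · exact absurd ⟨_, h1, h0, _, h2, hx.symm⟩ hα
          · rw [ih hb _ h2, mul_zero]
      · rw [a.2 _ h1, zero_mul]
    · intro a b ha hb α hα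
      rw [AddMemClass.coe_add, map_add, ha α hα, hb α hα, add_zero]

/-- The sums of `k` elements of `G`. -/
def exactSums (G : Set (Fin n →₀ ℕ)) : ℕ → Set (Fin n →₀ ℕ)
  | 0 => {0}
  | k + 1 => Set.image2 (· + ·) G (exactSums G k)

theorem finite_exactSums {G : Set (Fin n →₀ ℕ)} (hG : G.Finite) (k : ℕ) :
    (exactSums G k).Finite := by
  induction k with
  | zero => exact Set.finite_singleton _
  | succ k ih => exact hG.image2 _ ih

theorem exactSums_mem {G : Set (Fin n →₀ ℕ)} (hGT : G ⊆ T) {k : ℕ} {α : Fin n →₀ ℕ}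
    (hα : α ∈ exactSums G k) : α ∈ T := by
  induction k generalizing α with
  | zero => rw [Set.mem_singleton_iff.mp hα]; exact T.zero_mem
  | succ k ih =>
    obtain ⟨β, hβ, γ, hγ, rfl⟩ := hα
    exact T.add_mem (hGT hβ) (ih hγ)

theorem exists_generator_add {G : Set (Fin n →₀ ℕ)} (hG : AddSubmonoid.closure G = T)
    {β : Fin n →₀ ℕ} (hβ : β ∈ T) (h0 : β ≠ 0) :
    ∃ γ ∈ G, γ ≠ 0 ∧ ∃ δ ∈ T, β = γ + δ := by
  subst hG
  induction hβ using AddSubmonoid.closure_induction with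
  | mem x hx => exact ⟨x, hx, h0, 0, zero_mem _, (add_zero x).symm⟩
  | zero => exact absurd rfl h0
  | add x y hx hy ihx ihy =>
    by_cases hx0 : x = 0
    · subst hx0
      rw [zero_add] at h0 ⊢
      exact ihy h0
    · obtain ⟨γ, hγ, hγ0, δ, hδ, rfl⟩ := ihx hx0
      exact ⟨γ, hγ, hγ0, δ + y, add_mem hδ hy, add_assoc _ _ _⟩

theorem exists_exactSums_add {G : Set (Fin n →₀ ℕ)} (hG : AddSubmonoid.closure G = T) {k : ℕ}
    {α : Fin n →₀ ℕ} (hα : α ∈ sumsOf T k) :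
    ∃ τ ∈ exactSums (G \ {0}) k, ∃ δ ∈ T, α = τ + δ := by
  induction k generalizing α with
  | zero => exact ⟨0, rfl, α, hα, (zero_add α).symm⟩
  | succ k ih =>
    obtain ⟨β, hβ, h0, γ, hγ, rfl⟩ := hα
    obtain ⟨τ, hτ, δ, hδ, rfl⟩ := ih hγ
    obtain ⟨ε, hε, hε0, ζ, hζ, rfl⟩ := exists_generator_add hG hβ h0
    exact ⟨ε + τ, ⟨ε, ⟨hε, hε0⟩, τ, hτ, rfl⟩, ζ + δ, T.add_mem hζ hδ, by abel⟩

/-- An element of T that is not a sum of k + 1 nonzero elements is 0 or a generator plus an element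
that is not a sum of k. This finiteness lets a power series be approximated by a polynomial modulo
each power of the ideal. -/
theorem mem_sumsOf_or_finite {G : Set (Fin n →₀ ℕ)} (hGf : G.Finite)
    (hG : AddSubmonoid.closure G = T) (k : ℕ) : ((T : Set (Fin n →₀ ℕ)) \ sumsOf T k).Finite := by
  induction k with
  | zero => simp [sumsOf]
  | succ k ih =>
    refine ((Set.finite_singleton (0 : Fin n →₀ ℕ)).union (hGf.image2 (· + ·) ih)).subset ?_
    rintro α ⟨hα, hα'⟩
    by_cases h0 : α = 0
    · exact Or.inl h0
    · obtain ⟨γ, hγ, hγ0, δ, hδ, rfl⟩ := exists_generator_add hG hα h0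
      refine Or.inr ⟨γ, hγ, δ, ⟨hδ, fun hδ' => hα' ⟨γ, ?_, hγ0, δ, hδ', rfl⟩⟩, rfl⟩
      exact hG ▸ AddSubmonoid.subset_closure hγ

theorem monomial_mem_constIdeal_pow {G : Set (Fin n →₀ ℕ)} (hGT : G ⊆ T) {k : ℕ}
    {τ : Fin n →₀ ℕ} (hτ : τ ∈ exactSums (G \ {0}) k) (hτT : τ ∈ T) :
    (⟨monomial τ 1, monomial_mem_supported hτT 1⟩ : supported K T) ∈ constIdeal K T ^ k := by
  classical
  induction k generalizing τ with
  | zero => simp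
  | succ k ih =>
    obtain ⟨β, hβ, γ, hγ, rfl⟩ := hτ
    have hγT := exactSums_mem (Set.sdiff_subset.trans hGT) hγ
    rw [pow_succ']
    have : (⟨monomial (β + γ) 1, monomial_mem_supported hτT 1⟩ : supported K T) =
        ⟨monomial β 1, monomial_mem_supported (hGT hβ.1) 1⟩ *
          ⟨monomial γ 1, monomial_mem_supported hγT 1⟩ := by
      apply Subtype.ext
      simp [MvPowerSeries.monomial_mul_monomial]
    simp only at this ⊢
    rw [this]
    refine Ideal.mul_mem_mul ?_ (ih hγ hγT)
    rw [mem_constIdeal, ← coeff_zero_eq_constantCoeff_apply, MvPowerSeries.coeff_monomial,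
      if_neg (Ne.symm hβ.2)]

/-- Each exponent in `sumsOf T k` is τ + δ with δ in T and τ one of finitely many sums of k nonzero
generators. Fixing such a τ for each exponent splits g into finitely many multiples of monomials x ^
τ, each in the k-th power of the ideal. -/
theorem mem_constIdeal_pow {G : Set (Fin n →₀ ℕ)} (hGf : G.Finite)
    (hG : AddSubmonoid.closure G = T) (k : ℕ) {g : supported K T}
    (hg : ∀ α, α ∉ sumsOf T k → coeff α (g : MvPowerSeries (Fin n) K) = 0) :
    g ∈ constIdeal K T ^ k := by
  classical
  have hGT : G ⊆ T := hG ▸ AddSubmonoid.subset_closure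
  have hfin := finite_exactSums (hGf.subset (Set.sdiff_subset (t := {0}))) k
  choose τ hτ using fun α : sumsOf T k => exists_exactSums_add hG α.2
  let q : (Fin n →₀ ℕ) → MvPowerSeries (Fin n) K := fun σ δ =>
    if h : σ + δ ∈ sumsOf T k then if τ ⟨σ + δ, h⟩ = σ then coeff (σ + δ) g.1 else 0 else 0
  have hq : ∀ σ δ, coeff δ (q σ) =
    if h : σ + δ ∈ sumsOf T k then if τ ⟨σ + δ, h⟩ = σ then coeff (σ + δ) g.1 else 0 else 0 :=
    fun _ _ => rfl
  have hqT : ∀ σ, q σ ∈ supported K T := by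
    intro σ δ hδ
    rw [hq]
    split_ifs with h h'
    · obtain ⟨δ', hδ', he⟩ := (hτ ⟨σ + δ, h⟩).2
      rw [h'] at he
      exact absurd (add_left_cancel he ▸ hδ') hδ
    · rfl
    · rfl
  have hmem : ∀ σ ∈ hfin.toFinset, σ ∈ T := fun σ hσ =>
    exactSums_mem (Set.sdiff_subset.trans hGT) (hfin.mem_toFinset.mp hσ)
  have key : g = ∑ σ ∈ hfin.toFinset.attach,
      (⟨monomial σ.1 1, monomial_mem_supported (hmem _ σ.2) 1⟩ : supported K T) *
        ⟨q σ.1, hqT σ.1⟩ := by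
    apply Subtype.ext
    rw [AddSubmonoidClass.coe_finsetSum]
    simp only [MulMemClass.mk_mul_mk]
    rw [Finset.sum_attach hfin.toFinset (fun σ => monomial σ 1 * q σ)]
    ext α
    rw [map_sum]
    simp only [MvPowerSeries.coeff_monomial_mul, one_mul]
    by_cases hα : α ∈ sumsOf T k
    · rw [Finset.sum_eq_single (τ ⟨α, hα⟩)]
      · obtain ⟨hτ1, δ, hδ, he⟩ := hτ ⟨α, hα⟩
        simp only at he
        have hle : τ ⟨α, hα⟩ ≤ α := le_iff_exists_add.mpr ⟨δ, he⟩
        rw [if_pos hle, hq]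
        have h2 : τ ⟨α, hα⟩ + (α - τ ⟨α, hα⟩) = α := add_tsub_cancel_of_le hle
        have h3 : τ ⟨α, hα⟩ + (α - τ ⟨α, hα⟩) ∈ sumsOf T k := by rwa [h2]
        have h4 : (⟨τ ⟨α, hα⟩ + (α - τ ⟨α, hα⟩), h3⟩ : sumsOf T k) = ⟨α, hα⟩ := Subtype.ext h2
        rw [dif_pos h3, h4, if_pos rfl, h2]
      · intro σ _ hσ
        split_ifs with hle
        · rw [hq]
          have h2 : σ + (α - σ) = α := add_tsub_cancel_of_le hle
          have h3 : σ + (α - σ) ∈ sumsOf T k := by rwa [h2]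
          have h4 : (⟨σ + (α - σ), h3⟩ : sumsOf T k) = ⟨α, hα⟩ := Subtype.ext h2
          rw [dif_pos h3, h4, if_neg (Ne.symm hσ)]
        · rfl
      · intro h
        exact absurd (hfin.mem_toFinset.mpr (hτ ⟨α, hα⟩).1) h
    · rw [hg α hα, eq_comm]
      refine Finset.sum_eq_zero fun σ _ => ?_
      split_ifs with hle
      · rw [hq, dif_neg]
        rwa [add_tsub_cancel_of_le hle]
      · rfl
  rw [key]
  refine Ideal.sum_mem _ fun σ _ => Ideal.mul_mem_right _ _ ?_
  exact monomial_mem_constIdeal_pow hGT (hfin.mem_toFinset.mp σ.2) (hmem _ σ.2)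


variable {S : AddSubmonoid (Fin n → ℚ)}

/-- The embedding of the semigroup algebra `K[S]` into `K[[T]]` given by an isomorphism `S ≃ T`. -/
noncomputable def toSeries (K : Type u) [Field K] (ε : S ≃+ T) :
    AddMonoidAlgebra K S →ₐ[K] supported K T :=
  AddMonoidAlgebra.lift K (supported K T) S
    { toFun := fun s => ⟨monomial (ε s.toAdd).1 1, monomial_mem_supported (ε s.toAdd).2 1⟩
      map_one' := by
        apply Subtype.ext
        simp [MvPowerSeries.monomial_zero_one]
      map_mul' := fun s t => by
        apply Subtype.ext
        simp [MvPowerSeries.monomial_mul_monomial] }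

theorem coe_toSeries_single (ε : S ≃+ T) (s : S) (c : K) :
    (toSeries K ε (AddMonoidAlgebra.single s c) : MvPowerSeries (Fin n) K) =
      monomial (ε s).1 c := by
  classical
  rw [toSeries, AddMonoidAlgebra.lift_single]
  ext α
  simp [MvPowerSeries.coeff_monomial]

theorem coeff_toSeries (ε : S ≃+ T) (p : AddMonoidAlgebra K S) (s : S) :
    coeff (ε s).1 (toSeries K ε p : MvPowerSeries (Fin n) K) = p.coeff s := by
  classical
  induction p using AddMonoidAlgebra.induction_linear with
  | zero => simp
  | add p q hp hq => rw [map_add, AddMemClass.coe_add, map_add, hp, hq]; rfl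
  | single t c =>
    rw [coe_toSeries_single, MvPowerSeries.coeff_monomial]
    rw [AddMonoidAlgebra.coeff_single, Finsupp.single_apply]
    refine if_congr ?_ rfl rfl
    rw [Subtype.coe_inj, ε.injective.eq_iff, eq_comm]

theorem single_mem_specialIdeal_pow (ε : S ≃+ T) (k : ℕ) (s : S) (c : K)
    (hs : (ε s).1 ∈ sumsOf T k) :
    AddMonoidAlgebra.single s c ∈ specialIdeal K S ^ k := by
  induction k generalizing s with
  | zero => simp
  | succ k ih =>
    obtain ⟨β, hβ, hβ0, γ, hγ, h⟩ := hs
    have hγT : γ ∈ T := by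
      clear h ih
      induction k generalizing γ with
      | zero => exact hγ
      | succ k ih =>
        obtain ⟨a, ha, -, b, hb, rfl⟩ := hγ
        exact T.add_mem ha (ih b hb)
    have hs : s = ε.symm ⟨β, hβ⟩ + ε.symm ⟨γ, hγT⟩ := by
      apply ε.injective
      apply Subtype.ext
      simp [h]
    have : AddMonoidAlgebra.single s c = AddMonoidAlgebra.single (ε.symm ⟨β, hβ⟩) 1 *
        AddMonoidAlgebra.single (ε.symm ⟨γ, hγT⟩) c := by
      rw [AddMonoidAlgebra.single_mul_single, one_mul, ← hs]
    rw [this, pow_succ']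
    refine Ideal.mul_mem_mul (Ideal.subset_span ⟨_, ?_, rfl⟩) (ih _ (by simpa using hγ))
    simpa [Subtype.ext_iff] using hβ0

theorem toSeries_mem_constIdeal (ε : S ≃+ T) :
    specialIdeal K S ≤ (constIdeal K T).comap (toSeries K ε) := by
  classical
  rw [specialIdeal, Ideal.span_le]
  rintro _ ⟨α, hα, rfl⟩
  simp only [Ideal.coe_comap, Set.mem_preimage, SetLike.mem_coe]
  rw [mem_constIdeal, coe_toSeries_single, ← coeff_zero_eq_constantCoeff_apply,
    MvPowerSeries.coeff_monomial, if_neg]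
  intro h
  exact hα (ε.map_eq_zero_iff.mp (Subtype.ext h.symm))

/-- The completion of `K[S]` at the special point is the completion of `K[[T]]`. -/
theorem analyticallyIsomorphic_supported (hT : T.FG) (ε : S ≃+ T) :
    AnalyticallyIsomorphic K (specialIdeal K S) (constIdeal K T) := by
  classical
  obtain ⟨G, hG⟩ := hT
  refine AnalyticallyIsomorphic.of_hom (toSeries K ε) (fun k p => ⟨fun hp => ?_, fun hp => ?_⟩)
    fun k b => ?_
  · exact Ideal.mem_comap.mp
      (Ideal.le_comap_pow _ k (Ideal.pow_right_mono (toSeries_mem_constIdeal ε) k hp))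
  · rw [← AddMonoidAlgebra.sum_coeff_single p, Finsupp.sum]
    refine Ideal.sum_mem _ fun s hs => single_mem_specialIdeal_pow ε k s _ ?_
    by_contra h
    have := coeff_eq_zero_of_mem_constIdeal_pow k hp _ h
    rw [coeff_toSeries] at this
    exact Finsupp.mem_support_iff.mp hs this
  · have hfin := mem_sumsOf_or_finite G.finite_toSet hG k
    have hfin' : {s : S | (ε s).1 ∉ sumsOf T k}.Finite := by
      have hmaps : Set.MapsTo (fun s : S => (ε s).1) {s : S | (ε s).1 ∉ sumsOf T k}
          ((T : Set (Fin n →₀ ℕ)) \ sumsOf T k) := fun s hs => ⟨(ε s).2, hs⟩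
      refine Set.Finite.of_injOn hmaps ?_ hfin
      exact fun s _ t _ h => ε.injective (Subtype.ext h)
    -- The approximating polynomial keeps the finitely many terms of b whose exponents are not in
    -- `sumsOf T k`.
    refine ⟨AddMonoidAlgebra.ofCoeff (Finsupp.onFinset hfin'.toFinset
      (fun s => if (ε s).1 ∈ sumsOf T k then 0 else coeff (ε s).1 b.1) ?_), ?_⟩
    · intro s hs
      rw [Set.Finite.mem_toFinset]
      intro h
      exact hs (if_pos h)
    · refine mem_constIdeal_pow G.finite_toSet hG k fun α hα => ?_
      by_cases hαT : α ∈ T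
      · obtain ⟨s, hs⟩ := ε.surjective ⟨α, hαT⟩
        have hs' : (ε s).1 = α := congrArg Subtype.val hs
        rw [AddSubgroupClass.coe_sub, map_sub, ← hs', coeff_toSeries,
          AddMonoidAlgebra.coeff_ofCoeff, Finsupp.onFinset_apply, if_neg (hs' ▸ hα), sub_self]
      · exact mem_supported.mp (SetLike.coe_mem (b - _)) α hαT

end SemigroupRing

/-! ### The local ring K[[T]] and finite generation of T. -/

section Local

open MvPowerSeries

variable {n : ℕ} {K : Type u} [Field K] {T : AddSubmonoid (Fin n →₀ ℕ)}

/-- The inverse in the full power series ring has exponents in T, since its product with g is 1 and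
T is full. -/
theorem isUnit_supported (hT : IsFull T) {g : supported K T}
    (hg : constantCoeff (g : MvPowerSeries (Fin n) K) ≠ 0) : IsUnit g := by
  have h := MvPowerSeries.mul_inv_cancel _ hg
  have h0 : (g : MvPowerSeries (Fin n) K) ≠ 0 := by
    intro h0
    rw [h0, map_zero] at hg
    exact hg rfl
  refine IsUnit.of_mul_eq_one (b := ⟨(g : MvPowerSeries (Fin n) K)⁻¹,
    mem_supported_of_mul_mem hT g.2 h0 ?_⟩) (Subtype.ext h)
  rw [h]
  exact one_mem _

theorem isLocalRing_supported (hT : IsFull T) : IsLocalRing (supported K T) := by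
  refine IsLocalRing.of_isUnit_or_isUnit_one_sub_self fun g => ?_
  by_cases hg : constantCoeff (g : MvPowerSeries (Fin n) K) = 0
  · exact Or.inr (isUnit_supported hT (by simp [hg]))
  · exact Or.inl (isUnit_supported hT hg)

theorem maximalIdeal_supported (hT : IsFull T) [IsLocalRing (supported K T)] :
    IsLocalRing.maximalIdeal (supported K T) = constIdeal K T := by
  ext g
  rw [IsLocalRing.mem_maximalIdeal, mem_nonunits_iff, mem_constIdeal]
  constructor
  · intro h
    by_contra h'
    exact h (isUnit_supported hT h')
  · intro h hu
    have := hu.map ((constantCoeff (σ := Fin n) (R := K)).comp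
      (supported K T).val.toRingHom)
    exact this.ne_zero h

theorem AnalyticallyIsomorphic.of_algEquiv {A B : Type*} [CommRing A] [Algebra K A] [CommRing B]
    [Algebra K B] [IsLocalRing A] [IsLocalRing B] (e : A ≃ₐ[K] B) :
    AnalyticallyIsomorphic K (IsLocalRing.maximalIdeal A) (IsLocalRing.maximalIdeal B) := by
  have h : (IsLocalRing.maximalIdeal B).comap e = IsLocalRing.maximalIdeal A := by
    ext a
    simp [IsLocalRing.mem_maximalIdeal, mem_nonunits_iff]
  have h' : (IsLocalRing.maximalIdeal A).map (e : A ≃+* B) = IsLocalRing.maximalIdeal B := by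
    rw [← h]
    exact Ideal.map_comap_of_surjective _ e.surjective _
  refine AnalyticallyIsomorphic.of_hom e.toAlgHom (fun k a => ?_) fun k b => ⟨e.symm b, by simp⟩
  rw [← h', ← Ideal.map_pow]
  change _ ↔ (e : A ≃+* B) a ∈ _
  rw [Ideal.mem_map_of_equiv]
  simp

/-- Division by N writes an element of T as a box vector plus N • γ; by fullness the box vector is
again in T. So the finitely many box points of T and the vectors N eᵢ generate. -/
theorem fg_of_isFull {N : ℕ} (hN : N ≠ 0) (hT : IsFull T) (hNT : ∀ α, N • α ∈ T) : T.FG := by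
  classical
  let G : Set (Fin n →₀ ℕ) := {α | α ∈ T ∧ ∃ β : Fin n → Fin N, α = boxExp β} ∪
    Set.range fun i : Fin n => N • Finsupp.single i 1
  have hG : G.Finite := by
    refine Set.Finite.union ?_ (Set.finite_range _)
    exact (Set.finite_range (fun β : Fin n → Fin N => boxExp β)).subset
      fun α ⟨_, β, hβ⟩ => ⟨β, hβ.symm⟩
  refine ⟨hG.toFinset, ?_⟩
  rw [Set.Finite.coe_toFinset]
  apply le_antisymm
  · rw [AddSubmonoid.closure_le]
    rintro _ (⟨h, -⟩ | ⟨i, rfl⟩)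
    · exact h
    · exact hNT _
  · intro α hα
    obtain ⟨⟨β, γ⟩, rfl⟩ := (divModEquiv hN).surjective α
    rw [divModEquiv_apply] at hα ⊢
    have hβ : boxExp β ∈ T := hT _ (hNT γ) _ (by rwa [add_comm])
    refine add_mem (AddSubmonoid.subset_closure (Or.inl ⟨hβ, β, rfl⟩)) ?_
    have : N • γ = ∑ i, γ i • (N • Finsupp.single i 1 : Fin n →₀ ℕ) := by
      ext j
      simp [Finsupp.finsetSum_apply, Finsupp.single_apply, mul_comm]
    rw [this]
    refine AddSubmonoid.sum_mem _ fun i _ => AddSubmonoid.nsmul_mem _ ?_ _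
    exact AddSubmonoid.subset_closure (Or.inr ⟨i, rfl⟩)

end Local

/-! ### Lattice coordinates adapted to a simplicial cone. -/

section Lattice

variable {n : ℕ}

/-- The vector with coordinates `zᵢ / N` with respect to the vectors `wᵢ`. -/
def latMap (N : ℕ) (w : Fin n → Fin n → ℚ) : (Fin n → ℤ) →+ (Fin n → ℚ) where
  toFun z := ∑ i, ((z i : ℚ) / N) • w i
  map_zero' := by simp
  map_add' a b := by
    rw [← Finset.sum_add_distrib]
    refine Finset.sum_congr rfl fun i _ => ?_
    rw [Pi.add_apply, Int.cast_add, add_div, add_smul]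

theorem latMap_apply (N : ℕ) (w : Fin n → Fin n → ℚ) (z : Fin n → ℤ) :
    latMap N w z = ∑ i, ((z i : ℚ) / N) • w i := rfl

/-- The inclusion `ℕⁿ → ℤⁿ`. -/
noncomputable def castHom (n : ℕ) : (Fin n →₀ ℕ) →+ (Fin n → ℤ) where
  toFun α i := α i
  map_zero' := by ext; simp
  map_add' a b := by ext; simp

@[simp] theorem castHom_apply (α : Fin n →₀ ℕ) (i : Fin n) : castHom n α i = α i := rfl

theorem castHom_injective : Function.Injective (castHom n) := fun a b h => by
  ext i
  have := congrFun h i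
  simpa using this

/-- The points of a subgroup of `ℤⁿ` with nonnegative coordinates. -/
noncomputable def natPoints (P : AddSubgroup (Fin n → ℤ)) : AddSubmonoid (Fin n →₀ ℕ) :=
  P.toAddSubmonoid.comap (castHom n)

theorem mem_natPoints {P : AddSubgroup (Fin n → ℤ)} {α : Fin n →₀ ℕ} :
    α ∈ natPoints P ↔ castHom n α ∈ P := Iff.rfl

theorem isFull_natPoints (P : AddSubgroup (Fin n → ℤ)) : IsFull (natPoints P) := by
  intro α hα β hβ
  rw [mem_natPoints, map_add] at hβ
  exact (AddSubgroup.add_mem_cancel_left _ hα).mp hβ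

theorem linearIndependent_cast_real {w : Fin n → Fin n → ℤ}
    (hw : LinearIndependent ℝ fun i j => (w i j : ℝ)) :
    LinearIndependent ℚ fun i j => (w i j : ℚ) := by
  rw [Fintype.linearIndependent_iff] at hw ⊢
  intro c hc i
  have := hw (fun i => (c i : ℝ)) (by
    ext j
    have := congrFun hc j
    simp only [Finset.sum_apply, Pi.smul_apply, smul_eq_mul, Pi.zero_apply] at this ⊢
    exact_mod_cast this) i
  exact_mod_cast this

theorem latMap_injective {N : ℕ} (hN : N ≠ 0) {w : Fin n → Fin n → ℚ}
    (hw : LinearIndependent ℚ w) : Function.Injective (latMap N w) := by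
  rw [injective_iff_map_eq_zero]
  intro z hz
  rw [latMap_apply] at hz
  ext i
  have := Fintype.linearIndependent_iff.mp hw _ hz i
  simpa [hN] using this

theorem latMap_nsmul {N : ℕ} (hN : N ≠ 0) (w : Fin n → Fin n → ℚ) (z : Fin n → ℤ) :
    latMap N w (N • z) = ∑ i, z i • w i := by
  rw [latMap_apply]
  refine Finset.sum_congr rfl fun i _ => ?_
  have : ((N : ℚ)) ≠ 0 := by exact_mod_cast hN
  simp [this, Int.cast_smul_eq_zsmul]

theorem mem_cone_iff {v : Fin n → Fin n → ℤ} {x : Fin n → ℝ} :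
    x ∈ cone v ↔ ∃ c : Fin n → ℝ, (∀ i, 0 ≤ c i) ∧ x = ∑ i, c i • fun j => (v i j : ℝ) := by
  rw [cone, PointedCone.hull, Submodule.mem_span_range_iff_exists_fun]
  constructor
  · rintro ⟨c, rfl⟩
    exact ⟨fun i => c i, fun i => (c i).2, rfl⟩
  · rintro ⟨c, hc, rfl⟩
    exact ⟨fun i => ⟨c i, hc i⟩, rfl⟩

/-- In coordinates with respect to multiples `rᵢ vᵢ` of the generators of the cone, the semigroup
`M ∩ σ` is the set of nonnegative points of a subgroup of `ℤⁿ`. -/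
theorem nonempty_semigroup_equiv {M : AddSubgroup (Fin n → ℚ)} {v : Fin n → Fin n → ℤ}
    (hv : LinearIndependent ℝ fun i j => (v i j : ℝ)) {N : ℕ} (hN : N ≠ 0) {r : Fin n → ℚ}
    (hr : ∀ i, 0 < r i)
    (hM : ∀ α ∈ M, α ∈ (latMap N fun i j => r i * (v i j : ℚ)).range) :
    Nonempty (semigroup M (cone v) ≃+
      natPoints (M.comap (latMap N fun i j => r i * (v i j : ℚ)))) := by
  have hN' : (0 : ℝ) < N := by exact_mod_cast Nat.pos_of_ne_zero hN
  set w : Fin n → Fin n → ℚ := fun i j => r i * (v i j : ℚ) with hw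
  have hcast : ∀ z : Fin n → ℤ, (fun j => ((latMap N w z j : ℚ) : ℝ)) =
      ∑ i, (((z i : ℝ) / N) * r i) • fun j => (v i j : ℝ) := by
    intro z
    ext j
    simp only [latMap_apply, Finset.sum_apply, Pi.smul_apply, smul_eq_mul, hw]
    push_cast
    refine Finset.sum_congr rfl fun i _ => by ring
  have hwli : LinearIndependent ℚ w :=
    (linearIndependent_cast_real hv).units_smul fun i => Units.mk0 (r i) (hr i).ne'
  let F : natPoints (M.comap (latMap N w)) →+ semigroup M (cone v) :=
    { toFun := fun β => ⟨latMap N w (castHom n β.1), β.2, by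
        rw [hcast, mem_cone_iff]
        refine ⟨_, fun i => ?_, rfl⟩
        have : (0 : ℝ) < r i := by exact_mod_cast hr i
        have h2 : (0 : ℝ) ≤ ((castHom n β.1 i : ℤ) : ℝ) := by simp
        positivity⟩
      map_zero' := by
        apply Subtype.ext
        simp
      map_add' := fun a b => by
        apply Subtype.ext
        simp }
  have hF : ∀ β, (F β : Fin n → ℚ) = latMap N w (castHom n β.1) := fun β => rfl
  refine ⟨(AddEquiv.ofBijective F ⟨fun a b hab => ?_, fun α => ?_⟩).symm⟩
  · have := congrArg Subtype.val hab
    rw [hF, hF] at this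
    exact Subtype.ext (castHom_injective (latMap_injective hN hwli this))
  · obtain ⟨z, hz⟩ := hM α.1 α.2.1
    obtain ⟨c, hc, hc'⟩ := mem_cone_iff.mp α.2.2
    -- The lattice coordinates, rescaled, are the cone coefficients by linear independence, and the
    -- latter are nonnegative.
    have hz0 : ∀ i, 0 ≤ z i := by
      intro i
      have h1 : ∑ i, (((z i : ℝ) / N) * r i - c i) • (fun j => (v i j : ℝ)) = 0 := by
        simp only [sub_smul, Finset.sum_sub_distrib]
        rw [← hcast, hz, ← hc', sub_self]
      have h2 := Fintype.linearIndependent_iff.mp hv _ h1 i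
      have h3 : (0 : ℝ) ≤ ((z i : ℝ) / N) * r i := by linarith [hc i]
      have h4 : (0 : ℝ) < r i := by exact_mod_cast hr i
      have h5 : (0 : ℝ) ≤ (z i : ℝ) / N := nonneg_of_mul_nonneg_left h3 h4
      have h6 : (0 : ℝ) ≤ (z i : ℝ) := by
        rw [div_nonneg_iff] at h5
        rcases h5 with h5 | h5
        · exact h5.1
        · linarith [h5.2]
      exact_mod_cast h6
    let β : Fin n →₀ ℕ := Finsupp.equivFunOnFinite.symm fun i => (z i).toNat
    have hβ : castHom n β = z := by
      ext i
      simp [β, Int.toNat_of_nonneg (hz0 i)]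
    refine ⟨⟨β, ?_⟩, Subtype.ext ?_⟩
    · rw [mem_natPoints, AddSubgroup.mem_comap, hβ, hz]
      exact α.2.1
    · rw [hF, hβ, hz]

theorem nsmul_mem_natPoints_comap {M : AddSubgroup (Fin n → ℚ)} {w : Fin n → Fin n → ℚ}
    (hw : ∀ i, w i ∈ M) {N : ℕ} (hN : N ≠ 0) (z : Fin n → ℤ) :
    N • z ∈ M.comap (latMap N w) := by
  rw [AddSubgroup.mem_comap, latMap_nsmul hN]
  exact sum_mem fun i _ => zsmul_mem (hw i) _

theorem range_latMap_le {N k : ℕ} (hk : k ≠ 0) (w : Fin n → Fin n → ℚ) :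
    (latMap N w).range ≤ (latMap (N * k) w).range := by
  rintro _ ⟨z, rfl⟩
  refine ⟨k • z, ?_⟩
  rw [latMap_apply, latMap_apply]
  refine Finset.sum_congr rfl fun i _ => ?_
  have : (k : ℚ) ≠ 0 := by exact_mod_cast hk
  congr 1
  simp only [Pi.smul_apply, nsmul_eq_mul, Int.cast_mul, Int.cast_natCast, Nat.cast_mul]
  rw [mul_comm (N : ℚ), mul_div_mul_left _ _ this]

/-- The vᵢ form a basis of ℚⁿ, and M has finitely many generators, whose coordinates have a common
denominator. -/
theorem exists_common_denominator {M : AddSubgroup (Fin n → ℚ)} {v : Fin n → Fin n → ℤ}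
    (h : IsSimplicialPair M v) :
    ∃ N : ℕ, N ≠ 0 ∧ M ≤ (latMap N fun i j => (v i j : ℚ)).range := by
  classical
  obtain ⟨G, hG⟩ := h.fg
  have hli := linearIndependent_cast_real h.linearIndependent
  have hspan : ∀ α : Fin n → ℚ, ∃ N : ℕ, N ≠ 0 ∧ α ∈ (latMap N fun i j => (v i j : ℚ)).range := by
    intro α
    have hcard : Fintype.card (Fin n) = Module.finrank ℚ (Fin n → ℚ) := by simp
    let b := basisOfLinearIndependentOfCardEqFinrank' _ hli hcard
    have hα := b.sum_repr α
    refine ⟨∏ i, (b.repr α i).den, Finset.prod_ne_zero_iff.mpr fun i _ => (b.repr α i).den_ne_zero,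
      fun i => (b.repr α i).num * ∏ j ∈ Finset.univ.erase i, ((b.repr α j).den : ℤ), ?_⟩
    rw [latMap_apply, ← hα]
    refine Finset.sum_congr rfl fun i _ => ?_
    rw [hα]
    have hb : b i = fun j => (v i j : ℚ) := by simp [b]
    rw [hb]
    congr 1
    have h1 : (((∏ i, (b.repr α i).den : ℕ)) : ℚ) = (b.repr α i).den *
        ∏ j ∈ Finset.univ.erase i, ((b.repr α j).den : ℚ) := by
      push_cast
      rw [Finset.mul_prod_erase _ (fun j => ((b.repr α j).den : ℚ)) (Finset.mem_univ i)]
    have h2 : ∏ j ∈ Finset.univ.erase i, ((b.repr α j).den : ℚ) ≠ 0 :=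
      Finset.prod_ne_zero_iff.mpr fun j _ => by exact_mod_cast (b.repr α j).den_ne_zero
    rw [h1]
    push_cast
    rw [mul_div_mul_right _ _ h2, Rat.num_div_den]
  have hfin : ∀ G : Finset (Fin n → ℚ), ∃ N : ℕ, N ≠ 0 ∧
      ∀ α ∈ G, α ∈ (latMap N fun i j => (v i j : ℚ)).range := by
    intro G
    induction G using Finset.induction_on with
    | empty => exact ⟨1, one_ne_zero, by simp⟩
    | insert a s _ ih =>
      obtain ⟨N, hN, hs⟩ := ih
      obtain ⟨k, hk, ha⟩ := hspan a
      refine ⟨N * k, mul_ne_zero hN hk, fun α hα => ?_⟩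
      rcases Finset.mem_insert.mp hα with rfl | hα
      · rw [mul_comm]
        exact range_latMap_le hN _ ha
      · exact range_latMap_le hk _ (hs α hα)
  obtain ⟨N, hN, hN'⟩ := hfin G
  refine ⟨N, hN, ?_⟩
  rw [← hG, AddSubgroup.closure_le]
  exact hN'

/-- Primitive generators of the rays. -/
theorem exists_ray_generators {M : AddSubgroup (Fin n → ℚ)} {v : Fin n → Fin n → ℤ}
    (h : IsSimplicialPair M v) :
    ∃ r : Fin n → ℚ, (∀ i, 0 < r i) ∧ (∀ i, (fun j => r i * (v i j : ℚ)) ∈ M) ∧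
      ∀ i (t : ℚ), (fun j => t * (v i j : ℚ)) ∈ M → ∃ z : ℤ, t = z * r i := by
  classical
  obtain ⟨N, hN, hM⟩ := exists_common_denominator h
  have hN' : (N : ℚ) ≠ 0 := by exact_mod_cast hN
  have hli := linearIndependent_cast_real h.linearIndependent
  suffices ∀ i, ∃ r : ℚ, 0 < r ∧ (fun j => r * (v i j : ℚ)) ∈ M ∧
      ∀ t : ℚ, (fun j => t * (v i j : ℚ)) ∈ M → ∃ z : ℤ, t = z * r by
    choose r h1 h2 h3 using this
    exact ⟨r, h1, h2, h3⟩
  intro i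
  let L : ℚ →+ (Fin n → ℚ) :=
    { toFun := fun t => t • fun j => (v i j : ℚ)
      map_zero' := zero_smul _ _
      map_add' := fun a b => add_smul _ _ _ }
  have hL : ∀ t, (fun j => t * (v i j : ℚ)) = L t := fun t => rfl
  let ι : ℤ →+ ℚ :=
    { toFun := fun z => z / N
      map_zero' := by simp
      map_add' := fun a b => by push_cast; ring }
  have hι : ∀ z, ι z = z / N := fun z => rfl
  -- Points of M on the line of vᵢ have coordinate in (1 / N) ℤ, so they form a cyclic group; it is
  -- nonzero because vᵢ itself lies in M.
  obtain ⟨g, hg⟩ := Int.subgroup_cyclic (M.comap (L.comp ι))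
  have hg' : ∀ z : ℤ, L (z / N) ∈ M ↔ ∃ k : ℤ, k * g = z := by
    intro z
    have : z ∈ M.comap (L.comp ι) ↔ z ∈ AddSubgroup.closure {g} := by rw [hg]
    rw [AddSubgroup.mem_closure_singleton] at this
    simpa [hι] using this
  have hg0 : g ≠ 0 := by
    rintro rfl
    have h1 : L ((N : ℤ) / N) ∈ M := by
      rw [← hL]
      simpa [hN'] using h.int_mem (v i)
    obtain ⟨k, hk⟩ := (hg' N).mp h1
    rw [mul_zero] at hk
    exact hN (by exact_mod_cast hk.symm)
  have habs : (0 : ℚ) < |g| := by exact_mod_cast abs_pos.mpr hg0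
  refine ⟨(|g| : ℤ) / N, ?_, ?_, ?_⟩
  · have : (0 : ℚ) < N := by exact_mod_cast Nat.pos_of_ne_zero hN
    push_cast
    positivity
  · rw [hL, hg']
    rcases abs_choice g with h | h <;> rw [h]
    · exact ⟨1, one_mul _⟩
    · exact ⟨-1, by ring⟩
  · intro t ht
    obtain ⟨z, hz⟩ := hM ht
    have hz' : L t = ∑ k, (if k = i then t else 0) • fun j => (v k j : ℚ) := by
      simp [L]
    rw [hL, hz', latMap_apply] at hz
    have h1 : ∑ k, ((z k : ℚ) / N - (if k = i then t else 0)) • (fun j => (v k j : ℚ)) = 0 := by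
      simp only [sub_smul, Finset.sum_sub_distrib]
      rw [hz, sub_self]
    have h2 := Fintype.linearIndependent_iff.mp hli _ h1 i
    rw [if_pos rfl, sub_eq_zero] at h2
    rw [hL, ← h2, hg'] at ht
    obtain ⟨k, hk⟩ := ht
    rw [← h2, ← hk]
    rcases abs_choice g with h | h <;> rw [h]
    · exact ⟨k, by push_cast; ring⟩
    · exact ⟨-k, by push_cast; ring⟩

/-- The index annihilates M modulo the ray lattice, whose points have integer coordinates with
respect to the ray generators. This allows the index itself as denominator, so no new prime factor
enters. -/
theorem le_range_latMap_relIndex {M : AddSubgroup (Fin n → ℚ)} {v : Fin n → Fin n → ℤ}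
    (hk : (rayLattice M v).relIndex M ≠ 0) {r : Fin n → ℚ}
    (hr : ∀ i (t : ℚ), (fun j => t * (v i j : ℚ)) ∈ M → ∃ z : ℤ, t = z * r i) :
    M ≤ (latMap ((rayLattice M v).relIndex M) fun i j => r i * (v i j : ℚ)).range := by
  classical
  set k := (rayLattice M v).relIndex M
  have hk' : (k : ℚ) ≠ 0 := by exact_mod_cast hk
  have hle : rayLattice M v ≤ (latMap 1 fun i j => r i * (v i j : ℚ)).range := by
    rw [rayLattice, AddSubgroup.closure_le]
    rintro α ⟨hα, i, t, rfl⟩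
    obtain ⟨z, rfl⟩ := hr i t hα
    refine ⟨Pi.single i z, ?_⟩
    rw [latMap_apply, Finset.sum_eq_single i]
    · ext j
      simp [mul_assoc]
    · intro j _ hj
      simp [hj]
    · simp
  intro α hα
  have h1 : k • (⟨α, hα⟩ : M) ∈ (rayLattice M v).addSubgroupOf M :=
    AddSubgroup.nsmul_index_mem _ _
  rw [AddSubgroup.mem_addSubgroupOf] at h1
  obtain ⟨z, hz⟩ := hle h1
  refine ⟨z, ?_⟩
  rw [latMap_apply] at hz ⊢
  have h2 : α = (k : ℚ)⁻¹ • (k • α) := by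
    rw [← Nat.cast_smul_eq_nsmul ℚ, smul_smul, inv_mul_cancel₀ hk', one_smul]
  rw [h2]
  change _ = (k : ℚ)⁻¹ • ((k • (⟨α, hα⟩ : M) : M) : Fin n → ℚ)
  rw [← hz, Finset.smul_sum]
  refine Finset.sum_congr rfl fun i _ => ?_
  rw [smul_smul]
  congr 1
  simp
  ring

end Lattice

/-! ### Normalization of a hypersurface inside a normal integral extension. -/

section Normalization

variable {K A C : Type*} [Field K] [CommRing A] [Algebra K A] [CommRing C] [IsDomain C]
  [Algebra K C]

/-- The subfield of the fraction field of `C` generated by the image of `A` and by `s`. -/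
noncomputable def genField (φ : A →+* C) (s : Set C) : Subfield (FractionRing C) :=
  Subfield.closure (algebraMap C (FractionRing C) '' (Set.range φ ∪ s))

theorem algebraMap_mem_genField (φ : A →+* C) (s : Set C) (a : A) :
    algebraMap C (FractionRing C) (φ a) ∈ genField φ s :=
  Subfield.subset_closure ⟨φ a, Or.inl ⟨a, rfl⟩, rfl⟩

theorem mem_genField_of_mem (φ : A →+* C) {s : Set C} {x : C} (hx : x ∈ s) :
    algebraMap C (FractionRing C) x ∈ genField φ s :=
  Subfield.subset_closure ⟨x, Or.inr hx, rfl⟩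

theorem eq_minpoly_of_irreducible [IsDomain A] [IsIntegrallyClosed A] [Algebra A C]
    [Module.IsTorsionFree A C] {f : A[X]} (hf : f.Monic) (hirr : Irreducible f) {ξ : C}
    (hξ : aeval ξ f = 0) : f = minpoly A ξ := by
  have hinteg : IsIntegral A ξ := ⟨f, hf, hξ⟩
  have hdvd := minpoly.isIntegrallyClosed_dvd hinteg hξ
  have h1 := (hirr.dvd_iff.mp hdvd).resolve_left (minpoly.not_isUnit A ξ)
  exact eq_of_monic_of_associated hf (minpoly.monic hinteg) h1

/-- The normalization of `A[y] / (f)` consists of the elements of a normal integral extension `C`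
of `A` that lie in the field generated by a root of `f`. -/
theorem nonempty_normalization_equiv [IsDomain A] [IsIntegrallyClosed A] [IsIntegrallyClosed C]
    (φ : A →ₐ[K] C) (hφ : Function.Injective φ) (hinteg : φ.toRingHom.IsIntegral) {f : A[X]}
    (hf : f.Monic) (hirr : Irreducible f) {ξ : C} (hξ : f.eval₂ φ.toRingHom ξ = 0)
    (W : Subalgebra K C)
    (hW : ∀ θ, θ ∈ W ↔ algebraMap C (FractionRing C) θ ∈ genField φ.toRingHom {ξ}) :
    IsDomain (AdjoinRoot f) ∧ Nonempty (Normalization (AdjoinRoot f) ≃ₐ[K] W) := by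
  let _ : Algebra A C := φ.toRingHom.toAlgebra
  have halg : ∀ a, algebraMap A C a = φ a := fun _ => rfl
  have : IsScalarTower K A C := IsScalarTower.of_algebraMap_eq fun r => (φ.commutes r).symm
  have : FaithfulSMul A C := (faithfulSMul_iff_algebraMap_injective A C).mpr hφ
  have hξ' : aeval ξ f = 0 := hξ
  have hmin := eq_minpoly_of_irreducible hf hirr hξ'
  let ψ : AdjoinRoot f →ₐ[A] C := AdjoinRoot.liftAlgHom f (Algebra.ofId A C) ξ hξ
  have hψmk : ∀ g, ψ (AdjoinRoot.mk f g) = aeval ξ g := fun g => by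
    simp [ψ, aeval_def]
    rfl
  have hψ : Function.Injective ψ := by
    rw [injective_iff_map_eq_zero]
    intro x hx
    obtain ⟨g, rfl⟩ := AdjoinRoot.mk_surjective x
    rw [hψmk] at hx
    rw [AdjoinRoot.mk_eq_zero, hmin]
    exact minpoly.isIntegrallyClosed_dvd ⟨f, hf, hξ'⟩ hx
  have hdom : IsDomain (AdjoinRoot f) := hψ.isDomain ψ.toRingHom
  refine ⟨hdom, ?_⟩
  let Ω := FractionRing C
  have hΨ : Function.Injective ((algebraMap C Ω).comp ψ.toRingHom) :=
    (IsFractionRing.injective C Ω).comp hψ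
  let Φ : FractionRing (AdjoinRoot f) →+* Ω := IsFractionRing.lift hΨ
  have hΦ : ∀ x, Φ (algebraMap _ _ x) = algebraMap C Ω (ψ x) := fun x =>
    IsFractionRing.lift_algebraMap hΨ x
  have hΦa : ∀ a : A, Φ (algebraMap (AdjoinRoot f) _ (algebraMap A _ a)) =
      algebraMap C Ω (φ a) := fun a => by rw [hΦ, ψ.commutes]; rfl
  have hrange : ∀ y, y ∈ genField φ.toRingHom {ξ} ↔ ∃ x, Φ x = y := by
    intro y
    constructor
    · intro hy
      have : genField φ.toRingHom {ξ} ≤ Φ.fieldRange := by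
        rw [genField, Subfield.closure_le]
        rintro _ ⟨_, (⟨a, rfl⟩ | rfl), rfl⟩
        · exact ⟨_, hΦa a⟩
        · refine ⟨algebraMap _ _ (AdjoinRoot.root f), ?_⟩
          rw [hΦ, ← AdjoinRoot.mk_X, hψmk, aeval_X]
      exact this hy
    · rintro ⟨x, rfl⟩
      have key : ∀ z : AdjoinRoot f, Φ (algebraMap _ _ z) ∈ genField φ.toRingHom {ξ} := by
        intro z
        obtain ⟨g, rfl⟩ := AdjoinRoot.mk_surjective z
        rw [hΦ, hψmk, aeval_eq_sum_range, map_sum]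
        refine sum_mem fun i _ => ?_
        rw [Algebra.smul_def, map_mul, map_pow]
        exact mul_mem (algebraMap_mem_genField φ.toRingHom {ξ} (g.coeff i))
          (pow_mem (mem_genField_of_mem φ.toRingHom (Set.mem_singleton ξ)) i)
      obtain ⟨a, b, hb, rfl⟩ := IsFractionRing.div_surjective (A := AdjoinRoot f) x
      rw [map_div₀]
      exact div_mem (key a) (key b)
  let j : Normalization (AdjoinRoot f) →ₐ[K] Ω :=
    { Φ.comp (algebraMap (Normalization (AdjoinRoot f)) (FractionRing (AdjoinRoot f))) with
      commutes' := fun r => by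
        change Φ (algebraMap (Normalization (AdjoinRoot f)) (FractionRing (AdjoinRoot f))
          (algebraMap K _ r)) = _
        rw [← IsScalarTower.algebraMap_apply K (Normalization (AdjoinRoot f))
          (FractionRing (AdjoinRoot f)), IsScalarTower.algebraMap_apply K (AdjoinRoot f)
          (FractionRing (AdjoinRoot f)), IsScalarTower.algebraMap_apply K A (AdjoinRoot f), hΦa,
          φ.commutes, ← IsScalarTower.algebraMap_apply K C Ω] }
  have hj : ∀ x, j x = Φ x.1 := fun x => rfl
  let i : W →ₐ[K] Ω := (IsScalarTower.toAlgHom K C Ω).comp W.val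
  have hi : ∀ x, i x = algebraMap C Ω x.1 := fun x => rfl
  have hjinj : Function.Injective j := fun x y h => Subtype.ext (Φ.injective h)
  have hiinj : Function.Injective i := fun x y h =>
    Subtype.ext (IsFractionRing.injective C Ω h)
  -- Both rings are compared inside Frac(C). An element integral over A[y]/(f) is integral over C,
  -- hence in C by normality; conversely, elements of C are integral over A.
  have heq : j.range = i.range := by
    apply le_antisymm
    · rintro _ ⟨x, rfl⟩
      have hx : IsIntegral (AdjoinRoot f) x.1 := x.2
      have h1 : IsIntegral C (Φ x.1) := by
        obtain ⟨p, hp, hp'⟩ := hx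
        refine ⟨p.map ψ.toRingHom, hp.map _, ?_⟩
        rw [eval₂_map]
        have h2 : (algebraMap C Ω).comp ψ.toRingHom =
            Φ.comp (algebraMap (AdjoinRoot f) (FractionRing (AdjoinRoot f))) :=
          RingHom.ext fun z => (hΦ z).symm
        rw [h2, ← hom_eval₂, hp', map_zero]
      obtain ⟨c, hc⟩ := IsIntegrallyClosed.isIntegral_iff.mp h1
      refine ⟨⟨c, (hW c).mpr ?_⟩, hc⟩
      rw [hc, hrange]
      exact ⟨_, rfl⟩
    · rintro _ ⟨θ, rfl⟩
      obtain ⟨x, hx⟩ := (hrange _).mp ((hW θ.1).mp θ.2)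
      refine ⟨⟨x, ?_⟩, hx⟩
      obtain ⟨p, hp, hp'⟩ := hinteg θ.1
      refine ⟨p.map (algebraMap A (AdjoinRoot f)), hp.map _, Φ.injective ?_⟩
      rw [eval₂_map, hom_eval₂, map_zero, hx]
      have h2 : Φ.comp ((algebraMap (AdjoinRoot f) (FractionRing (AdjoinRoot f))).comp
          (algebraMap A (AdjoinRoot f))) = (algebraMap C Ω).comp φ.toRingHom :=
        RingHom.ext fun z => hΦa z
      rw [h2, ← hom_eval₂, hp', map_zero]
  exact ⟨(AlgEquiv.ofInjective j hjinj).trans ((Subalgebra.equivOfEq _ _ heq).trans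
    (AlgEquiv.ofInjective i hiinj).symm)⟩

end Normalization

/-! ### Kummer theory for extensions generated by radicals. -/

section Kummer

variable {K E Ω ι B : Type*} [Field K] [IsAlgClosed K] [Field E] [Field Ω] [Algebra K E]
  [Algebra E Ω] {m : ℕ}

theorem exists_isPrimitiveRoot (K : Type*) [Field K] [IsAlgClosed K] (hm : (m : K) ≠ 0) :
    ∃ ζ : K, IsPrimitiveRoot ζ m := by
  have : NeZero (m : K) := ⟨hm⟩
  exact HasEnoughRootsOfUnity.exists_primitiveRoot K m

/-- Each generator is a root of some X ^ m - e with e ≠ 0, which is separable as m is invertible and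
splits because K contains a primitive m-th root of unity. -/
theorem isGalois_of_radicals (K : Type*) [Field K] [IsAlgClosed K] [Algebra K E]
    (hm : (m : K) ≠ 0) {s : ι → Ω} (hs0 : ∀ i, s i ≠ 0)
    (hs : ∀ i, s i ^ m ∈ (algebraMap E Ω).range)
    (hgen : IntermediateField.adjoin E (Set.range s) = ⊤) : IsGalois E Ω := by
  obtain ⟨ζ, hζ⟩ := exists_isPrimitiveRoot K hm
  have hm0 : m ≠ 0 := by rintro rfl; simp at hm
  have hζ' : IsPrimitiveRoot (algebraMap E Ω (algebraMap K E ζ)) m :=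
    (hζ.map_of_injective (algebraMap K E).injective).map_of_injective (algebraMap E Ω).injective
  have hroot : ∀ i, ∃ e : E, e ≠ 0 ∧ algebraMap E Ω e = s i ^ m := by
    intro i
    obtain ⟨e, he⟩ := hs i
    refine ⟨e, ?_, he⟩
    rintro rfl
    rw [map_zero] at he
    exact pow_ne_zero m (hs0 i) he.symm
  choose e he0 he using hroot
  have haev : ∀ i, aeval (s i) (X ^ m - C (e i)) = 0 := fun i => by simp [he]
  have hinteg : ∀ i, IsIntegral E (s i) := fun i =>
    ⟨X ^ m - C (e i), monic_X_pow_sub_C _ hm0, haev i⟩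
  have hsplit : ∀ i, ((minpoly E (s i)).map (algebraMap E Ω)).Splits := by
    intro i
    refine Splits.of_dvd ?_ ?_ (Polynomial.map_dvd _ (minpoly.dvd E (s i) (haev i)))
    · rw [Polynomial.map_sub, Polynomial.map_pow, map_X, map_C]
      exact X_pow_sub_C_splits_of_isPrimitiveRoot hζ' (he i).symm
    · exact Polynomial.map_ne_zero (X_pow_sub_C_ne_zero (Nat.pos_of_ne_zero hm0) _)
  have hsep : ∀ i, IsSeparable E (s i) := by
    intro i
    refine Separable.of_dvd ?_ (minpoly.dvd E (s i) (haev i))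
    refine separable_X_pow_sub_C _ ?_ (he0 i)
    intro h
    apply hm
    rw [← map_natCast (algebraMap K E)] at h
    exact (map_eq_zero _).mp h
  have hsepE : Algebra.IsSeparable E Ω := by
    have h1 : Algebra.IsSeparable E (IntermediateField.adjoin E (Set.range s)) :=
      (IntermediateField.isSeparable_adjoin_iff_isSeparable E Ω).mpr
        (by rintro _ ⟨i, rfl⟩; exact hsep i)
    rw [hgen] at h1
    exact Algebra.IsSeparable.of_algHom E _
      (IntermediateField.topEquiv (F := E) (E := Ω)).symm.toAlgHom
  have hnorm : Normal E Ω := by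
    rw [normal_iff]
    intro x
    refine ⟨(Algebra.IsSeparable.isIntegral E x), ?_⟩
    refine IntermediateField.splits_of_mem_adjoin E Ω (S := Set.range s) ?_ (by rw [hgen]; trivial)
    rintro _ ⟨i, rfl⟩
    exact ⟨hinteg i, hsplit i⟩
  exact { }

/-- The quotient σ x / x is an m-th root of unity, hence comes from K. Radicals are thus
eigenvectors of every automorphism. -/
theorem exists_algEquiv_apply_eq (hm : (m : K) ≠ 0) {x : Ω} (hx0 : x ≠ 0)
    (hx : x ^ m ∈ (algebraMap E Ω).range) (σ : Ω ≃ₐ[E] Ω) :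
    ∃ c : E, σ x = algebraMap E Ω c * x := by
  obtain ⟨ζ, hζ⟩ := exists_isPrimitiveRoot K hm
  have hm0 : NeZero m := ⟨by rintro rfl; simp at hm⟩
  have hζ' : IsPrimitiveRoot (algebraMap E Ω (algebraMap K E ζ)) m :=
    (hζ.map_of_injective (algebraMap K E).injective).map_of_injective (algebraMap E Ω).injective
  have h1 : (σ x / x) ^ m = 1 := by
    obtain ⟨e, he⟩ := hx
    rw [div_pow, ← map_pow, ← he, σ.commutes, he, div_self (pow_ne_zero _ hx0)]
  obtain ⟨k, -, hk⟩ := hζ'.eq_pow_of_pow_eq_one h1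
  refine ⟨algebraMap K E ζ ^ k, ?_⟩
  rw [map_pow, hk, div_mul_cancel₀ _ hx0]

/-- A field between `E` and `Ω` contains the components of its elements with respect to a basis
of radicals. -/
theorem radical_mem_of_sum_mem [IsGalois E Ω] [FiniteDimensional E Ω] [Fintype B]
    (hm : (m : K) ≠ 0) {μ : B → Ω} (hμ0 : ∀ b, μ b ≠ 0)
    (hμ : ∀ b, μ b ^ m ∈ (algebraMap E Ω).range) (hli : LinearIndependent E μ)
    (L : IntermediateField E Ω) (c : B → E) (hL : ∑ b, c b • μ b ∈ L) {b : B} (hb : c b ≠ 0) :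
    μ b ∈ L := by
  rw [← IsGalois.fixedField_fixingSubgroup L, IntermediateField.mem_fixedField_iff]
  intro σ hσ
  have h1 : σ (∑ b, c b • μ b) = ∑ b, c b • μ b :=
    (IntermediateField.mem_fixingSubgroup_iff L σ).mp hσ _ hL
  choose d hd using fun b => exists_algEquiv_apply_eq (K := K) hm (hμ0 b) (hμ b) σ
  rw [map_sum, ← sub_eq_zero, ← Finset.sum_sub_distrib] at h1
  -- The automorphism acts diagonally on the basis and fixes the sum, so every component with
  -- nonzero coefficient has eigenvalue 1.
  have h2 : ∑ b, (c b * d b - c b) • μ b = 0 := by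
    rw [← h1]
    refine Finset.sum_congr rfl fun b _ => ?_
    rw [map_smul, hd, sub_smul, mul_smul, Algebra.smul_def (d b)]
  have h3 := Fintype.linearIndependent_iff.mp hli _ h2 b
  have h4 : d b = 1 := by
    have : c b * (d b - 1) = 0 := by rw [mul_sub, mul_one, h3]
    exact sub_eq_zero.mp ((mul_eq_zero.mp this).resolve_left hb)
  rw [hd, h4, map_one, one_mul]

end Kummer

/-! ### Bases of radicals and the induced extension of fraction fields. -/

section RadicalBasis

/-- A basis of `C` over `A` consisting of `m`-th roots of elements of `A`. -/
structure IsRadicalBasis {A C B : Type*} [CommRing A] [CommRing C] [Fintype B] (φ : A →+* C)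
    (m : ℕ) (μ : B → C) : Prop where
  ne_zero : ∀ b, μ b ≠ 0
  pow_mem : ∀ b, μ b ^ m ∈ φ.range
  span : ∀ θ, ∃ h : B → A, θ = ∑ b, φ (h b) * μ b
  indep : ∀ h : B → A, ∑ b, φ (h b) * μ b = 0 → ∀ b, h b = 0

theorem isIntegral_of_span {A C B : Type*} [CommRing A] [CommRing C] [Fintype B] {φ : A →+* C}
    {μ : B → C} (h : ∀ θ, ∃ c : B → A, θ = ∑ b, φ (c b) * μ b) : φ.IsIntegral := by
  let _ := φ.toAlgebra
  have : Module.Finite A C := by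
    refine Module.Finite.of_surjective (Fintype.linearCombination A μ) fun θ => ?_
    obtain ⟨c, hc⟩ := h θ
    refine ⟨c, ?_⟩
    rw [hc, Fintype.linearCombination_apply]
    simp only [Algebra.smul_def]
    rfl
  exact (algebraMap_isIntegral_iff (R := A) (A := C)).mpr inferInstance

theorem IsRadicalBasis.isIntegral {A C B : Type*} [CommRing A] [CommRing C] [Fintype B] {m : ℕ}
    {μ : B → C} {φ : A →+* C} (h : IsRadicalBasis φ m μ) : φ.IsIntegral :=
  isIntegral_of_span h.span

attribute [local instance] FractionRing.liftAlgebra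

variable {K A C B : Type*} [Field K] [IsAlgClosed K] [CommRing A] [Algebra K A]
  [CommRing C] [IsDomain C] [Algebra A C] [FaithfulSMul A C] [Fintype B] {m : ℕ} {μ : B → C}

theorem linearIndependent_radicals (h : IsRadicalBasis (algebraMap A C) m μ) :
    LinearIndependent (FractionRing A) fun b => algebraMap C (FractionRing C) (μ b) := by
  rw [← LinearIndependent.iff_fractionRing (R := A), Fintype.linearIndependent_iff]
  intro c hc
  refine h.indep c (IsFractionRing.injective C (FractionRing C) ?_)
  rw [map_zero, ← hc, map_sum]
  refine Finset.sum_congr rfl fun b _ => ?_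
  rw [Algebra.smul_def, map_mul, ← IsScalarTower.algebraMap_apply A C (FractionRing C)]

theorem pow_mem_range_radicals (h : IsRadicalBasis (algebraMap A C) m μ) (b : B) :
    algebraMap C (FractionRing C) (μ b) ^ m ∈
      (algebraMap (FractionRing A) (FractionRing C)).range := by
  obtain ⟨a, ha⟩ := h.pow_mem b
  refine ⟨algebraMap A _ a, ?_⟩
  rw [← IsScalarTower.algebraMap_apply, ← map_pow, ← ha,
    ← IsScalarTower.algebraMap_apply A C (FractionRing C)]

variable [IsDomain A]

/-- As C is integral over A, a denominator in C divides a nonzero element of A, so denominators may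
be taken from A. -/
theorem exists_eq_sum_radicals (h : IsRadicalBasis (algebraMap A C) m μ) (ω : FractionRing C) :
    ∃ c : B → FractionRing A, ω = ∑ b, c b • algebraMap C (FractionRing C) (μ b) := by
  have hinteg : Algebra.IsIntegral A C := algebraMap_isIntegral_iff.mp h.isIntegral
  obtain ⟨x, y, hy, rfl⟩ := IsFractionRing.div_surjective (A := C) ω
  obtain ⟨a, ha, z, hz⟩ := (hinteg.isIntegral y).isAlgebraic.exists_nonzero_dvd hy
  obtain ⟨c, hc⟩ := h.span (x * z)
  have hz' : algebraMap C (FractionRing C) y * algebraMap C (FractionRing C) z =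
      algebraMap (FractionRing A) (FractionRing C) (algebraMap A (FractionRing A) a) := by
    rw [← IsScalarTower.algebraMap_apply, ← map_mul, ← hz,
      ← IsScalarTower.algebraMap_apply A C (FractionRing C)]
  have ha' : algebraMap (FractionRing A) (FractionRing C) (algebraMap A (FractionRing A) a) ≠ 0 :=
    by simpa using ha
  have hy' : algebraMap C (FractionRing C) y ≠ 0 := left_ne_zero_of_mul (hz' ▸ ha')
  have hz0 : algebraMap C (FractionRing C) z ≠ 0 := right_ne_zero_of_mul (hz' ▸ ha')
  refine ⟨fun b => algebraMap A _ (c b) / algebraMap A _ a, ?_⟩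
  rw [← mul_div_mul_right _ _ hz0, hz', ← map_mul, hc, map_sum, Finset.sum_div]
  refine Finset.sum_congr rfl fun b _ => ?_
  rw [Algebra.smul_def, map_div₀, ← IsScalarTower.algebraMap_apply A (FractionRing A),
    ← IsScalarTower.algebraMap_apply A (FractionRing A), map_mul,
    ← IsScalarTower.algebraMap_apply A C (FractionRing C), div_mul_eq_mul_div]

/-- The basis of radicals of the fraction field of `C`. -/
noncomputable def radicalBasis (h : IsRadicalBasis (algebraMap A C) m μ) :
    Module.Basis B (FractionRing A) (FractionRing C) :=
  .mk (linearIndependent_radicals h) fun ω _ => by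
    obtain ⟨c, rfl⟩ := exists_eq_sum_radicals h ω
    exact Submodule.sum_mem _ fun b _ => Submodule.smul_mem _ _ (Submodule.subset_span ⟨b, rfl⟩)

theorem isGalois_radicals (K : Type*) [Field K] [IsAlgClosed K] [Algebra K A] (hm : (m : K) ≠ 0)
    (h : IsRadicalBasis (algebraMap A C) m μ) : IsGalois (FractionRing A) (FractionRing C) := by
  refine isGalois_of_radicals K hm (s := fun b => algebraMap C (FractionRing C) (μ b))
    (fun b => by simpa using h.ne_zero b) (pow_mem_range_radicals h) ?_
  rw [eq_top_iff]
  intro ω _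
  obtain ⟨c, rfl⟩ := exists_eq_sum_radicals h ω
  refine sum_mem fun b _ => IntermediateField.smul_mem _ ?_
  exact IntermediateField.subset_adjoin _ _ ⟨b, rfl⟩

/-- A subfield of the fraction field of `C` containing `A` as an intermediate field. -/
def intermediateOf (L : Subfield (FractionRing C))
    (hL : ∀ a, algebraMap C (FractionRing C) (algebraMap A C a) ∈ L) :
    IntermediateField (FractionRing A) (FractionRing C) :=
  { L with
    algebraMap_mem' := fun e => by
      obtain ⟨x, y, hy, rfl⟩ := IsFractionRing.div_surjective (A := A) e
      rw [map_div₀, ← IsScalarTower.algebraMap_apply, ← IsScalarTower.algebraMap_apply,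
        IsScalarTower.algebraMap_apply A C (FractionRing C),
        IsScalarTower.algebraMap_apply A C (FractionRing C)]
      exact L.div_mem (hL x) (hL y) }

theorem mem_intermediateOf {L : Subfield (FractionRing C)}
    {hL : ∀ a, algebraMap C (FractionRing C) (algebraMap A C a) ∈ L} {x : FractionRing C} :
    x ∈ intermediateOf L hL ↔ x ∈ L := Iff.rfl

theorem adjoin_eq_intermediateOf (ξ : C) :
    IntermediateField.adjoin (FractionRing A) {algebraMap C (FractionRing C) ξ} =
      intermediateOf (genField (algebraMap A C) {ξ})
        (algebraMap_mem_genField (algebraMap A C) {ξ}) := by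
  apply le_antisymm
  · rw [IntermediateField.adjoin_le_iff]
    rintro _ rfl
    exact mem_genField_of_mem _ (Set.mem_singleton ξ)
  · have : genField (algebraMap A C) {ξ} ≤ (IntermediateField.adjoin (FractionRing A)
        {algebraMap C (FractionRing C) ξ}).toSubfield := by
      rw [genField, Subfield.closure_le]
      rintro _ ⟨_, (⟨a, rfl⟩ | rfl), rfl⟩
      · rw [← IsScalarTower.algebraMap_apply A C (FractionRing C),
          IsScalarTower.algebraMap_apply A (FractionRing A) (FractionRing C)]
        exact IntermediateField.algebraMap_mem _ _
      · exact IntermediateField.mem_adjoin_simple_self _ _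
    exact this

theorem radical_mem_of_sum_mem_subfield (hm : (m : K) ≠ 0)
    (h : IsRadicalBasis (algebraMap A C) m μ) (L : Subfield (FractionRing C))
    (hL : ∀ a, algebraMap C (FractionRing C) (algebraMap A C a) ∈ L) (c : B → A)
    (hc : algebraMap C (FractionRing C) (∑ b, algebraMap A C (c b) * μ b) ∈ L) {b : B}
    (hb : c b ≠ 0) : algebraMap C (FractionRing C) (μ b) ∈ L := by
  have := isGalois_radicals K hm h
  have : FiniteDimensional (FractionRing A) (FractionRing C) :=
    (radicalBasis h).finiteDimensional_of_finite
  have hμ0 : ∀ b, algebraMap C (FractionRing C) (μ b) ≠ 0 := fun b => by simpa using h.ne_zero b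
  have hb' : algebraMap A (FractionRing A) (c b) ≠ 0 := by simpa using hb
  have hsum : ∑ b, algebraMap A (FractionRing A) (c b) • algebraMap C (FractionRing C) (μ b) ∈
      intermediateOf (A := A) L hL := by
    have heq : ∑ b, algebraMap A (FractionRing A) (c b) • algebraMap C (FractionRing C) (μ b) =
        algebraMap C (FractionRing C) (∑ b, algebraMap A C (c b) * μ b) := by
      rw [map_sum]
      refine Finset.sum_congr rfl fun b _ => ?_
      rw [Algebra.smul_def, ← IsScalarTower.algebraMap_apply, map_mul,
        IsScalarTower.algebraMap_apply A C (FractionRing C)]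
    rw [heq]
    exact hc
  have key := radical_mem_of_sum_mem (K := K) (E := FractionRing A) hm
    (μ := fun b => algebraMap C (FractionRing C) (μ b)) hμ0
    (pow_mem_range_radicals h) (linearIndependent_radicals h) (intermediateOf (A := A) L hL)
    (fun b => algebraMap A (FractionRing A) (c b)) hsum hb'
  exact key

/-- A finite Galois extension has finitely many intermediate fields, so L is simple. Multiplying a
generator by a nonzero element of A makes it integral, hence an element of the normal ring C. -/
theorem exists_primitive_of_radicals [IsIntegrallyClosed C] (hm : (m : K) ≠ 0)
    (h : IsRadicalBasis (algebraMap A C) m μ) (L : Subfield (FractionRing C))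
    (hL : ∀ a, algebraMap C (FractionRing C) (algebraMap A C a) ∈ L) :
    ∃ ξ : C, genField (algebraMap A C) {ξ} = L := by
  have := isGalois_radicals K hm h
  have : FiniteDimensional (FractionRing A) (FractionRing C) :=
    (radicalBasis h).finiteDimensional_of_finite
  have : Finite (IntermediateField (FractionRing A) (FractionRing C)) :=
    (Field.exists_primitive_element_iff_finite_intermediateField _ _).mp
      ⟨inferInstance, Field.exists_primitive_element _ _⟩
  obtain ⟨α, hα⟩ := Field.exists_primitive_element_of_finite_intermediateField _ _
    (intermediateOf (A := A) L hL)
  have halg : IsAlgebraic A α :=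
    (IsFractionRing.isAlgebraic_iff A (FractionRing A) (FractionRing C)).mpr
      (Algebra.IsAlgebraic.isAlgebraic α)
  obtain ⟨a, ha, hinteg⟩ := halg.exists_integral_multiple
  obtain ⟨ξ, hξ⟩ := IsIntegrallyClosed.isIntegral_iff.mp (hinteg.tower_top (A := C))
  refine ⟨ξ, ?_⟩
  have ha' : algebraMap (FractionRing A) (FractionRing C) (algebraMap A (FractionRing A) a) ≠ 0 :=
    by simpa using ha
  have h1 : intermediateOf (genField (algebraMap A C) {ξ})
      (algebraMap_mem_genField (algebraMap A C) {ξ}) = intermediateOf (A := A) L hL := by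
    rw [← adjoin_eq_intermediateOf, ← hα, hξ]
    apply le_antisymm
    · rw [IntermediateField.adjoin_simple_le_iff, Algebra.smul_def,
        IsScalarTower.algebraMap_apply A (FractionRing A) (FractionRing C)]
      exact mul_mem (IntermediateField.algebraMap_mem _ _)
        (IntermediateField.mem_adjoin_simple_self _ _)
    · rw [IntermediateField.adjoin_simple_le_iff]
      have h2 : α = (algebraMap (FractionRing A) (FractionRing C)
          (algebraMap A (FractionRing A) a))⁻¹ * (a • α) := by
        rw [Algebra.smul_def, IsScalarTower.algebraMap_apply A (FractionRing A) (FractionRing C),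
          inv_mul_cancel_left₀ ha']
      have h3 := mul_mem (inv_mem (IntermediateField.algebraMap_mem
        (IntermediateField.adjoin (FractionRing A) {a • α}) (algebraMap A (FractionRing A) a)))
        (IntermediateField.mem_adjoin_simple_self (FractionRing A) (a • α))
      rwa [← h2] at h3
  ext x
  rw [← mem_intermediateOf (A := A) (hL := hL), ← h1]
  rfl

variable [IsIntegrallyClosed A]

theorem minpoly_algebraMap_eq {f : A[X]} (hf : f.Monic) (hirr : Irreducible f) {ξ : C}
    (hξ : aeval ξ f = 0) :
    minpoly (FractionRing A) (algebraMap C (FractionRing C) ξ) = f.map (algebraMap A _) := by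
  have h1 : aeval (algebraMap C (FractionRing C) ξ) f = 0 := by
    rw [aeval_algebraMap_apply, hξ, map_zero]
  have h2 : IsIntegral A (algebraMap C (FractionRing C) ξ) := ⟨f, hf, h1⟩
  rw [minpoly.isIntegrallyClosed_eq_field_fractions' (FractionRing A) h2,
    ← eq_minpoly_of_irreducible hf hirr h1]

end RadicalBasis

/-! ### Degrees, primitive elements and splitting for an embedding with a radical basis. -/

section RadicalHom

attribute [local instance] FractionRing.liftAlgebra

variable {K A C B : Type*} [Field K] [CommRing A] [IsDomain A] [Algebra K A]
  [CommRing C] [IsDomain C] [Algebra K C] [Fintype B] {m : ℕ} {μ : B → C} {φ : A →ₐ[K] C}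

theorem IsRadicalBasis.natDegree_dvd [IsIntegrallyClosed A] (hφ : Function.Injective φ)
    (h : IsRadicalBasis φ.toRingHom m μ) {f : A[X]} (hf : f.Monic)
    (hirr : Irreducible f) {ξ : C} (hξ : f.eval₂ φ.toRingHom ξ = 0) :
    f.natDegree ∣ Fintype.card B := by
  let _ : Algebra A C := φ.toRingHom.toAlgebra
  have : FaithfulSMul A C := (faithfulSMul_iff_algebraMap_injective A C).mpr hφ
  have : FiniteDimensional (FractionRing A) (FractionRing C) :=
    (radicalBasis h).finiteDimensional_of_finite
  have h1 := minpoly.degree_dvd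
    (IsIntegral.of_finite (FractionRing A) (algebraMap C (FractionRing C) ξ))
  rwa [minpoly_algebraMap_eq hf hirr (ξ := ξ) hξ, Module.finrank_eq_card_basis (radicalBasis h),
    hf.natDegree_map] at h1

variable [IsAlgClosed K]

theorem IsRadicalBasis.exists_primitive [IsIntegrallyClosed C] (hφ : Function.Injective φ)
    (hm : (m : K) ≠ 0) (h : IsRadicalBasis φ.toRingHom m μ) (L : Subfield (FractionRing C))
    (hL : ∀ a, algebraMap C (FractionRing C) (φ a) ∈ L) :
    ∃ ξ : C, genField φ.toRingHom {ξ} = L := by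
  let _ : Algebra A C := φ.toRingHom.toAlgebra
  have : FaithfulSMul A C := (faithfulSMul_iff_algebraMap_injective A C).mpr hφ
  exact exists_primitive_of_radicals hm h L hL

theorem IsRadicalBasis.mem_of_sum_mem (hφ : Function.Injective φ) (hm : (m : K) ≠ 0)
    (h : IsRadicalBasis φ.toRingHom m μ) (L : Subfield (FractionRing C))
    (hL : ∀ a, algebraMap C (FractionRing C) (φ a) ∈ L) (c : B → A)
    (hc : algebraMap C (FractionRing C) (∑ b, φ (c b) * μ b) ∈ L) {b : B} (hb : c b ≠ 0) :
    algebraMap C (FractionRing C) (μ b) ∈ L := by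
  let _ : Algebra A C := φ.toRingHom.toAlgebra
  have : FaithfulSMul A C := (faithfulSMul_iff_algebraMap_injective A C).mpr hφ
  exact radical_mem_of_sum_mem_subfield hm h L hL c hc hb

/-- Over the fraction field of A, f becomes the minimal polynomial of ξ, which splits in the Galois
extension Frac(C); its roots are integral, so they lie in C. -/
theorem IsRadicalBasis.splits [IsIntegrallyClosed A] [IsIntegrallyClosed C]
    (hφ : Function.Injective φ) (hm : (m : K) ≠ 0) (h : IsRadicalBasis φ.toRingHom m μ)
    {f : A[X]} (hf : f.Monic) (hirr : Irreducible f) {ξ : C} (hξ : f.eval₂ φ.toRingHom ξ = 0) :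
    (f.map φ.toRingHom).Splits := by
  let _ : Algebra A C := φ.toRingHom.toAlgebra
  have : FaithfulSMul A C := (faithfulSMul_iff_algebraMap_injective A C).mpr hφ
  have := isGalois_radicals K hm h
  have hmin := minpoly_algebraMap_eq hf hirr (ξ := ξ) hξ
  have h1 := IsGalois.splits (FractionRing A) (algebraMap C (FractionRing C) ξ)
  have h2 : (algebraMap (FractionRing A) (FractionRing C)).comp (algebraMap A (FractionRing A)) =
      (algebraMap C (FractionRing C)).comp φ.toRingHom := by
    rw [← IsScalarTower.algebraMap_eq, IsScalarTower.algebraMap_eq A C (FractionRing C)]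
    rfl
  rw [hmin, Polynomial.map_map, h2, ← Polynomial.map_map] at h1
  refine Splits.of_splits_map_of_injective (IsFractionRing.injective C (FractionRing C)) h1 ?_
  intro x hx
  refine IsIntegrallyClosed.isIntegral_iff.mp ⟨f.map φ.toRingHom, hf.map _, ?_⟩
  rw [← eval_map]
  exact isRoot_of_mem_roots hx

end RadicalHom

instance isDomain_mvPowerSeries (n : ℕ) (K : Type*) [Field K] :
    IsDomain (MvPowerSeries (Fin n) K) := NoZeroDivisors.to_isDomain _

/-! ### The extension K[[x]] ⊆ K[[x^{1/m}]]. -/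

section Expand

open MvPowerSeries

variable {n : ℕ} {K : Type*} [Field K] {m : ℕ}

theorem isFull_top : IsFull (⊤ : AddSubmonoid (Fin n →₀ ℕ)) := fun _ _ _ _ => trivial

theorem mem_supported_top (g : MvPowerSeries (Fin n) K) : g ∈ supported K ⊤ :=
  fun _ h => absurd trivial h

theorem coeff_expand_mul_monomial (hm : m ≠ 0) (g : MvPowerSeries (Fin n) K)
    (β β' : Fin n → Fin m) (γ : Fin n →₀ ℕ) :
    coeff (boxExp β + m • γ) (MvPowerSeries.expand m hm g * monomial (boxExp β') 1) =
      if β' = β then coeff γ g else 0 := by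
  classical
  rw [MvPowerSeries.coeff_mul_monomial, mul_one]
  split_ifs with h1 h2 h2
  · rw [h2, add_tsub_cancel_left, coeff_expand_smul]
  · obtain ⟨i, hi⟩ : ∃ i, β' i ≠ β i := by
      by_contra! h
      exact h2 (funext h)
    refine coeff_expand_of_not_dvd m hm g (i := i) fun hdvd => hi ?_
    obtain ⟨k, hk⟩ := hdvd
    have h3 := h1 i
    simp only [Finsupp.coe_tsub, Pi.sub_apply, Finsupp.coe_add, Pi.add_apply, boxExp_apply,
      Finsupp.coe_smul, Pi.smul_apply, smul_eq_mul] at hk h3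
    have h4 : (β i : ℕ) + m * γ i = β' i + m * k := by omega
    have h5 := congrArg (· % m) h4
    simp only [Nat.add_mul_mod_self_left] at h5
    rw [Nat.mod_eq_of_lt (β i).2, Nat.mod_eq_of_lt (β' i).2] at h5
    exact Fin.ext h5.symm
  · subst h2
    exact absurd (self_le_add_right _ _) h1
  · rfl

/-- Spanning is Euclidean division of exponents with trivial units; independence holds because
different box monomials contribute to different residue classes modulo m. -/
theorem isRadicalBasis_expand (hm : m ≠ 0) :
    IsRadicalBasis (MvPowerSeries.expand (R := K) (σ := Fin n) m hm).toRingHom m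
      fun β : Fin n → Fin m => monomial (boxExp β) 1 where
  ne_zero β := by
    classical
    intro h
    have := congrArg (MvPowerSeries.coeff (boxExp β)) h
    rw [MvPowerSeries.coeff_monomial_same, map_zero] at this
    exact one_ne_zero this
  pow_mem β := ⟨monomial (boxExp β) 1, by
    change MvPowerSeries.expand m hm _ = _
    rw [MvPowerSeries.expand_monomial, MvPowerSeries.monomial_pow, one_pow]⟩
  span θ := by
    obtain ⟨h, -, hh⟩ := exists_eq_sum_twist (T := ⊤) (u := fun _ => (1 : MvPowerSeries (Fin n) K))
      hm isFull_top (fun _ => trivial) (fun _ => mem_supported_top _) (fun _ => by simp)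
      (mem_supported_top θ)
    refine ⟨h, hh.trans (Finset.sum_congr rfl fun β _ => ?_)⟩
    rw [twist_one, mul_comm]
    rfl
  indep h hh β := by
    classical
    ext γ
    have h1 := congrArg (MvPowerSeries.coeff (boxExp β + m • γ)) hh
    rw [map_sum, map_zero] at h1
    rw [map_zero, ← h1]
    have : ∀ b, coeff (boxExp β + m • γ) ((MvPowerSeries.expand m hm).toRingHom (h b) *
        monomial (boxExp b) 1) = if b = β then coeff γ (h b) else 0 := fun b =>
      coeff_expand_mul_monomial hm (h b) β b γ
    rw [Finset.sum_congr rfl fun b _ => this b, Finset.sum_ite_eq' Finset.univ β,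
      if_pos (Finset.mem_univ β)]

theorem expand_injective (hm : m ≠ 0) :
    Function.Injective (MvPowerSeries.expand (R := K) (σ := Fin n) m hm) := by
  rw [← twist_one]
  exact twist_injective hm fun _ => by simp

theorem isPuiseux_of_splits {f : (MvPowerSeries (Fin n) K)[X]} (hf : f.Monic) (hm : m ≠ 0)
    (h : (f.map (MvPowerSeries.expand (R := K) (σ := Fin n) m hm).toRingHom).Splits) :
    IsPuiseux f := by
  refine ⟨hf, m, hm, _, fun i => (f.map
    (MvPowerSeries.expand (R := K) (σ := Fin n) m hm).toRingHom).roots.toList.get i, ?_⟩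
  have h1 := h.eq_prod_roots_of_monic (hf.map _)
  conv_lhs => rw [h1]
  conv_lhs => rw [← Multiset.coe_toList (Polynomial.roots _)]
  rw [Multiset.map_coe, Multiset.prod_coe, ← List.prod_ofFn]
  congr 1
  refine List.ext_get (by simp) fun i h1 h2 => by simp

theorem isIntegral_twist {N : ℕ} (hN : N ≠ 0) {u : Fin n → MvPowerSeries (Fin n) K}
    (hu : ∀ i, constantCoeff (u i) = 1) : (twist hN u).toRingHom.IsIntegral := by
  refine isIntegral_of_span (μ := fun β : Fin n → Fin N => monomial (boxExp β) 1) fun θ => ?_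
  obtain ⟨h, -, hh⟩ := exists_eq_sum_twist (T := ⊤) hN isFull_top (fun _ => trivial)
    (fun _ => mem_supported_top _) hu (mem_supported_top θ)
  exact ⟨h, hh.trans (Finset.sum_congr rfl fun β _ => mul_comm _ _)⟩

end Expand

/-! ### Comparing K[[T]] with subfields of the fraction field. -/

section SupportedField

open MvPowerSeries

variable {n : ℕ} {K A : Type*} [Field K] [CommRing A] {T : AddSubmonoid (Fin n →₀ ℕ)}

/-- Every element of the generated field is a fraction a / b over K[[T]], and b * θ = a forces θ
into K[[T]] by fullness. -/
theorem mem_supported_of_mem_genField (hT : IsFull T) {φ : A →+* MvPowerSeries (Fin n) K}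
    {s : Set (MvPowerSeries (Fin n) K)} (hφ : ∀ a, φ a ∈ supported K T)
    (hs : ∀ x ∈ s, x ∈ supported K T) {θ : MvPowerSeries (Fin n) K}
    (h : algebraMap (MvPowerSeries (Fin n) K) _ θ ∈ genField φ s) :
    θ ∈ supported K T := by
  set ι := algebraMap (MvPowerSeries (Fin n) K) (FractionRing (MvPowerSeries (Fin n) K)) with hι
  have hinj : Function.Injective ι := IsFractionRing.injective _ _
  have key : ∀ x ∈ genField φ s, ∃ a b, a ∈ supported K T ∧ b ∈ supported K T ∧ b ≠ 0 ∧
      x = ι a / ι b := by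
    intro x hx
    refine Subfield.closure_induction (p := fun x _ => ∃ a b, a ∈ supported K T ∧
      b ∈ supported K T ∧ b ≠ 0 ∧ x = ι a / ι b) ?_ ?_ ?_ ?_ ?_ ?_ hx
    · rintro _ ⟨y, (⟨a, rfl⟩ | hy), rfl⟩
      · exact ⟨φ a, 1, hφ a, one_mem _, one_ne_zero, by simp [hι]⟩
      · exact ⟨y, 1, hs y hy, one_mem _, one_ne_zero, by simp [hι]⟩
    · exact ⟨1, 1, one_mem _, one_mem _, one_ne_zero, by simp⟩
    · rintro _ _ _ _ ⟨a, b, ha, hb, hb0, rfl⟩ ⟨c, d, hc, hd, hd0, rfl⟩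
      refine ⟨a * d + b * c, b * d, add_mem (mul_mem ha hd) (mul_mem hb hc), mul_mem hb hd,
        mul_ne_zero hb0 hd0, ?_⟩
      rw [div_add_div _ _ ((map_ne_zero_iff ι hinj).mpr hb0) ((map_ne_zero_iff ι hinj).mpr hd0)]
      simp
    · rintro _ _ ⟨a, b, ha, hb, hb0, rfl⟩
      exact ⟨-a, b, neg_mem ha, hb, hb0, by rw [map_neg, neg_div]⟩
    · rintro _ _ ⟨a, b, ha, hb, hb0, rfl⟩
      by_cases ha0 : a = 0
      · exact ⟨0, 1, zero_mem _, one_mem _, one_ne_zero, by simp [ha0]⟩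
      · exact ⟨b, a, hb, ha, ha0, by rw [inv_div]⟩
    · rintro _ _ _ _ ⟨a, b, ha, hb, hb0, rfl⟩ ⟨c, d, hc, hd, hd0, rfl⟩
      exact ⟨a * c, b * d, mul_mem ha hc, mul_mem hb hd, mul_ne_zero hb0 hd0, by
        rw [map_mul, map_mul, div_mul_div_comm]⟩
  obtain ⟨a, b, ha, hb, hb0, h1⟩ := key _ h
  rw [eq_div_iff ((map_ne_zero_iff ι hinj).mpr hb0), ← map_mul] at h1
  refine mem_supported_of_mul_mem hT hb hb0 ?_
  rw [mul_comm, hinj h1]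
  exact ha

theorem algebraMap_mem_of_mem_supported {N : ℕ} (hN : N ≠ 0) (hT : IsFull T)
    (hNT : ∀ α, N • α ∈ T) {u : Fin n → MvPowerSeries (Fin n) K} (hu : ∀ i, u i ∈ supported K T)
    (hu1 : ∀ i, constantCoeff (u i) = 1)
    {L : Subfield (FractionRing (MvPowerSeries (Fin n) K))}
    (hL : ∀ a, algebraMap (MvPowerSeries (Fin n) K) _ (twist hN u a) ∈ L)
    (hmon : ∀ α ∈ T, algebraMap (MvPowerSeries (Fin n) K) _ (monomial α 1) ∈ L)
    {g : MvPowerSeries (Fin n) K} (hg : g ∈ supported K T) :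
    algebraMap (MvPowerSeries (Fin n) K) _ g ∈ L := by
  obtain ⟨h, h0, hh⟩ := exists_eq_sum_twist hN hT hNT hu hu1 hg
  rw [hh, map_sum]
  refine sum_mem fun β _ => ?_
  rw [map_mul]
  by_cases hβ : boxExp β ∈ T
  · exact mul_mem (hmon _ hβ) (hL _)
  · rw [h0 β hβ]
    simp

/-- The normalization of the hypersurface defined by a polynomial with a root that generates the
fraction field of `K[[T]]`. -/
theorem nonempty_normalization_equiv_supported {N : ℕ} (hN : N ≠ 0) (hT : IsFull T)
    (hNT : ∀ α, N • α ∈ T) {u : Fin n → MvPowerSeries (Fin n) K} (hu : ∀ i, u i ∈ supported K T)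
    (hu1 : ∀ i, constantCoeff (u i) = 1) {f : (MvPowerSeries (Fin n) K)[X]} (hf : f.Monic)
    (hirr : Irreducible f) {ξ : MvPowerSeries (Fin n) K} (hξT : ξ ∈ supported K T)
    (hξ : f.eval₂ (twist hN u).toRingHom ξ = 0)
    (hmon : ∀ α ∈ T, algebraMap (MvPowerSeries (Fin n) K) _ (monomial α 1) ∈
      genField (twist hN u).toRingHom {ξ}) :
    IsDomain (AdjoinRoot f) ∧ Nonempty (Normalization (AdjoinRoot f) ≃ₐ[K] supported K T) := by
  refine nonempty_normalization_equiv (twist hN u) (twist_injective hN hu1)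
    (isIntegral_twist hN hu1) hf hirr hξ (supported K T) fun θ => ⟨fun hθ => ?_, fun hθ => ?_⟩
  · exact algebraMap_mem_of_mem_supported hN hT hNT hu hu1
      (algebraMap_mem_genField (twist hN u).toRingHom {ξ}) hmon hθ
  · exact mem_supported_of_mem_genField hT (twist_mem hN hNT hu) (by rintro x rfl; exact hξT) hθ

end SupportedField

/-! ### Removing the p-part of the denominator of a separable root. -/

section Descent

open MvPowerSeries

variable {n : ℕ} {K : Type*} [Field K]

/-- The exponents divisible by `q`. -/
noncomputable def multiples (n q : ℕ) : AddSubmonoid (Fin n →₀ ℕ) :=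
  AddMonoidHom.mrange (nsmulAddMonoidHom q)

theorem mem_multiples {q : ℕ} {α : Fin n →₀ ℕ} : α ∈ multiples n q ↔ ∃ β, q • β = α := Iff.rfl

theorem isFull_multiples (q : ℕ) : IsFull (multiples n q) := by
  rintro _ ⟨α, rfl⟩ β ⟨γ, hγ⟩
  refine ⟨γ - α, ?_⟩
  ext i
  have := DFunLike.congr_fun hγ i
  simp only [nsmulAddMonoidHom_apply, Finsupp.coe_add, Pi.add_apply, Finsupp.coe_smul,
    Pi.smul_apply, smul_eq_mul, Finsupp.coe_tsub, Pi.sub_apply] at this ⊢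
  rw [Nat.mul_sub]
  omega

theorem expand_mem_supported_multiples {q : ℕ} (hq : q ≠ 0) (g : MvPowerSeries (Fin n) K) :
    MvPowerSeries.expand q hq g ∈ supported K (multiples n q) := by
  rw [← twist_one]
  exact twist_mem hq (fun α => mem_multiples.mpr ⟨α, rfl⟩) (fun _ => one_mem _) g

theorem mem_range_expand {q : ℕ} (hq : q ≠ 0) {g : MvPowerSeries (Fin n) K}
    (hg : g ∈ supported K (multiples n q)) : ∃ g', MvPowerSeries.expand q hq g' = g := by
  let g' : MvPowerSeries (Fin n) K := fun γ => coeff (q • γ) g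
  refine ⟨g', ?_⟩
  ext δ
  by_cases hδ : δ ∈ multiples n q
  · obtain ⟨γ, rfl⟩ := hδ
    rw [nsmulAddMonoidHom_apply, coeff_expand_smul]
    rfl
  · rw [hg δ hδ]
    exact expand_mem_supported_multiples hq _ δ hδ

theorem pow_expChar_pow_eq_expand {p : ℕ} [ExpChar K p] (k : ℕ)
    (hp : p ^ k ≠ 0) (g : MvPowerSeries (Fin n) K) :
    g ^ p ^ k = MvPowerSeries.expand (p ^ k) hp (MvPowerSeries.map (iterateFrobenius K p k) g) := by
  rw [← MvPowerSeries.map_iterateFrobenius_expand p (expChar_pos K p).ne', MvPowerSeries.map_expand]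

/-- The coefficient of the derivative in degree d - 1 is d, which is nonzero in K. -/
theorem separable_map_of_not_dvd {A F : Type*} [CommRing A] [Algebra K A] [IsDomain A]
    [IsIntegrallyClosed A] [Field F] [Algebra A F] [IsFractionRing A F] {f : A[X]} (hf : f.Monic)
    (hirr : Irreducible f) (hd : ¬ ringChar K ∣ f.natDegree) :
    (f.map (algebraMap A F)).Separable := by
  have h1 := (hf.irreducible_iff_irreducible_map_fraction_map (K := F)).mp hirr
  rw [separable_iff_derivative_ne_zero h1]
  intro h2
  have hd0 : f.natDegree ≠ 0 := fun h => hd (h ▸ dvd_zero _)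
  have h3 := congrArg (fun g => Polynomial.coeff g (f.natDegree - 1)) h2
  have h4 : f.natDegree - 1 + 1 = f.natDegree := by omega
  simp only [coeff_derivative, Polynomial.coeff_map, h4, hf.coeff_natDegree, map_one, one_mul,
    Polynomial.coeff_zero] at h3
  apply hd
  rw [← ringChar.spec]
  have h5 : algebraMap A F (algebraMap K A (f.natDegree : K)) = 0 := by
    rw [map_natCast, map_natCast, ← h4]
    exact_mod_cast h3
  exact (algebraMap K A).injective
    (by rw [(IsFractionRing.injective A F).eq_iff' (map_zero _)] at h5; rw [h5, map_zero])

attribute [local instance] FractionRing.liftAlgebra in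
/-- A separable element of a purely inseparable extension by `p ^ k`-th roots lies in the base. -/
theorem mem_of_separable_of_pow_mem {A C : Type*} [CommRing A] [IsDomain A] [IsIntegrallyClosed A]
    [CommRing C] [IsDomain C] {p : ℕ} [ExpChar A p] {φ : A →+* C} (hφ : Function.Injective φ)
    {f : A[X]} (hf : f.Monic) (hirr : Irreducible f)
    (hsep : (f.map (algebraMap A (FractionRing A))).Separable) {ξ : C}
    (hξ : f.eval₂ φ ξ = 0) (L : Subfield (FractionRing C))
    (hL : ∀ a, algebraMap C (FractionRing C) (φ a) ∈ L) {k : ℕ}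
    (hξL : algebraMap C (FractionRing C) (ξ ^ p ^ k) ∈ L) :
    algebraMap C (FractionRing C) ξ ∈ L := by
  let _ : Algebra A C := φ.toAlgebra
  have : FaithfulSMul A C := (faithfulSMul_iff_algebraMap_injective A C).mpr hφ
  have : ExpChar (FractionRing A) p :=
    expChar_of_injective_ringHom (IsFractionRing.injective A (FractionRing A)) p
  have hmin := minpoly_algebraMap_eq hf hirr (ξ := ξ) hξ
  have h1 : IsSeparable (FractionRing A) (algebraMap C (FractionRing C) ξ) := by
    rw [IsSeparable, hmin]
    exact hsep
  -- A separable element generates the same field as its p ^ k-th power.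
  have h2 := IntermediateField.adjoin_simple_eq_adjoin_pow_expChar_pow_of_isSeparable
    (FractionRing A) (FractionRing C) h1 p k
  have h3 : IntermediateField.adjoin (FractionRing A)
      {algebraMap C (FractionRing C) ξ ^ p ^ k} ≤ intermediateOf (A := A) L hL := by
    rw [IntermediateField.adjoin_simple_le_iff, ← map_pow]
    exact hξL
  exact h3 (h2 ▸ IntermediateField.mem_adjoin_simple_self _ _)

/-- The p ^ k-th power of any series is a series in the xᵢ ^ (p ^ k). By separability ξ lies in the
field generated by such series, so all its exponents are divisible by p ^ k and it descends along
`expand`. -/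
theorem exists_root_of_separable {p : ℕ} [ExpChar K p] [IsAlgClosed K] {m k : ℕ} (hm : m ≠ 0)
    (hq : p ^ k ≠ 0) {f : (MvPowerSeries (Fin n) K)[X]} (hf : f.Monic) (hirr : Irreducible f)
    (hd : ¬ ringChar K ∣ f.natDegree) {ξ : MvPowerSeries (Fin n) K}
    (hξ : f.eval₂ (MvPowerSeries.expand (R := K) (p ^ k * m) (mul_ne_zero hq hm)).toRingHom ξ = 0) :
    ∃ ξ', f.eval₂ (MvPowerSeries.expand (R := K) m hm).toRingHom ξ' = 0 := by
  have : ExpChar (MvPowerSeries (Fin n) K) p :=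
    expChar_of_injective_algebraMap (algebraMap K _).injective p
  have hcomp : ∀ a : MvPowerSeries (Fin n) K, MvPowerSeries.expand (p ^ k * m)
      (mul_ne_zero hq hm) a = MvPowerSeries.expand (p ^ k) hq (MvPowerSeries.expand m hm a) :=
    fun a => MvPowerSeries.expand_mul _ _ _ _ a
  have h1 := mem_of_separable_of_pow_mem (p := p) (k := k) (expand_injective (mul_ne_zero hq hm)) hf
    hirr (separable_map_of_not_dvd (K := K) hf hirr hd) hξ
    (genField (MvPowerSeries.expand (R := K) (σ := Fin n) (p ^ k) hq).toRingHom ∅) (fun a => by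
      change algebraMap _ _ (MvPowerSeries.expand _ _ a) ∈ _
      rw [hcomp]
      exact algebraMap_mem_genField _ _ _) (by
      rw [pow_expChar_pow_eq_expand k hq]
      exact algebraMap_mem_genField _ _ _)
  have h2 := mem_supported_of_mem_genField (isFull_multiples (p ^ k))
    (expand_mem_supported_multiples hq) (by simp) h1
  obtain ⟨ξ', rfl⟩ := mem_range_expand hq h2
  refine ⟨ξ', expand_injective hq ?_⟩
  change (MvPowerSeries.expand (p ^ k) hq).toRingHom _ = _
  rw [hom_eval₂, map_zero, ← hξ]
  congr 1
  ext1 a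
  exact (hcomp a).symm

end Descent

/-! ### Laurent monomials and their exponent lattices. -/

section Exponents

open MvPowerSeries

variable {n : ℕ} {K : Type*} [Field K]

/-- The Laurent monomial with exponent `z`. -/
noncomputable def laurent (K : Type*) [Field K] (z : Fin n → ℤ) :
    FractionRing (MvPowerSeries (Fin n) K) :=
  ∏ i, algebraMap (MvPowerSeries (Fin n) K) _ (X i) ^ z i

theorem X_ne_zero_mvPowerSeries (i : Fin n) : (X i : MvPowerSeries (Fin n) K) ≠ 0 := by
  intro h
  have := congrArg (MvPowerSeries.coeff (Finsupp.single i 1)) h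
  rw [coeff_index_single_self_X, map_zero] at this
  exact one_ne_zero this

theorem algebraMap_X_ne_zero (i : Fin n) :
    algebraMap (MvPowerSeries (Fin n) K) (FractionRing (MvPowerSeries (Fin n) K)) (X i) ≠ 0 :=
  (map_ne_zero_iff _ (IsFractionRing.injective _ _)).mpr (X_ne_zero_mvPowerSeries i)

theorem laurent_add (z w : Fin n → ℤ) : laurent K (z + w) = laurent K z * laurent K w := by
  rw [laurent, laurent, laurent, ← Finset.prod_mul_distrib]
  exact Finset.prod_congr rfl fun i _ => zpow_add₀ (algebraMap_X_ne_zero i) _ _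

theorem laurent_neg (z : Fin n → ℤ) : laurent K (-z) = (laurent K z)⁻¹ := by
  rw [laurent, laurent, ← Finset.prod_inv_distrib]
  exact Finset.prod_congr rfl fun i _ => zpow_neg _ _

theorem monomial_eq_prod (α : Fin n →₀ ℕ) :
    (monomial α (1 : K) : MvPowerSeries (Fin n) K) = ∏ i, X i ^ α i := by
  simpa [unitPow, Finsupp.prod_fintype] using
    (prod_X_pow_mul (N := 1) (fun _ => (1 : MvPowerSeries (Fin n) K)) α).symm

theorem laurent_castHom (α : Fin n →₀ ℕ) :
    laurent K (castHom n α) = algebraMap (MvPowerSeries (Fin n) K) _ (monomial α 1) := by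
  rw [monomial_eq_prod, map_prod, laurent]
  simp

/-- The exponents of the Laurent monomials in a field. -/
noncomputable def exponents (L : Subfield (FractionRing (MvPowerSeries (Fin n) K))) :
    AddSubgroup (Fin n → ℤ) where
  carrier := {z | laurent K z ∈ L}
  zero_mem' := by simp [laurent]
  add_mem' {a b} ha hb := by
    rw [Set.mem_ofPred_eq, laurent_add]
    exact mul_mem ha hb
  neg_mem' {a} ha := by
    rw [Set.mem_ofPred_eq, laurent_neg]
    exact inv_mem ha

theorem mem_natPoints_exponents {L : Subfield (FractionRing (MvPowerSeries (Fin n) K))}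
    {α : Fin n →₀ ℕ} : α ∈ natPoints (exponents L) ↔
      algebraMap (MvPowerSeries (Fin n) K) _ (monomial α 1) ∈ L := by
  rw [← laurent_castHom]
  rfl

end Exponents

/-! ### From a Puiseux polynomial to a toric singularity. -/

section Toric

open MvPowerSeries

variable {n : ℕ} {K : Type*} [Field K] {T : AddSubmonoid (Fin n →₀ ℕ)}

/-- K[[T]] is a finite module over the power series ring in the xᵢ ^ N, generated by the box
monomials with exponents in T. -/
theorem isNoetherianRing_supported {N : ℕ} (hN : N ≠ 0) (hT : IsFull T)
    (hNT : ∀ α, N • α ∈ T) : IsNoetherianRing (supported K T) := by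
  classical
  let φ : MvPowerSeries (Fin n) K →ₐ[K] supported K T :=
    (twist hN fun _ => 1).codRestrict (supported K T) (twist_mem hN hNT fun _ => one_mem _)
  let _ : Algebra (MvPowerSeries (Fin n) K) (supported K T) := φ.toRingHom.toAlgebra
  let μ : (Fin n → Fin N) → supported K T := fun β =>
    if h : boxExp β ∈ T then ⟨monomial (boxExp β) 1, monomial_mem_supported h 1⟩ else 0
  have : Module.Finite (MvPowerSeries (Fin n) K) (supported K T) := by
    refine Module.Finite.of_surjective (Fintype.linearCombination _ μ) fun θ => ?_
    obtain ⟨h, h0, hh⟩ := exists_eq_sum_twist hN hT hNT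
      (u := fun _ => (1 : MvPowerSeries (Fin n) K)) (fun _ => one_mem _) (fun _ => by simp) θ.2
    refine ⟨h, Subtype.ext ?_⟩
    rw [hh, Fintype.linearCombination_apply, AddSubmonoidClass.coe_finsetSum]
    refine Finset.sum_congr rfl fun β _ => ?_
    by_cases hβ : boxExp β ∈ T
    · rw [Algebra.smul_def, MulMemClass.coe_mul, mul_comm]
      simp only [μ, dif_pos hβ]
      rfl
    · simp [h0 β hβ]
  exact isNoetherian_of_tower (MvPowerSeries (Fin n) K) inferInstance

theorem exists_isLocalRing_of_algEquiv {D : Type*} [CommRing D] [Algebra K D] (hT : IsFull T)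
    (hfg : T.FG) (e : D ≃ₐ[K] supported K T) {S : AddSubmonoid (Fin n → ℚ)} (ε : S ≃+ T) :
    ∃ _ : IsLocalRing D,
      AnalyticallyIsomorphic K (IsLocalRing.maximalIdeal D) (specialIdeal K S) := by
  have h1 : IsLocalRing (supported K T) := isLocalRing_supported hT
  have h2 : IsLocalRing D := e.symm.toRingEquiv.isLocalRing
  refine ⟨h2, (AnalyticallyIsomorphic.of_algEquiv e).trans ?_⟩
  rw [maximalIdeal_supported hT]
  exact (analyticallyIsomorphic_supported hfg ε).symm

/-- A lattice between `N ℤⁿ` and `ℤⁿ`, scaled by `1 / N`, forms a simplicial pair with the positive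
orthant. -/
theorem exists_isSimplicialPair {N : ℕ} (hN : N ≠ 0) {P : AddSubgroup (Fin n → ℤ)}
    (hP : ∀ z, N • z ∈ P) :
    ∃ (M : AddSubgroup (Fin n → ℚ)) (v : Fin n → Fin n → ℤ), IsSimplicialPair M v ∧
      Nonempty (semigroup M (cone v) ≃+ natPoints P) := by
  classical
  let v : Fin n → Fin n → ℤ := fun i j => if i = j then 1 else 0
  have hv : LinearIndependent ℝ fun i j => (v i j : ℝ) := by
    rw [Fintype.linearIndependent_iff]
    intro c hc i
    have := congrFun hc i
    simpa [v] using this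
  let w : Fin n → Fin n → ℚ := fun i j => 1 * (v i j : ℚ)
  have hw : w = fun i j => (v i j : ℚ) := by ext; simp [w]
  have hli : LinearIndependent ℚ w := hw ▸ linearIndependent_cast_real hv
  have hcomap : (P.map (latMap N w)).comap (latMap N w) = P :=
    AddSubgroup.comap_map_eq_self_of_injective (latMap_injective hN hli) P
  refine ⟨P.map (latMap N w), v, ⟨?_, ?_, hv⟩, ?_⟩
  · have : P.FG := by
      have := IsNoetherian.noetherian (R := ℤ) (M := Fin n → ℤ) (AddSubgroup.toIntSubmodule P)
      rw [Submodule.fg_iff_addSubgroup_fg] at this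
      exact this
    obtain ⟨G, hG⟩ := this
    exact ⟨G.image (latMap N w), by rw [Finset.coe_image, ← AddMonoidHom.map_closure, hG]⟩
  · intro a
    refine ⟨N • a, hP a, ?_⟩
    rw [latMap_nsmul hN]
    ext j
    simp [w, v]
  · have h := nonempty_semigroup_equiv (M := P.map (latMap N w)) (v := v) hv hN (r := fun _ => 1)
      (fun _ => one_pos) (by rintro _ ⟨z, -, rfl⟩; exact ⟨z, rfl⟩)
    change Nonempty (_ ≃+ natPoints ((P.map (latMap N w)).comap (latMap N w))) at h
    rwa [hcomap] at h

theorem exists_eq_pow_mul_and_natCast_ne_zero (p : ℕ) [hp : ExpChar K p] {m : ℕ} (hm : m ≠ 0) :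
    ∃ k N : ℕ, N ≠ 0 ∧ (N : K) ≠ 0 ∧ m = p ^ k * N := by
  cases hp with
  | zero => exact ⟨0, m, hm, by exact_mod_cast hm, by simp⟩
  | prime hpr =>
    obtain ⟨k, N, h1, h2⟩ := Nat.exists_eq_pow_mul_and_not_dvd hm p hpr.ne_one
    exact ⟨k, N, by rintro rfl; simp at h1, by rwa [Ne, CharP.cast_eq_zero_iff K p], h2⟩

/-- The normalization of the hypersurface of an irreducible Puiseux polynomial of degree prime to
the characteristic is a ring of power series with exponents in a saturated monoid. -/
theorem exists_normalization_equiv_supported [IsAlgClosed K] {f : (MvPowerSeries (Fin n) K)[X]}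
    (hf : IsPuiseux f) (hirr : Irreducible f) (hd : ¬ ringChar K ∣ f.natDegree) :
    ∃ (N : ℕ) (_ : N ≠ 0) (P : AddSubgroup (Fin n → ℤ)) (_ : ∀ z, N • z ∈ P),
      IsDomain (AdjoinRoot f) ∧
        Nonempty (Normalization (AdjoinRoot f) ≃ₐ[K] supported K (natPoints P)) := by
  obtain ⟨hmon, m, hm, d, ξ, hprod⟩ := hf
  obtain ⟨p, hp⟩ := ExpChar.exists K
  obtain ⟨k, N, hN, hNK, hmN⟩ := exists_eq_pow_mul_and_natCast_ne_zero (K := K) p hm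
  have hd0 : f.natDegree ≠ 0 := fun h => hd (h ▸ dvd_zero _)
  have hdd : 0 < d := by
    have := congrArg natDegree hprod
    rw [hmon.natDegree_map, natDegree_prod_of_monic _ _ fun i _ => monic_X_sub_C _] at this
    simp at this
    omega
  have hq : p ^ k ≠ 0 := pow_ne_zero _ (expChar_pos K p).ne'
  obtain ⟨θ, hθ⟩ : ∃ θ, f.eval₂ (MvPowerSeries.expand (R := K) N hN).toRingHom θ = 0 := by
    refine exists_root_of_separable (ξ := ξ ⟨0, hdd⟩) hN hq hmon hirr hd ?_
    subst hmN
    rw [← eval_map, hprod, eval_prod]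
    exact Finset.prod_eq_zero (Finset.mem_univ ⟨0, hdd⟩) (by simp)
  set L := genField (MvPowerSeries.expand (R := K) (σ := Fin n) N hN).toRingHom {θ} with hL
  have hNP : ∀ z, N • z ∈ exponents L := by
    intro z
    have h1 : laurent K (N • z) = ∏ i, (algebraMap (MvPowerSeries (Fin n) K) _
        (MvPowerSeries.expand N hN (X i))) ^ z i := by
      refine Finset.prod_congr rfl fun i _ => ?_
      rw [MvPowerSeries.expand_X, map_pow, ← zpow_natCast, ← zpow_mul]
      simp
    change laurent K (N • z) ∈ L
    rw [h1]
    exact prod_mem fun i _ => zpow_mem (algebraMap_mem_genField _ _ _) _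
  have hNT : ∀ α, N • α ∈ natPoints (exponents L) := fun α => by
    rw [mem_natPoints, map_nsmul]
    exact hNP _
  -- By Kummer theory, each box monomial occurring in θ with nonzero coefficient lies in L; its
  -- exponent therefore belongs to the lattice.
  have hθT : θ ∈ supported K (natPoints (exponents L)) := by
    obtain ⟨c, hc⟩ := (isRadicalBasis_expand (K := K) (n := n) hN).span θ
    rw [hc]
    refine sum_mem fun β _ => ?_
    by_cases h0 : c β = 0
    · simp [h0]
    · refine mul_mem ?_ (monomial_mem_supported ?_ 1)
      · change MvPowerSeries.expand N hN _ ∈ _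
        rw [← twist_one]
        exact twist_mem hN hNT (fun _ => one_mem _) _
      · rw [mem_natPoints_exponents]
        refine (isRadicalBasis_expand (K := K) (n := n) hN).mem_of_sum_mem (expand_injective hN)
          hNK L (algebraMap_mem_genField _ _) c ?_ h0
        have h2 : ∑ b, MvPowerSeries.expand N hN (c b) * monomial (boxExp b) 1 = θ := hc.symm
        rw [h2]
        exact mem_genField_of_mem _ (Set.mem_singleton θ)
  refine ⟨N, hN, exponents L, hNP, ?_⟩
  refine nonempty_normalization_equiv_supported hN (isFull_natPoints _) hNT
    (u := fun _ => 1) (fun _ => one_mem _) (fun _ => by simp) hmon hirr hθT ?_ ?_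
  · rwa [twist_one]
  · intro α hα
    rw [twist_one]
    exact mem_natPoints_exponents.mp hα

theorem isRegularLocalRing_or_isHirzebruchJung [IsAlgClosed K] {f : (MvPowerSeries (Fin n) K)[X]}
    (hf : IsPuiseux f) (hirr : Irreducible f) (hd : ¬ ringChar K ∣ f.natDegree) :
    ∃ _ : IsLocalRing (Normalization (AdjoinRoot f)),
      IsRegularLocalRing (Normalization (AdjoinRoot f)) ∨
        IsHirzebruchJung K n (Normalization (AdjoinRoot f)) := by
  obtain ⟨N, hN, P, hP, hdom, ⟨e⟩⟩ := exists_normalization_equiv_supported hf hirr hd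
  obtain ⟨M, v, hpair, ⟨ε⟩⟩ := exists_isSimplicialPair hN hP
  have hT := isFull_natPoints P
  have hNT : ∀ α, N • α ∈ natPoints P := fun α => by
    rw [mem_natPoints, map_nsmul]
    exact hP _
  obtain ⟨hloc, hiso⟩ := exists_isLocalRing_of_algEquiv hT (fg_of_isFull hN hT hNT) e ε
  refine ⟨hloc, or_iff_not_imp_left.mpr fun hsing => ⟨M, v, hpair, ?_, inferInstance, ?_, hsing,
    hiso⟩⟩
  · have := isNoetherianRing_supported (K := K) hN hT hNT
    exact isNoetherianRing_of_ringEquiv _ e.symm.toRingEquiv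
  · exact integralClosure.isIntegrallyClosedOfFiniteExtension (FractionRing (AdjoinRoot f))

end Toric

/-! ### Realizing a lattice when N is prime to the characteristic. -/

section Tame

open MvPowerSeries

theorem exists_irreducible_of_isIntegral {A C : Type*} [CommRing A] [IsDomain A] [CommRing C]
    [IsDomain C] {φ : A →+* C} (hinteg : φ.IsIntegral) (ξ : C) :
    ∃ f : A[X], f.Monic ∧ Irreducible f ∧ f.eval₂ φ ξ = 0 := by
  let _ : Algebra A C := φ.toAlgebra
  have h : IsIntegral A ξ := hinteg ξ
  exact ⟨minpoly A ξ, minpoly.monic h, minpoly.irreducible h, minpoly.aeval A ξ⟩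

variable {n : ℕ} {K : Type*} [Field K] [IsAlgClosed K]

/-- The polynomial is the minimal polynomial of a primitive element of the field generated by the
monomials of T. Its degree divides the degree of the whole Kummer extension, which has a basis of N
^ n monomials. -/
theorem exists_isPuiseux_of_natCast_ne_zero {N : ℕ} (hN : (N : K) ≠ 0)
    {P : AddSubgroup (Fin n → ℤ)} (hP : ∀ α, N • α ∈ natPoints P) :
    ∃ f : (MvPowerSeries (Fin n) K)[X], IsPuiseux f ∧ Irreducible f ∧ f.natDegree ∣ N ^ n ∧
      Nonempty (Normalization (AdjoinRoot f) ≃ₐ[K] supported K (natPoints P)) := by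
  have hN0 : N ≠ 0 := by rintro rfl; simp at hN
  have hB := isRadicalBasis_expand (K := K) (n := n) hN0
  have hinj := expand_injective (K := K) (n := n) hN0
  have hφT : ∀ a, MvPowerSeries.expand (R := K) N hN0 a ∈ supported K (natPoints P) := fun a => by
    rw [← twist_one]
    exact twist_mem hN0 hP (fun _ => one_mem _) a
  set L := genField (MvPowerSeries.expand (R := K) (σ := Fin n) N hN0).toRingHom
    {x | ∃ α ∈ natPoints P, x = monomial α 1} with hL
  obtain ⟨ξ, hξ⟩ := hB.exists_primitive hinj hN L (algebraMap_mem_genField _ _)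
  have hξT : ξ ∈ supported K (natPoints P) := by
    have h1 : algebraMap (MvPowerSeries (Fin n) K) (FractionRing _) ξ ∈ L :=
      hξ ▸ mem_genField_of_mem _ (Set.mem_singleton ξ)
    refine mem_supported_of_mem_genField (isFull_natPoints P) hφT ?_ h1
    rintro _ ⟨α, hα, rfl⟩
    exact monomial_mem_supported hα 1
  obtain ⟨f, hf, hirr, hfξ⟩ := exists_irreducible_of_isIntegral hB.isIntegral ξ
  refine ⟨f, isPuiseux_of_splits hf hN0 (hB.splits hinj hN hf hirr hfξ), hirr, ?_, ?_⟩
  · simpa using hB.natDegree_dvd hinj hf hirr hfξ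
  · refine (nonempty_normalization_equiv_supported hN0 (isFull_natPoints P) hP
      (u := fun _ => 1) (fun _ => one_mem _) (fun _ => by simp) hf hirr hξT ?_ ?_).2
    · rwa [twist_one]
    · intro α hα
      rw [twist_one, hξ]
      exact mem_genField_of_mem _ ⟨α, hα, rfl⟩

end Tame

/-! ### A primitive element argument without separability. -/

section PrimitiveElement

variable {K F E : Type*} [Field K] [Field F] [Algebra K F] [Field E] [Algebra F E]
  [Algebra K E] [IsScalarTower K F E]

/-- A polynomial with values in a subfield at infinitely many points has coefficients there. -/
theorem coeff_mem_of_infinite_eval_mem (G : IntermediateField F E) {s : Set K} (hs : s.Infinite)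
    {g : E[X]} (hg : ∀ c ∈ s, g.eval (algebraMap K E c) ∈ G) (k : ℕ) : g.coeff k ∈ G := by
  classical
  obtain ⟨t, hts, ht⟩ := hs.exists_subset_card_eq (g.natDegree + 1)
  let r : K → G := fun c => if h : g.eval (algebraMap K E c) ∈ G then ⟨_, h⟩ else 0
  have hr : ∀ c ∈ t, (r c : E) = g.eval (algebraMap K E c) := fun c hc => by
    simp only [r, dif_pos (hg c (hts hc))]
  have hv : Set.InjOn (algebraMap K G) (t : Set K) := (algebraMap K G).injective.injOn
  -- With more nodes than the degree, g is recovered by Lagrange interpolation from nodes in K and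
  -- values in G.
  have key : g = (Lagrange.interpolate t (algebraMap K G) r).map (algebraMap G E) := by
    refine Polynomial.eq_of_degrees_lt_of_eval_index_eq (v := algebraMap K E) t
      (algebraMap K E).injective.injOn ?_ ?_ fun c hc => ?_
    · rw [ht]
      exact degree_le_natDegree.trans_lt (by exact_mod_cast Nat.lt_succ_self _)
    · rw [degree_map]
      exact Lagrange.degree_interpolate_lt r hv
    · have h1 : algebraMap K E c = algebraMap G E (algebraMap K G c) := rfl
      rw [← hr c hc, h1, eval_map_algebraMap, aeval_algebraMap_apply, coe_aeval_eq_eval,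
        Lagrange.eval_interpolate_at_node r hv hc]
      rfl
  rw [key, Polynomial.coeff_map]
  exact (Polynomial.coeff (Lagrange.interpolate t (algebraMap K G) r) k).2

variable [Infinite K]

/-- Infinitely many c give the same field G. The expression is polynomial in c, so its coefficients
lie in G; the linear one is m η, and m is invertible. -/
theorem exists_mem_adjoin_of_finite [Finite (IntermediateField F E)] {m : ℕ} (hm : (m : K) ≠ 0)
    (η : E) {x : E} (hx : x ≠ 0) :
    ∃ c : K, η ∈ IntermediateField.adjoin F {x⁻¹ * (1 + algebraMap K E c * (x * η)) ^ m} := by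
  obtain ⟨G, hG⟩ := Finite.exists_infinite_fiber fun c : K =>
    IntermediateField.adjoin F {x⁻¹ * (1 + algebraMap K E c * (x * η)) ^ m}
  rw [Set.infinite_coe_iff] at hG
  obtain ⟨c, hc⟩ := hG.nonempty
  refine ⟨c, ?_⟩
  rw [show IntermediateField.adjoin F _ = G from hc]
  let g : E[X] := C x⁻¹ * (1 + C (x * η) * X) ^ m
  have h1 : g.coeff 1 = m * η := by
    have : ((1 + C (x * η) * X) ^ m : E[X]).coeff 1 = m * (x * η) := by
      have h2 : (1 + C (x * η) * X : E[X]) ^ m = ((1 + X) ^ m).comp (C (x * η) * X) := by simp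
      rw [h2, comp_C_mul_X_coeff, coeff_one_add_X_pow]
      simp
    rw [coeff_C_mul, this]
    field_simp
  have h2 := coeff_mem_of_infinite_eval_mem G hG (g := g) (fun c hc => by
    have h3 : x⁻¹ * (1 + algebraMap K E c * (x * η)) ^ m ∈ G :=
      (show IntermediateField.adjoin F _ = G from hc) ▸
        IntermediateField.mem_adjoin_simple_self F _
    simpa [g, mul_comm] using h3) 1
  rw [h1] at h2
  have hm' : algebraMap K E m ≠ 0 := (_root_.map_ne_zero _).mpr hm
  rw [map_natCast] at hm'
  have h3 := mul_mem (inv_mem (natCast_mem G m)) h2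
  rwa [inv_mul_cancel_left₀ hm'] at h3

/-- The argument takes place inside F(η), which has finitely many intermediate fields because it is
simple, whether separable or not. -/
theorem exists_mem_adjoin_of_isAlgebraic {m : ℕ} (hm : (m : K) ≠ 0) {η : E}
    (hη : IsAlgebraic F η) {x : E} (hx : x ≠ 0) (hxη : x ∈ IntermediateField.adjoin F {η}) :
    ∃ c : K, η ∈ IntermediateField.adjoin F {x⁻¹ * (1 + algebraMap K E c * (x * η)) ^ m} := by
  have : FiniteDimensional F (IntermediateField.adjoin F {η}) :=
    IntermediateField.adjoin.finiteDimensional hη.isIntegral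
  have : Finite (IntermediateField F (IntermediateField.adjoin F {η})) :=
    Field.finite_intermediateField_of_exists_primitive_element F _
      ⟨_, IntermediateField.adjoin_eq_top_of_algebra F _
        (IntermediateField.adjoin.powerBasis hη.isIntegral).adjoin_gen_eq_top⟩
  obtain ⟨c, hc⟩ := exists_mem_adjoin_of_finite (K := K) (F := F)
    (E := IntermediateField.adjoin F {η}) hm (IntermediateField.AdjoinSimple.gen F η)
    (x := ⟨x, hxη⟩) (fun h => hx (congrArg Subtype.val h))
  refine ⟨c, ?_⟩
  have h1 : η ∈ (IntermediateField.adjoin F _).map (IntermediateField.adjoin F {η}).val :=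
    ⟨_, hc, rfl⟩
  rw [IntermediateField.adjoin_map, Set.image_singleton] at h1
  exact h1

end PrimitiveElement

/-! ### Puiseux polynomials with purely inseparable roots. -/

section Inseparable

open MvPowerSeries

variable {n : ℕ} {K : Type*} [Field K] [IsAlgClosed K]

theorem exists_pow_eq_expand {p : ℕ} [ExpChar K p] (k : ℕ) (hp : p ^ k ≠ 0)
    (h : MvPowerSeries (Fin n) K) : ∃ g, g ^ p ^ k = MvPowerSeries.expand (p ^ k) hp h := by
  refine ⟨MvPowerSeries.map (iterateFrobeniusEquiv K p k).symm.toRingHom h, ?_⟩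
  rw [pow_expChar_pow_eq_expand k hp]
  congr 1
  ext α
  simp only [MvPowerSeries.coeff_map]
  exact (iterateFrobeniusEquiv K p k).apply_symm_apply _

/-- An irreducible polynomial is a Puiseux polynomial if it has a root that is a `p ^ k`-th root
of a root of a polynomial which splits over a ring of fractional power series of order prime to
`p`. -/
theorem isPuiseux_of_pow_mem_range {p : ℕ} [ExpChar K p] {k m : ℕ} (hp : p ^ k ≠ 0)
    (hm : (m : K) ≠ 0) (hm0 : m ≠ 0) {C : Type*} [CommRing C] [IsDomain C]
    {ψ : MvPowerSeries (Fin n) K →+* C} (hψ : Function.Injective ψ)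
    {f : (MvPowerSeries (Fin n) K)[X]} (hf : f.Monic) (hirr : Irreducible f) {ξ : C}
    (hξ : f.eval₂ (ψ.comp (MvPowerSeries.expand m hm0).toRingHom) ξ = 0)
    {h : MvPowerSeries (Fin n) K} (hh : ψ h = ξ ^ p ^ k) : IsPuiseux f := by
  have hB := isRadicalBasis_expand (K := K) (n := n) hm0
  have hinj := expand_injective (K := K) (n := n) hm0
  obtain ⟨G, hG, hGirr, hGh⟩ := exists_irreducible_of_isIntegral hB.isIntegral h
  have hsplit := hB.splits hinj hm hG hGirr hGh
  -- With G the minimal polynomial of h, the element ξ is a root of G(y ^ (p ^ k)), so it suffices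
  -- to split that polynomial.
  have hdvd : f ∣ Polynomial.expand _ (p ^ k) G := by
    let _ : Algebra (MvPowerSeries (Fin n) K) C :=
      (ψ.comp (MvPowerSeries.expand m hm0).toRingHom).toAlgebra
    have : FaithfulSMul (MvPowerSeries (Fin n) K) C :=
      (faithfulSMul_iff_algebraMap_injective _ C).mpr (hψ.comp hinj)
    rw [eq_minpoly_of_irreducible hf hirr (ξ := ξ) hξ]
    refine minpoly.isIntegrallyClosed_dvd ⟨f, hf, hξ⟩ ?_
    rw [expand_aeval, ← hh]
    change G.eval₂ (ψ.comp (MvPowerSeries.expand m hm0).toRingHom) (ψ h) = 0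
    rw [← hom_eval₂, hGh, map_zero]
  refine isPuiseux_of_splits hf (mul_ne_zero hp hm0) ?_
  refine Splits.of_dvd ?_ ?_ (Polynomial.map_dvd _ hdvd)
  · have hcomp : (MvPowerSeries.expand (R := K) (σ := Fin n) (p ^ k * m)
        (mul_ne_zero hp hm0)).toRingHom = (MvPowerSeries.expand (p ^ k) hp).toRingHom.comp
          (MvPowerSeries.expand m hm0).toRingHom :=
      RingHom.ext fun a => MvPowerSeries.expand_mul _ hp _ hm0 a
    rw [Polynomial.map_expand, hcomp, ← Polynomial.map_map,
      hsplit.eq_prod_roots_of_monic (hG.map _), Polynomial.map_multiset_prod, map_multiset_prod]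
    refine Splits.multisetProd fun g hg => ?_
    simp only [Multiset.map_map, Multiset.mem_map, Function.comp_apply] at hg
    obtain ⟨θ, -, rfl⟩ := hg
    obtain ⟨g, hg⟩ := exists_pow_eq_expand k hp θ
    have : ExpChar (MvPowerSeries (Fin n) K) p :=
      expChar_of_injective_algebraMap (algebraMap K _).injective p
    -- After p ^ k-th roots of the variables are adjoined, θ becomes a p ^ k-th power because K is
    -- perfect, so the factor is a power of a linear one.
    have h1 : Polynomial.expand _ (p ^ k) (Polynomial.map
        (MvPowerSeries.expand (p ^ k) hp).toRingHom (Polynomial.X - Polynomial.C θ)) =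
          (Polynomial.X - Polynomial.C g) ^ p ^ k := by
      rw [sub_pow_expChar_pow, ← Polynomial.C_pow, hg]
      simp
    rw [h1]
    exact (Splits.X_sub_C g).pow _
  · refine (Monic.map _ ?_).ne_zero
    exact hG.expand (Nat.pos_of_ne_zero hp)

end Inseparable

/-! ### Substitutions with triangular units. -/

section Triangular

open MvPowerSeries

variable {n : ℕ} {K : Type*} [Field K]

theorem twist_comp_expand {q m : ℕ} (hq : q ≠ 0) (hm : m ≠ 0)
    (w : Fin n → MvPowerSeries (Fin n) K) :
    twist (mul_ne_zero hq hm) (fun i => w i ^ m) =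
      (twist hq w).comp (MvPowerSeries.expand m hm) := by
  rw [← twist_one]
  have h := substAlgHom_comp_substAlgHom (R := K) (S := K)
    (hasSubst_X_pow_mul (K := K) (n := n) hm fun _ => 1) (hasSubst_X_pow_mul hq w)
  refine AlgHom.ext fun a => ?_
  have h1 := DFunLike.congr_fun h a
  refine Eq.trans ?_ h1.symm
  rw [twist]
  congr 2
  ext1 i
  rw [mul_one, map_pow, substAlgHom_X, mul_pow,
    ← pow_mul]

theorem constantCoeff_twist {N : ℕ} (hN : N ≠ 0) (u : Fin n → MvPowerSeries (Fin n) K)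
    (g : MvPowerSeries (Fin n) K) : constantCoeff (twist hN u g) = constantCoeff g := by
  rw [← coeff_zero_eq_constantCoeff_apply, coeff_twist]
  have : (Finset.Iic 0 : Finset (Fin n →₀ ℕ)) = {0} := by
    ext; simp
  rw [this, Finset.sum_singleton]
  simp [unitPow]

/-- The substitution preserves constant terms, so a preimage of a unit is a unit, and its inverse
maps to the inverse. -/
theorem inv_mem_range_twist {N : ℕ} (hN : N ≠ 0) {u : Fin n → MvPowerSeries (Fin n) K}
    {g h : MvPowerSeries (Fin n) K} (hg : g ∈ (twist hN u).range) (hgh : g * h = 1) :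
    h ∈ (twist hN u).range := by
  obtain ⟨g', hg'⟩ := hg
  have hg' : twist hN u g' = g := hg'
  have h0 : constantCoeff g ≠ 0 := by
    intro h0
    have := congrArg MvPowerSeries.constantCoeff hgh
    rw [map_mul, h0, zero_mul, map_one] at this
    exact zero_ne_one this
  have h1 : constantCoeff g' ≠ 0 := by
    rwa [← hg', constantCoeff_twist] at h0
  refine ⟨g'⁻¹, ?_⟩
  have h2 := congrArg (twist hN u) (MvPowerSeries.mul_inv_cancel g' h1)
  rw [map_mul, map_one] at h2
  rw [hg'] at h2
  have hg0 : g ≠ 0 := by rintro rfl; simp at h0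
  exact mul_left_cancel₀ hg0 (h2.trans hgh.symm)

/-- The elements whose `p ^ e`-th power lies in a subalgebra. -/
def powPreimage {C : Type*} [CommRing C] [Algebra K C] (p : ℕ) [ExpChar C p] (e : ℕ)
    (S : Subalgebra K C) : Subalgebra K C where
  carrier := {h | h ^ p ^ e ∈ S}
  mul_mem' {a b} ha hb := by
    rw [Set.mem_ofPred_eq, mul_pow]
    exact mul_mem ha hb
  add_mem' {a b} ha hb := by
    rw [Set.mem_ofPred_eq, add_pow_expChar_pow]
    exact add_mem ha hb
  algebraMap_mem' r := by
    rw [Set.mem_ofPred_eq, ← map_pow]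
    exact S.algebraMap_mem _

/-- Induction on i: the substitution sends xᵢ to xᵢ ^ (p ^ k) wᵢ, and wᵢ is a polynomial in earlier
variables. Since Frobenius is additive, a high p-power of wᵢ lies in the range, and so does that of
its inverse. -/
theorem exists_X_pow_mem_range {p : ℕ} [ExpChar K p] {k : ℕ} (hq : p ^ k ≠ 0)
    {w : Fin n → MvPowerSeries (Fin n) K} (hw : ∀ j, w j ∈ Algebra.adjoin K (X '' {l | l < j}))
    (hw1 : ∀ j, constantCoeff (w j) = 1) :
    ∃ e : ℕ, ∀ i, (X i : MvPowerSeries (Fin n) K) ^ p ^ e ∈ (twist hq w).range := by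
  have : ExpChar (MvPowerSeries (Fin n) K) p :=
    expChar_of_injective_algebraMap (algebraMap K _).injective p
  have hmono : ∀ {x : MvPowerSeries (Fin n) K} {e e' : ℕ}, e ≤ e' →
      x ^ p ^ e ∈ (twist hq w).range → x ^ p ^ e' ∈ (twist hq w).range := by
    intro x e e' hee h
    obtain ⟨d, rfl⟩ := Nat.exists_eq_add_of_le hee
    rw [pow_add, pow_mul]
    exact pow_mem h _
  have key : ∀ i : Fin n, ∃ e : ℕ, (X i : MvPowerSeries (Fin n) K) ^ p ^ e ∈
      (twist hq w).range := by
    intro i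
    induction i using WellFoundedLT.induction with
    | ind i ih =>
      choose! e he using ih
      obtain ⟨E, hE⟩ : ∃ E, ∀ l, e l ≤ E := ⟨Finset.univ.sup e, fun l => Finset.le_sup (by simp)⟩
      have h1 : w i ^ p ^ E ∈ (twist hq w).range := by
        have : Algebra.adjoin K (X '' {l | l < i}) ≤ powPreimage p E (twist hq w).range := by
          rw [Algebra.adjoin_le_iff]
          rintro _ ⟨l, hl, rfl⟩
          exact hmono (hE l) (he l hl)
        exact this (hw i)
      have h2 : w i ^ p ^ E * (w i)⁻¹ ^ p ^ E = 1 := by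
        rw [← mul_pow, MvPowerSeries.mul_inv_cancel _ (by rw [hw1]; exact one_ne_zero), one_pow]
      have h3 := inv_mem_range_twist hq h1 h2
      refine ⟨k + E, ?_⟩
      have h4 : (X i : MvPowerSeries (Fin n) K) ^ p ^ (k + E) =
          twist hq w (X i) ^ p ^ E * (w i)⁻¹ ^ p ^ E := by
        rw [twist_X, mul_pow, mul_assoc, h2, mul_one, ← pow_mul, ← pow_add]
      rw [h4]
      exact mul_mem (pow_mem (AlgHom.mem_range_self _ _) _) h3
  choose e he using key
  exact ⟨Finset.univ.sup e, fun i => hmono (Finset.le_sup (Finset.mem_univ i)) (he i)⟩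

theorem monomial_mem_adjoin {s : Set (Fin n)} {α : Fin n →₀ ℕ} (h : ∀ j, j ∉ s → α j = 0) (c : K) :
    (monomial α c : MvPowerSeries (Fin n) K) ∈ Algebra.adjoin K (X '' s) := by
  have h1 : (monomial α c : MvPowerSeries (Fin n) K) = c • monomial α 1 := by
    rw [← map_smul, smul_eq_mul, mul_one]
  rw [h1, monomial_eq_prod]
  refine Subalgebra.smul_mem _ (Subalgebra.prod_mem _ fun i _ => ?_) c
  by_cases hi : i ∈ s
  · exact Subalgebra.pow_mem _ (Algebra.subset_adjoin (Set.mem_image_of_mem _ hi)) _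
  · rw [h i hi, pow_zero]
    exact one_mem _

end Triangular

/-! ### Filtering a lattice by initial coordinates. -/

section Induction

open MvPowerSeries

variable {n : ℕ} {K : Type*} [Field K]

/-- The elements of `P` supported in the first `i` coordinates. -/
def initialPart (P : AddSubgroup (Fin n → ℤ)) (i : ℕ) : AddSubgroup (Fin n → ℤ) where
  carrier := {z | z ∈ P ∧ ∀ j : Fin n, i ≤ j → z j = 0}
  zero_mem' := ⟨zero_mem _, fun _ _ => rfl⟩
  add_mem' {a b} ha hb := ⟨add_mem ha.1 hb.1, fun j hj => by simp [ha.2 j hj, hb.2 j hj]⟩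
  neg_mem' {a} ha := ⟨neg_mem ha.1, fun j hj => by simp [ha.2 j hj]⟩

/-- A vector of the initial part with minimal last coordinate. -/
theorem exists_minimal_vector {N : ℕ} (hN : N ≠ 0) {P : AddSubgroup (Fin n → ℤ)}
    (hP : ∀ z, N • z ∈ P) (i : Fin n) :
    ∃ (a g : Fin n →₀ ℕ) (k : ℕ), castHom n a ∈ initialPart P (i + 1) ∧
      castHom n g ∈ initialPart P i ∧ k • a = g + Finsupp.single i N ∧
      ∀ z ∈ initialPart P (i + 1), ∃ t : ℤ, z - t • castHom n a ∈ initialPart P i := by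
  classical
  let H : AddSubgroup ℤ := (initialPart P (i + 1)).map (Pi.evalAddMonoidHom (fun _ => ℤ) i)
  obtain ⟨r, hr⟩ := Int.subgroup_cyclic H
  have hmem : ∀ x, x ∈ H ↔ ∃ t : ℤ, t * r.natAbs = x := by
    intro x
    have h1 : (∃ t : ℤ, t * r.natAbs = x) ↔ r ∣ x := by
      rw [← Int.natAbs_dvd]
      exact ⟨fun ⟨t, ht⟩ => Dvd.intro_left t ht, fun ⟨t, ht⟩ => ⟨t, by rw [ht, mul_comm]⟩⟩
    rw [h1, hr, AddSubgroup.mem_closure_singleton]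
    exact ⟨fun ⟨t, ht⟩ => Dvd.intro_left t (by simpa using ht),
      fun ⟨t, ht⟩ => ⟨t, by rw [ht, smul_eq_mul, mul_comm]⟩⟩
  have hNH : (N : ℤ) ∈ H := by
    refine ⟨N • Pi.single i 1, ⟨hP _, fun j hj => ?_⟩, by simp⟩
    have : j ≠ i := by rintro rfl; omega
    simp [this]
  obtain ⟨k', hk'⟩ := (hmem N).mp hNH
  obtain ⟨k, hk⟩ : ∃ k : ℕ, k * r.natAbs = N := by
    obtain ⟨k, hk⟩ := Int.natCast_dvd_natCast.mp (Dvd.intro_left _ hk')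
    exact ⟨k, by rw [hk, mul_comm]⟩
  obtain ⟨a₀, ha₀, hai⟩ := (hmem r.natAbs).mpr ⟨1, one_mul _⟩
  have hai : a₀ i = r.natAbs := hai
  -- Adding N |a₀ j| in the other coordinates makes the vector nonnegative without leaving P or the
  -- initial part.
  obtain ⟨a, hadef⟩ : ∃ a : Fin n →₀ ℕ, ∀ j, a j =
      if j = i then r.natAbs else (a₀ j + N * |a₀ j|).toNat :=
    ⟨Finsupp.equivFunOnFinite.symm _, fun _ => rfl⟩
  have hcast : castHom n a = a₀ + N • fun j => if j = i then 0 else |a₀ j| := by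
    ext j
    by_cases hj : j = i
    · simp [hadef, hj, hai]
    · have h1 : 0 ≤ a₀ j + N * |a₀ j| := by
        have : (1 : ℤ) ≤ N := by omega
        nlinarith [neg_abs_le (a₀ j), abs_nonneg (a₀ j)]
      simp [hadef, hj, h1]
  have ha : castHom n a ∈ initialPart P (i + 1) := by
    rw [hcast]
    refine add_mem ha₀ ⟨hP _, fun j hj => ?_⟩
    simp [ha₀.2 j hj]
  have hai' : a i = r.natAbs := by simp [hadef]
  have hg : k • a = (k • a).erase i + Finsupp.single i N := by
    conv_lhs => rw [← Finsupp.erase_add_single i (k • a)]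
    rw [Finsupp.smul_apply, hai', smul_eq_mul, hk]
  refine ⟨a, (k • a).erase i, k, ha, ⟨?_, fun j hj => ?_⟩, hg, fun z hz => ?_⟩
  · have h1 : castHom n ((k • a).erase i) = k • castHom n a - N • Pi.single i 1 := by
      have h2 := congrArg (castHom n) hg
      rw [map_nsmul, map_add] at h2
      rw [eq_sub_iff_add_eq, h2]
      congr 1
      ext j
      by_cases hj : j = i
      · subst hj; simp
      · simp [hj]
    rw [h1]
    exact sub_mem (nsmul_mem ha.1 _) (hP _)
  · by_cases hji : j = i
    · simp [hji]
    · have h2 := ha.2 j (by have : (j : ℕ) ≠ i := fun h => hji (Fin.ext h); omega)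
      rw [castHom_apply] at h2
      simp only [castHom_apply, Finsupp.erase_ne hji, Finsupp.smul_apply, smul_eq_mul]
      push_cast
      rw [h2, mul_zero]
  · obtain ⟨t, ht⟩ := (hmem (z i)).mp ⟨z, hz, rfl⟩
    refine ⟨t, ⟨sub_mem hz.1 (zsmul_mem ha.1 t), fun j hj => ?_⟩⟩
    by_cases hji : j = i
    · subst hji
      rw [Pi.sub_apply, Pi.smul_apply, castHom_apply, hai', smul_eq_mul, ht, sub_self]
    · have hj' : (i : ℕ) + 1 ≤ j := by have : (j : ℕ) ≠ i := fun h => hji (Fin.ext h); omega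
      have h2 := ha.2 j hj'
      rw [Pi.sub_apply, Pi.smul_apply, hz.2 j hj', h2, smul_zero, sub_zero]

end Induction

/-! ### Realizing an arbitrary lattice through triangular units. -/

section Wild

open MvPowerSeries

variable {n : ℕ} {K : Type*} [Field K]

theorem laurent_zsmul (t : ℤ) (z : Fin n → ℤ) : laurent K (t • z) = laurent K z ^ t := by
  rw [laurent, laurent, ← Finset.prod_zpow]
  refine Finset.prod_congr rfl fun i _ => ?_
  rw [← zpow_mul, Pi.smul_apply, smul_eq_mul, mul_comm]

theorem laurent_ne_zero (z : Fin n → ℤ) : laurent K z ≠ 0 :=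
  Finset.prod_ne_zero_iff.mpr fun i _ => zpow_ne_zero _ (algebraMap_X_ne_zero i)

theorem laurent_castHom_single (i : Fin n) (N : ℕ) : laurent K (castHom n (Finsupp.single i N)) =
    algebraMap (MvPowerSeries (Fin n) K) _ (X i) ^ N := by
  rw [laurent_castHom, ← X_pow_eq, map_pow]

/-- The field generated over `K` by the first `i` of the power series `yⱼ`. -/
noncomputable def baseField (y : Fin n → MvPowerSeries (Fin n) K) (i : ℕ) :
    IntermediateField K (FractionRing (MvPowerSeries (Fin n) K)) :=
  IntermediateField.adjoin K {x | ∃ j : Fin n, (j : ℕ) < i ∧ x = algebraMap _ _ (y j)}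

theorem mem_baseField {y : Fin n → MvPowerSeries (Fin n) K} {i : ℕ} {j : Fin n}
    (hj : (j : ℕ) < i) : algebraMap _ _ (y j) ∈ baseField y i :=
  IntermediateField.subset_adjoin _ _ ⟨j, hj, rfl⟩

theorem baseField_le {y : Fin n → MvPowerSeries (Fin n) K} {i : ℕ}
    {M : IntermediateField K (FractionRing (MvPowerSeries (Fin n) K))}
    (h : ∀ j : Fin n, (j : ℕ) < i → algebraMap _ _ (y j) ∈ M) : baseField y i ≤ M := by
  rw [baseField, IntermediateField.adjoin_le_iff]
  rintro _ ⟨j, hj, rfl⟩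
  exact h j hj

/-- By induction wⱼ is algebraic, being a polynomial in earlier variables; dividing by wⱼ ^ m shows
that Xⱼ ^ N is algebraic. -/
theorem isAlgebraic_algebraMap_X {N m : ℕ} (hN : N ≠ 0) {w : Fin n → MvPowerSeries (Fin n) K}
    (hw : ∀ j, w j ∈ Algebra.adjoin K (X '' {l | l < j})) (hw0 : ∀ j, w j ≠ 0) {i : ℕ}
    {F : IntermediateField K (FractionRing (MvPowerSeries (Fin n) K))}
    (hF : ∀ j : Fin n, (j : ℕ) < i → algebraMap _ _ (X j ^ N * w j ^ m) ∈ F) (j : Fin n)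
    (hj : (j : ℕ) < i) :
    IsAlgebraic F (algebraMap _ (FractionRing (MvPowerSeries (Fin n) K))
      (X j : MvPowerSeries (Fin n) K)) := by
  induction j using WellFoundedLT.induction with
  | ind j ih =>
    let S := (algebraicClosure F (FractionRing (MvPowerSeries (Fin n) K))).restrictScalars K
    have hS : ∀ x, x ∈ S ↔ IsAlgebraic F x := fun x => mem_algebraicClosure_iff
    have h1 : Algebra.adjoin K (X '' {l | l < j}) ≤ S.toSubalgebra.comap
        (IsScalarTower.toAlgHom K (MvPowerSeries (Fin n) K) (FractionRing _)) := by
      rw [Algebra.adjoin_le_iff]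
      rintro _ ⟨l, hl, rfl⟩
      exact (hS _).mpr (ih l hl (lt_trans hl hj))
    have h2 : algebraMap (MvPowerSeries (Fin n) K) (FractionRing _) (w j) ∈ S := h1 (hw j)
    have h3 : algebraMap (MvPowerSeries (Fin n) K) (FractionRing _) (X j ^ N * w j ^ m) ∈ S := by
      rw [hS]
      exact isAlgebraic_algebraMap (A := FractionRing (MvPowerSeries (Fin n) K))
        (⟨_, hF j hj⟩ : F)
    have h4 : algebraMap _ (FractionRing (MvPowerSeries (Fin n) K)) (w j) ≠ 0 :=
      (map_ne_zero_iff _ (IsFractionRing.injective _ _)).mpr (hw0 j)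
    have h5 : algebraMap (MvPowerSeries (Fin n) K) (FractionRing _) (X j) ^ N ∈ S := by
      have h6 := div_mem h3 (pow_mem h2 m)
      rwa [map_mul, map_pow, map_pow, mul_div_cancel_right₀ _ (pow_ne_zero _ h4)] at h6
    exact IsAlgebraic.of_pow (Nat.pos_of_ne_zero hN) ((hS _).mp h5)

theorem isAlgebraic_laurent {N m : ℕ} (hN : N ≠ 0) {w : Fin n → MvPowerSeries (Fin n) K}
    (hw : ∀ j, w j ∈ Algebra.adjoin K (X '' {l | l < j})) (hw0 : ∀ j, w j ≠ 0) {i : ℕ}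
    {F : IntermediateField K (FractionRing (MvPowerSeries (Fin n) K))}
    (hF : ∀ j : Fin n, (j : ℕ) < i → algebraMap _ _ (X j ^ N * w j ^ m) ∈ F)
    {z : Fin n → ℤ} (hz : ∀ j : Fin n, i ≤ j → z j = 0) : IsAlgebraic F (laurent K z) := by
  rw [← mem_algebraicClosure_iff, laurent]
  refine prod_mem fun j _ => ?_
  by_cases hj : (j : ℕ) < i
  · exact zpow_mem (mem_algebraicClosure_iff.mpr (isAlgebraic_algebraMap_X hN hw hw0 hF j hj)) _
  · rw [hz j (not_lt.mp hj), zpow_zero]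
    exact one_mem _

/-- There are triangular units `wⱼ` and a monomial with exponent `b` such that the field of Laurent
monomials with exponents in `P` is generated by the `xⱼ ^ N * wⱼ ^ m` and `x ^ b`. -/
theorem exists_triangular_units [Infinite K] {N m : ℕ} (hN : N ≠ 0) (hm : (m : K) ≠ 0)
    {P : AddSubgroup (Fin n → ℤ)} (hP : ∀ z, N • z ∈ P) (i : ℕ) (hi : i ≤ n) :
    ∃ (w : Fin n → MvPowerSeries (Fin n) K) (b : Fin n →₀ ℕ),
      (∀ j, w j ∈ Algebra.adjoin K (X '' {l | l < j})) ∧ (∀ j, constantCoeff (w j) = 1) ∧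
      (∀ j, w j ∈ supported K (natPoints P)) ∧ castHom n b ∈ initialPart P i ∧
      ∀ M : IntermediateField K (FractionRing (MvPowerSeries (Fin n) K)),
        (∀ j : Fin n, (j : ℕ) < i → algebraMap _ _ (X j ^ N * w j ^ m) ∈ M) →
        laurent K (castHom n b) ∈ M → ∀ z ∈ initialPart P i, laurent K z ∈ M := by
  classical
  induction i with
  | zero =>
    refine ⟨fun _ => 1, 0, fun _ => one_mem _, fun _ => map_one _, fun _ => one_mem _,
      by rw [map_zero]; exact zero_mem _, fun M _ _ z hz => ?_⟩
    have : z = 0 := funext fun j => hz.2 j (Nat.zero_le _)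
    rw [this]
    simp [laurent]
  | succ i ih =>
    obtain ⟨w, b, hw, hw1, hwT, hb, hgen⟩ := ih (by omega)
    obtain ⟨a, g, k, ha, hg, hag, hdiv⟩ := exists_minimal_vector hN hP ⟨i, hi⟩
    set F := baseField (fun j => X j ^ N * w j ^ m) i with hF
    have hw0 : ∀ j, w j ≠ 0 := fun j h => by
      have := hw1 j
      rw [h, map_zero] at this
      exact zero_ne_one this
    have hx : laurent K (castHom n g) ∈
        IntermediateField.adjoin F {laurent K (castHom n b)} := by
      refine hgen ((IntermediateField.adjoin F {laurent K (castHom n b)}).restrictScalars K)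
        (fun j hj => ?_) (IntermediateField.mem_adjoin_simple_self F _) _ hg
      exact IntermediateField.algebraMap_mem (IntermediateField.adjoin F _)
        (⟨_, mem_baseField hj⟩ : F)
    -- Here η = x ^ b is the generator from the previous stage and x is the monomial x ^ g, which
    -- lies in F(x ^ b) by induction.
    obtain ⟨c, hc⟩ := exists_mem_adjoin_of_isAlgebraic (K := K) (F := F) hm
      (isAlgebraic_laurent hN hw hw0 (fun j hj => mem_baseField hj) hb.2) (laurent_ne_zero _) hx
    -- If b = 0, then g + b could vanish and spoil the constant term 1; in that case x ^ b = 1 needs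
    -- no recovering.
    let v : MvPowerSeries (Fin n) K := if b = 0 then 1 else 1 + monomial (g + b) c
    have hgb : castHom n (g + b) ∈ initialPart P i := by rw [map_add]; exact add_mem hg hb
    refine ⟨Function.update w ⟨i, hi⟩ v, a, ?_, ?_, ?_, ha, fun M hM haM => ?_⟩
    · intro j
      by_cases hj : j = ⟨i, hi⟩
      · subst hj
        rw [Function.update_self]
        by_cases hb0 : b = 0
        · simp only [v, if_pos hb0]
          exact one_mem _
        · simp only [v, if_neg hb0]
          refine add_mem (one_mem _) (monomial_mem_adjoin (fun l hl => ?_) c)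
          have h1 := hgb.2 l (not_lt.mp hl)
          rw [castHom_apply] at h1
          exact_mod_cast h1
      · rw [Function.update_of_ne hj]
        exact hw j
    · intro j
      by_cases hj : j = ⟨i, hi⟩
      · subst hj
        rw [Function.update_self]
        by_cases hb0 : b = 0
        · simp only [v, if_pos hb0, map_one]
        · simp only [v, if_neg hb0, map_add, map_one]
          rw [← coeff_zero_eq_constantCoeff_apply, MvPowerSeries.coeff_monomial, if_neg, add_zero]
          intro h
          exact hb0 (add_eq_zero.mp h.symm).2
      · rw [Function.update_of_ne hj]
        exact hw1 j
    · intro j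
      by_cases hj : j = ⟨i, hi⟩
      · subst hj
        rw [Function.update_self]
        by_cases hb0 : b = 0
        · simp only [v, if_pos hb0]
          exact one_mem _
        · simp only [v, if_neg hb0]
          exact add_mem (one_mem _) (monomial_mem_supported (mem_natPoints.mpr hgb.1) c)
      · rw [Function.update_of_ne hj]
        exact hwT j
    · have hM' : ∀ j : Fin n, (j : ℕ) < i → algebraMap _ _ (X j ^ N * w j ^ m) ∈ M := by
        intro j hj
        have h1 := hM j (by omega)
        rwa [Function.update_of_ne (fun h => by rw [h] at hj; exact lt_irrefl _ hj)] at h1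
      have hFM : F ≤ M := baseField_le hM'
      have hbM : laurent K (castHom n b) ∈ M := by
        by_cases hb0 : b = 0
        · rw [hb0, map_zero]
          simp [laurent]
        · have h1 := hM ⟨i, hi⟩ (Nat.lt_succ_self i)
          rw [Function.update_self] at h1
          have h2 : laurent K (castHom n a) ^ k = laurent K (castHom n g) *
              algebraMap (MvPowerSeries (Fin n) K) _ (X ⟨i, hi⟩) ^ N := by
            rw [← laurent_castHom_single, ← laurent_add, ← map_add, ← hag, map_nsmul,
              ← natCast_zsmul, laurent_zsmul, zpow_natCast]
          have h3 : algebraMap (MvPowerSeries (Fin n) K) (FractionRing _) v =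
              1 + algebraMap K _ c * (laurent K (castHom n g) * laurent K (castHom n b)) := by
            have h4 : (monomial (g + b) c : MvPowerSeries (Fin n) K) =
                algebraMap K _ c * monomial (g + b) 1 := by
              rw [← Algebra.smul_def, ← map_smul, smul_eq_mul, mul_one]
            simp only [v, if_neg hb0]
            rw [map_add, map_one, h4, map_mul, ← IsScalarTower.algebraMap_apply,
              ← laurent_add, ← map_add, laurent_castHom]
          -- As k a = g + N eᵢ, this is the quotient of the new generator xᵢ ^ N v ^ m by (x ^ a) ^
          -- k. By the choice of c it recovers x ^ b, so x ^ a alone takes over as the generating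
          -- monomial.
          have h4 : (laurent K (castHom n g))⁻¹ * (1 + algebraMap K _ c *
              (laurent K (castHom n g) * laurent K (castHom n b))) ^ m ∈ M := by
            have h5 := div_mem h1 (pow_mem haM k)
            rw [mul_comm] at h2
            rw [h2, map_mul, map_pow, map_pow, h3,
              mul_div_mul_left _ _ (pow_ne_zero _ (algebraMap_X_ne_zero _)), div_eq_mul_inv,
              mul_comm] at h5
            exact h5
          have h5 : IntermediateField.adjoin F {(laurent K (castHom n g))⁻¹ *
            (1 + algebraMap K _ c *
              (laurent K (castHom n g) * laurent K (castHom n b))) ^ m} ≤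
                IntermediateField.extendScalars hFM := by
            rw [IntermediateField.adjoin_simple_le_iff]
            exact h4
          exact h5 hc
      intro z hz
      obtain ⟨t, ht⟩ := hdiv z hz
      have h1 := mul_mem (hgen M hM' hbM _ ht) (zpow_mem haM t)
      rwa [← laurent_zsmul, ← laurent_add, sub_add_cancel] at h1

/-- The root is the monomial x ^ b. The embedding factors as `expand m` followed by the substitution
xᵢ ↦ xᵢ ^ (p ^ k) wᵢ, and a p-power of x ^ b lies in the range of the latter, so its minimal
polynomial is Puiseux. -/
theorem exists_isPuiseux_of_lattice [IsAlgClosed K] {N : ℕ} (hN : N ≠ 0)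
    {P : AddSubgroup (Fin n → ℤ)} (hP : ∀ z, N • z ∈ P) :
    ∃ f : (MvPowerSeries (Fin n) K)[X], IsPuiseux f ∧ Irreducible f ∧
      Nonempty (Normalization (AdjoinRoot f) ≃ₐ[K] supported K (natPoints P)) := by
  obtain ⟨p, hp⟩ := ExpChar.exists K
  obtain ⟨k, m, hm0, hm, rfl⟩ := exists_eq_pow_mul_and_natCast_ne_zero (K := K) p hN
  have hq : p ^ k ≠ 0 := left_ne_zero_of_mul hN
  have : Infinite K := IsAlgClosed.instInfinite
  obtain ⟨w, b, hw, hw1, hwT, hb, hgen⟩ := exists_triangular_units hN hm hP n le_rfl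
  have hu1 : ∀ i, constantCoeff (w i ^ m) = 1 := fun i => by rw [map_pow, hw1, one_pow]
  have hNT : ∀ α, (p ^ k * m) • α ∈ natPoints P := fun α => by
    rw [mem_natPoints, map_nsmul]
    exact hP _
  obtain ⟨f, hf, hirr, hfξ⟩ := exists_irreducible_of_isIntegral
    (isIntegral_twist hN (u := fun i => w i ^ m) hu1) (monomial b 1)
  refine ⟨f, ?_, hirr, (nonempty_normalization_equiv_supported hN (isFull_natPoints P) hNT
    (fun i => pow_mem (hwT i) m) hu1 hf hirr (monomial_mem_supported (mem_natPoints.mpr hb.1) 1)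
    hfξ fun α hα => ?_).2⟩
  · obtain ⟨e, he⟩ := exists_X_pow_mem_range hq hw hw1
    have hmem : (monomial b 1 : MvPowerSeries (Fin n) K) ^ p ^ e ∈ (twist hq w).range := by
      rw [monomial_eq_prod, ← Finset.prod_pow]
      refine prod_mem fun i _ => ?_
      rw [← pow_mul, mul_comm, pow_mul]
      exact pow_mem (he i) _
    obtain ⟨h, hh⟩ := hmem
    refine isPuiseux_of_pow_mem_range (pow_ne_zero e (expChar_pos K p).ne') hm hm0
      (ψ := (twist hq w).toRingHom) (twist_injective hq hw1) hf hirr ?_ hh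
    rw [twist_comp_expand hq hm0] at hfξ
    exact hfξ
  · set L := genField (twist hN fun i => w i ^ m).toRingHom {(monomial b 1 :
      MvPowerSeries (Fin n) K)} with hL
    have hLK : ∀ x : K, algebraMap K _ x ∈ L := fun x => by
      rw [IsScalarTower.algebraMap_apply K (MvPowerSeries (Fin n) K), ← (twist hN _).commutes]
      exact algebraMap_mem_genField _ _ _
    rw [← laurent_castHom]
    refine hgen (L.toIntermediateField hLK) (fun j _ => ?_) ?_ _ ⟨hα, fun j hj => ?_⟩
    · have h1 : algebraMap _ _ (twist hN (fun i => w i ^ m) (X j)) ∈ L :=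
        algebraMap_mem_genField _ _ _
      rw [twist_X] at h1
      exact h1
    · rw [laurent_castHom]
      exact mem_genField_of_mem _ (Set.mem_singleton _)
    · exact absurd j.2 (not_lt.mpr hj)

end Wild

/-! ### From a simplicial pair to a Puiseux polynomial, and the final assembly. -/

theorem exists_isPuiseux_analyticallyIsomorphic {n : ℕ} {K : Type*} [Field K] [IsAlgClosed K]
    {M : AddSubgroup (Fin n → ℚ)} {v : Fin n → Fin n → ℤ} (h : IsSimplicialPair M v) :
    ∃ f : (MvPowerSeries (Fin n) K)[X], IsPuiseux f ∧ Irreducible f ∧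
      (¬ ringChar K ∣ (rayLattice M v).relIndex M → ¬ ringChar K ∣ f.natDegree) ∧
      ∃ _ : IsLocalRing (Normalization (AdjoinRoot f)),
        AnalyticallyIsomorphic K (IsLocalRing.maximalIdeal (Normalization (AdjoinRoot f)))
          (specialIdeal K (semigroup M (cone v))) := by
  by_cases hk : ringChar K ∣ (rayLattice M v).relIndex M
  -- No degree condition is required here, so any common denominator works and the vᵢ themselves
  -- serve as coordinate vectors.
  · obtain ⟨N, hN, hM⟩ := exists_common_denominator h
    obtain ⟨ε⟩ := nonempty_semigroup_equiv h.linearIndependent hN (r := fun _ => 1)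
      (fun _ => one_pos) fun α hα => by simpa only [one_mul] using hM hα
    set P := M.comap (latMap N fun i j => 1 * (v i j : ℚ)) with hPdef
    have hP : ∀ z, N • z ∈ P := nsmul_mem_natPoints_comap
      (fun i => by simpa only [one_mul] using h.int_mem (v i)) hN
    have hNT : ∀ α, N • α ∈ natPoints P := fun α => by
      rw [mem_natPoints, map_nsmul]
      exact hP _
    obtain ⟨f, hf, hirr, ⟨e⟩⟩ := exists_isPuiseux_of_lattice (K := K) hN hP
    exact ⟨f, hf, hirr, fun h => absurd hk h, exists_isLocalRing_of_algEquiv (isFull_natPoints P)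
      (fg_of_isFull hN (isFull_natPoints P) hNT) e ε⟩
  -- With primitive ray generators as coordinate vectors, the index can be used as N. It is prime to
  -- the characteristic, and so is every divisor of N ^ n.
  · obtain ⟨r, hr, hrM, hgen⟩ := exists_ray_generators h
    set N := (rayLattice M v).relIndex M with hNdef
    have hN : N ≠ 0 := fun h => hk (h ▸ dvd_zero _)
    have hNK : (N : K) ≠ 0 := by rwa [Ne, ringChar.spec]
    obtain ⟨ε⟩ := nonempty_semigroup_equiv h.linearIndependent hN hr fun α hα =>
      le_range_latMap_relIndex hN hgen hα
    set P := M.comap (latMap N fun i j => r i * (v i j : ℚ)) with hPdef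
    have hNT : ∀ α, N • α ∈ natPoints P := fun α => by
      rw [mem_natPoints, map_nsmul]
      exact nsmul_mem_natPoints_comap hrM hN _
    obtain ⟨f, hf, hirr, hdeg, ⟨e⟩⟩ := exists_isPuiseux_of_natCast_ne_zero hNK hNT
    refine ⟨f, hf, hirr, fun _ hd => ?_, exists_isLocalRing_of_algEquiv (isFull_natPoints P)
      (fg_of_isFull hN (isFull_natPoints P) hNT) e ε⟩
    have h1 : ((N ^ n : ℕ) : K) = 0 := (ringChar.spec K _).mpr (hd.trans hdeg)
    rw [Nat.cast_pow] at h1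
    exact pow_ne_zero n hNK h1

end PuiseuxHypersurface

open PuiseuxHypersurface in
theorem theorem5p2 {K : Type*} [Field K] [IsAlgClosed K] (n : ℕ) :
    (∀ f : Polynomial (MvPowerSeries (Fin n) K),
      IsPuiseux f → Irreducible f → ¬ ringChar K ∣ f.natDegree →
        ∃ _ : IsLocalRing (Normalization (AdjoinRoot f)),
          IsRegularLocalRing (Normalization (AdjoinRoot f)) ∨
            IsHirzebruchJung K n (Normalization (AdjoinRoot f))) ∧
    (∀ (R : Type*) [CommRing R] [Algebra K R] [IsLocalRing R]
      (M : AddSubgroup (Fin n → ℚ)) (v : Fin n → Fin n → ℤ), IsHirzebruchJungOf K M v R →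
        ∃ f : Polynomial (MvPowerSeries (Fin n) K),
          IsPuiseux f ∧ Irreducible f ∧
          (¬ ringChar K ∣ (rayLattice M v).relIndex M → ¬ ringChar K ∣ f.natDegree) ∧
          ∃ _ : IsLocalRing (Normalization (AdjoinRoot f)),
            AnalyticallyIsomorphic K (IsLocalRing.maximalIdeal R)
              (IsLocalRing.maximalIdeal (Normalization (AdjoinRoot f)))) := by
  refine ⟨fun f hf hirr hd => isRegularLocalRing_or_isHirzebruchJung hf hirr hd,
    fun R _ _ _ M v hR => ?_⟩
  obtain ⟨f, hf, hirr, hd, hloc, hiso⟩ :=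
    exists_isPuiseux_analyticallyIsomorphic (K := K) hR.pair
  exact ⟨f, hf, hirr, hd, hloc, hR.analyticallyIsomorphic.trans hiso.symm⟩
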